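/- For a positive integer $n$, let $A$ be a random subset of $\mathbb{F}_2^n$ that contains each element of $\mathbb{F}_2^n$ with probability $\frac12$, independently of the other elements. The random Cayley graph on $\mathbb{F}_2^n$ is the graph with vertex set $\mathbb{F}_2^n$ in which two distinct vertices $x, y$ are adjacent if and only if $x+y\in A$. Let $\omega_n$ denote its clique number, that is, the number of vertices of its largest complete subgraph. All logarithms are to base $2$. There exists a strictly increasing sequence $(n_l)$ of integers with $n_l\ge 2$, of natural density $1$ (that is, $\lim_{N\to\infty}\frac{1}{N}\,|\{n_0,n_1,n_2,\dots\}\cap\{1,\dots,N\}| = 1$), such that $$\lim_{l\to\infty}\mathbb{P}\left(\omega_{n_l} = 2^{\lfloor \log n_l+\log\log n_l\rfloor}\right)= 1.$$ -/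

import Mathlib

open Filter Topology MeasureTheory ProbabilityTheory

/-- The Cayley sum graph of a set `A` in an abelian group `G`: the vertex set is `G`, and
distinct `x`, `y` are adjacent if and only if `x + y ∈ A`. -/
def cayleySumGraph {G : Type*} [AddCommGroup G] (A : Set G) : SimpleGraph G where
  Adj x y := x ≠ y ∧ x + y ∈ A
  symm := ⟨fun x y h => ⟨h.1.symm, by rw [add_comm]; exact h.2⟩⟩
  loopless := ⟨fun _ h => h.1 rfl⟩

/-- The number `1/2`, as a point of the unit interval. -/
noncomputable def halfProb : unitInterval :=
  ⟨1 / 2, by norm_num, by norm_num⟩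

/-- The law of the random subset of `𝔽₂ⁿ` that contains each element with probability `1/2`,
independently of the other elements. -/
noncomputable def randomSubsetLaw (n : ℕ) : Measure (Set (Fin n → ZMod 2)) :=
  setBernoulli Set.univ halfProb

/-- The probability that the clique number of the random Cayley graph on `𝔽₂ⁿ` equals `k`. -/
noncomputable def probCliqueNumEq (n k : ℕ) : ℝ :=
  (randomSubsetLaw n).real {A | (cayleySumGraph A).cliqueNum = k}

/-- The set `A` of positive integers has natural density `d`, i.e.
`|A ∩ {1, …, N}| / N → d` as `N → ∞`. -/
def HasNaturalDensity (A : Set ℕ) (d : ℝ) : Prop :=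
  Tendsto (fun N : ℕ => ((A ∩ Set.Icc 1 N).ncard : ℝ) / (N : ℝ)) atTop (𝓝 d)

/-! Write k = ⌊log n + log log n⌋, so that 2^k ≤ n log n < 2^(k+1) and k is close to log n. A clique
is a set X such that A contains every nonzero element of X + X.

Lower bound. If A contains all nonzero vectors of a k-dimensional subspace, that subspace is a
clique of size 2^k. A second moment argument over injective linear maps from 𝔽₂^k
(`randomSubsetLaw_real_cliqueNum_lt_le`) shows that such a subspace exists with high probability
once 2^k + 4k² ≤ nk.

Upper bound. There are far too many sets X of size 2^k + 1 for a direct union bound. Instead, each X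
+ X is shown to contain a set S from a family of at most 2^a sets, where |S| ≥ a + n. The union
bound then runs over these S (`randomSubsetLaw_real_lt_cliqueNum_le`). By
`exists_cheap_or_structured`, S has one of two forms. A cheap S is Y + Y, with Y ⊆ X described by a
basis of a subspace, by points Y₁ of that subspace, and by further points of Y₁ + Y₁ + Y₁. A
structured S comes from a bounded number of cosets of one subspace and one extra vector, after
deleting polylogarithmically many points in 2^k; it has nearly 2^(k+1) elements.

To prove the dichotomy, suppose X has no cheap sumset. An isoperimetric inequality forces the span
of X to have dimension O(k). A hitting set argument covers the popular sums of X by Y + Y for a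
small Y ⊆ X, so there are only O(2^k) of them. Hence almost all of X lies in a core of bounded
doubling, whose span has dimension k + O(1). In that dimension the same covering bounds the popular
sums by nk + O(n), which is less than (2 - δ/2) 2^k. A second core therefore has doubling constant
below 2, so its sumset has a stabiliser of size comparable to 2^k. Saturating this core under the
stabiliser gives exactly 2^k points, and a point of X outside them brings the sumset up to nearly
2^(k+1).

Density. The upper bound needs a margin (1 + δ) nk ≤ 2^(k+1). It fails only when n log n is just
below a power of two, and such n have upper density O(δ). A diagonal argument lets δ and the error
probability tend to 0. -/

open scoped Pointwise

/-! ### Small hitting sets for families of large sets. -/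

section Hitting
variable {α ι : Type*} [DecidableEq α]

/-- If each set `B i ⊆ X` has at least `β` elements, some `t` elements of `X` miss at most a
proportion `(1 - β / |X|) ^ t` of the sets. -/
theorem exists_subset_few_disjoint {X : Finset α} (hX : X.Nonempty) (I : Finset ι)
    (B : ι → Finset α) (hB : ∀ i ∈ I, B i ⊆ X) {β : ℕ} (hβ : ∀ i ∈ I, β ≤ (B i).card) (t : ℕ) :
    ∃ U ⊆ X, U.card ≤ t ∧
      ({i ∈ I | Disjoint (B i) U}.card : ℝ) * X.card ^ t ≤ I.card * ((X.card : ℝ) - β) ^ t := by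
  induction t with
  | zero => exact ⟨∅, by simp, by simp, by simp⟩
  | succ t ih =>
    obtain ⟨U, hUX, hUt, hU⟩ := ih
    set J := {i ∈ I | Disjoint (B i) U} with hJ
    have hm : (0 : ℝ) < X.card := by exact_mod_cast hX.card_pos
    have hsum : ∑ x ∈ X, ({i ∈ J | x ∈ B i}.card) = ∑ i ∈ J, (B i).card := by
      have := Finset.sum_card_bipartiteAbove_eq_sum_card_bipartiteBelow (s := X) (t := J)
        (fun x i => x ∈ B i)
      simp only [Finset.bipartiteAbove, Finset.bipartiteBelow] at this
      rw [this]
      refine Finset.sum_congr rfl fun i hi => ?_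
      congr 1
      ext x
      simp only [Finset.mem_filter, and_iff_right_iff_imp]
      exact fun hx => hB i (Finset.mem_filter.1 hi).1 hx
    obtain ⟨x, hx, hxJ⟩ : ∃ x ∈ X, β * J.card ≤ {i ∈ J | x ∈ B i}.card * X.card := by
      by_contra! h
      have h1 : ∑ x ∈ X, {i ∈ J | x ∈ B i}.card * X.card < ∑ x ∈ X, β * J.card :=
        Finset.sum_lt_sum_of_nonempty hX h
      rw [← Finset.sum_mul, hsum, Finset.sum_const, smul_eq_mul, mul_comm] at h1
      have h2 := lt_of_mul_lt_mul_left h1 (Nat.zero_le _)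
      have h3 : J.card * β ≤ ∑ i ∈ J, (B i).card := by
        rw [← smul_eq_mul]
        exact Finset.card_nsmul_le_sum _ _ _ fun i hi => hβ i (Finset.mem_filter.1 hi).1
      linarith [mul_comm β J.card]
    refine ⟨insert x U, Finset.insert_subset hx hUX,
      (Finset.card_insert_le _ _).trans (by omega), ?_⟩
    have hJ' : ({i ∈ I | Disjoint (B i) (insert x U)}.card : ℝ) + {i ∈ J | x ∈ B i}.card
        = J.card := by
      have : {i ∈ I | Disjoint (B i) (insert x U)} = {i ∈ J | ¬ x ∈ B i} := by
        ext i
        simp only [hJ, Finset.mem_filter, Finset.disjoint_insert_right]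
        tauto
      rw [this, add_comm]
      exact_mod_cast Finset.card_filter_add_card_filter_not _
    by_cases hI : I.Nonempty
    · obtain ⟨i, hi⟩ := hI
      have hβm : (β : ℝ) ≤ X.card := by
        exact_mod_cast (hβ i hi).trans (Finset.card_le_card (hB i hi))
      have h4 : (β : ℝ) * J.card ≤ {i ∈ J | x ∈ B i}.card * X.card := by exact_mod_cast hxJ
      calc ({i ∈ I | Disjoint (B i) (insert x U)}.card : ℝ) * X.card ^ (t + 1)
          = (J.card - {i ∈ J | x ∈ B i}.card) * X.card * X.card ^ t := by rw [← hJ']; ring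
        _ ≤ (J.card * ((X.card : ℝ) - β)) * X.card ^ t := by
          gcongr ?_ * _
          linarith
        _ = (J.card * X.card ^ t) * ((X.card : ℝ) - β) := by ring
        _ ≤ (I.card * ((X.card : ℝ) - β) ^ t) * ((X.card : ℝ) - β) := by
          gcongr
        _ = _ := by ring
    · rw [Finset.not_nonempty_iff_eq_empty] at hI
      simp [hI]

/-- After t greedy choices the proportion of sets missed is at most exp(-βt/|X|) ≤ e^(-a). This is
below 2^(-a), so fewer than one set is missed. -/
theorem exists_subset_all_hit {X : Finset α} (hX : X.Nonempty) (I : Finset ι)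
    (B : ι → Finset α) (hB : ∀ i ∈ I, B i ⊆ X) {β : ℕ} (hβ : ∀ i ∈ I, β ≤ (B i).card)
    {a t : ℕ} (ha : 0 < a) (hI : I.card ≤ 2 ^ a) (ht : a * X.card ≤ β * t) :
    ∃ U ⊆ X, U.card ≤ t ∧ ∀ i ∈ I, ∃ x ∈ U, x ∈ B i := by
  obtain ⟨U, hUX, hUt, hU⟩ := exists_subset_few_disjoint hX I B hB hβ t
  refine ⟨U, hUX, hUt, ?_⟩
  by_contra! h
  obtain ⟨i, hi, hiU⟩ := h
  have hm : (0 : ℝ) < X.card := by exact_mod_cast hX.card_pos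
  have hβm : (β : ℝ) ≤ X.card := by
    exact_mod_cast (hβ i hi).trans (Finset.card_le_card (hB i hi))
  have h1 : (1 : ℝ) ≤ {i ∈ I | Disjoint (B i) U}.card := by
    have : 0 < {i ∈ I | Disjoint (B i) U}.card := by
      rw [Finset.card_pos]
      exact ⟨i, Finset.mem_filter.2 ⟨hi, Finset.disjoint_left.2 fun x hx hxU => hiU x hxU hx⟩⟩
    exact_mod_cast this
  have h2 : (X.card : ℝ) - β ≤ X.card * Real.exp (-(β / X.card)) := by
    have := Real.add_one_le_exp (-(β / X.card : ℝ))
    calc (X.card : ℝ) - β = X.card * (-(β / X.card) + 1) := by field_simp; ring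
      _ ≤ _ := by gcongr
  have h3 : ((X.card : ℝ) - β) ^ t ≤ X.card ^ t * Real.exp (-a) := by
    calc ((X.card : ℝ) - β) ^ t ≤ (X.card * Real.exp (-(β / X.card))) ^ t := by
          gcongr
      _ = X.card ^ t * Real.exp (t * -(β / X.card)) := by rw [mul_pow, Real.exp_nat_mul]
      _ ≤ X.card ^ t * Real.exp (-a) := by
          gcongr
          have : (a : ℝ) * X.card ≤ β * t := by exact_mod_cast ht
          have : (a : ℝ) ≤ β * t / X.card := by rwa [le_div_iff₀ hm]
          linarith [show (t : ℝ) * -(β / X.card) = -(β * t / X.card) by ring]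
  have h4 : (I.card : ℝ) * Real.exp (-a) < 1 := by
    have h5 : (I.card : ℝ) ≤ 2 ^ a := by exact_mod_cast hI
    have h6 : (2 : ℝ) ^ a < Real.exp a := by
      rw [← Real.exp_one_pow]
      exact pow_lt_pow_left₀ (by linarith [Real.exp_one_gt_d9]) (by norm_num) ha.ne'
    rw [Real.exp_neg, ← div_eq_mul_inv, div_lt_one (Real.exp_pos _)]
    linarith
  have h7 : (0 : ℝ) < X.card ^ t := by positivity
  have : (1 : ℝ) * X.card ^ t ≤ I.card * Real.exp (-a) * X.card ^ t := by
    calc (1 : ℝ) * X.card ^ t ≤ _ := by gcongr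
      _ ≤ _ := hU
      _ ≤ I.card * (X.card ^ t * Real.exp (-a)) := by gcongr
      _ = _ := by ring
  nlinarith

theorem exists_pairwiseDisjoint_subsets (R : Finset α) {s b : ℕ} (h : s * b ≤ R.card) :
    ∃ f : Fin s → Finset α, (∀ i, f i ⊆ R) ∧ (∀ i, b = (f i).card) ∧
      ∀ i j, i ≠ j → Disjoint (f i) (f j) := by
  have : Nonempty (Fin s × Fin b ↪ R) :=
    Function.Embedding.nonempty_of_card_le (by simpa using h)
  obtain ⟨e⟩ := this
  refine ⟨fun i => Finset.univ.image fun j => (e (i, j) : α), fun i x hx => ?_, fun i => ?_,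
    fun i j hij => ?_⟩
  · obtain ⟨j, -, rfl⟩ := Finset.mem_image.1 hx
    exact (e (i, j)).2
  · rw [Finset.card_image_of_injective]
    · simp
    · intro j j' hj
      simpa using e.injective (Subtype.ext hj)
  · rw [Finset.disjoint_left]
    rintro x hx hx'
    obtain ⟨a, -, rfl⟩ := Finset.mem_image.1 hx
    obtain ⟨c, -, hc⟩ := Finset.mem_image.1 hx'
    have := e.injective (Subtype.ext hc)
    exact hij (by simpa using (congrArg Prod.fst this).symm)

end Hitting

/-! ### Sumset lower bounds and popular sums in characteristic two. -/

section CharTwo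
variable {V : Type*} [AddCommGroup V] [Module (ZMod 2) V]

theorem zmodTwo_ne_zero_iff (a : ZMod 2) : a ≠ 0 ↔ a = 1 := by
  revert a; decide

/-- Each vector is detected by some functional. If neither functional detects both vectors, their
sum does. -/
theorem exists_dual_eq_one {u v : V} (hu : u ≠ 0) (hv : v ≠ 0) :
    ∃ φ : Module.Dual (ZMod 2) V, φ u = 1 ∧ φ v = 1 := by
  have key : ∀ w : V, w ≠ 0 → ∃ φ : Module.Dual (ZMod 2) V, φ w = 1 := by
    intro w hw
    by_contra! h
    exact hw ((Module.forall_dual_apply_eq_zero_iff (ZMod 2) w).1 fun φ => by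
      by_contra h'
      exact h φ ((zmodTwo_ne_zero_iff _).1 h'))
  obtain ⟨φ, hφ⟩ := key u hu
  obtain ⟨ψ, hψ⟩ := key v hv
  by_cases h1 : φ v = 1
  · exact ⟨φ, hφ, h1⟩
  by_cases h2 : ψ u = 1
  · exact ⟨ψ, h2, hψ⟩
  · rw [← zmodTwo_ne_zero_iff, not_not] at h1 h2
    exact ⟨φ + ψ, by simp [hφ, h2], by simp [hψ, h1]⟩

theorem add_add_cancel_two (x y : V) : x + (x + y) = y := by
  rw [← add_assoc, ZModModule.add_self, zero_add]

variable [DecidableEq V]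

/-- A power-of-two case of the Hopf–Stiefel type bound, by induction. Choose a functional that is
nonconstant on both A and B. Each of its two fibres on A + B receives two pairings of half-sets
whose sizes total more than 2^(k+1), so one pairing exceeds 2^k and the induction hypothesis applies
to it. -/
theorem two_pow_le_card_add (k : ℕ) : ∀ A B : Finset V, A.Nonempty → B.Nonempty →
    2 ^ k < A.card + B.card → 2 ^ k ≤ (A + B).card := by
  induction k with
  | zero =>
    intro A B hA hB _
    simpa using (hA.add hB).card_pos
  | succ k ih =>
    intro A B hA hB h
    by_cases hA1 : A.card ≤ 1
    · have := Finset.card_le_card_add_left (t := B) hA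
      omega
    by_cases hB1 : B.card ≤ 1
    · have := Finset.card_le_card_add_right (s := A) hB
      omega
    obtain ⟨a, ha, a', ha', haa⟩ := Finset.one_lt_card.1 (not_le.1 hA1)
    obtain ⟨b, hb, b', hb', hbb⟩ := Finset.one_lt_card.1 (not_le.1 hB1)
    obtain ⟨φ, h1, h2⟩ := exists_dual_eq_one (sub_ne_zero.2 haa) (sub_ne_zero.2 hbb)
    have two : ∀ z : ZMod 2, z = 0 ∨ z = 1 := by decide
    have nonempty : ∀ (C : Finset V) (c c' : V), c ∈ C → c' ∈ C → φ (c - c') = 1 →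
        ∀ i : ZMod 2, {x ∈ C | φ x = i}.Nonempty := by
      intro C c c' hc hc' h i
      rw [map_sub] at h
      by_cases hi : φ c = i
      · exact ⟨c, by simp [hc, hi]⟩
      · refine ⟨c', Finset.mem_filter.2 ⟨hc', ?_⟩⟩
        generalize φ c = x at h hi
        generalize φ c' = y at h
        revert x y i
        decide
    have split : ∀ C : Finset V, {x ∈ C | φ x = 0}.card + {x ∈ C | φ x = 1}.card = C.card := by
      intro C
      rw [← Finset.card_filter_add_card_filter_not (s := C) (fun x => φ x = 0)]
      congr 2
      ext x
      simp [zmodTwo_ne_zero_iff]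
    have incl : ∀ i j : ZMod 2, {x ∈ A | φ x = i} + {x ∈ B | φ x = j} ⊆
        {x ∈ A + B | φ x = i + j} := by
      intro i j x hx
      obtain ⟨y, hy, z, hz, rfl⟩ := Finset.mem_add.1 hx
      simp only [Finset.mem_filter] at hy hz ⊢
      exact ⟨Finset.add_mem_add hy.1 hz.1, by simp [hy.2, hz.2]⟩
    have hA' := nonempty A a a' ha ha' h1
    have hB' := nonempty B b b' hb hb' h2
    have main : ∀ i j : ZMod 2, 2 ^ k < {x ∈ A | φ x = i}.card + {x ∈ B | φ x = j}.card →
        2 ^ k ≤ {x ∈ A + B | φ x = i + j}.card := fun i j hij =>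
      (ih _ _ (hA' i) (hB' j) hij).trans (Finset.card_le_card (incl i j))
    have e0 : 2 ^ k ≤ {x ∈ A + B | φ x = 0}.card := by
      by_cases hc : 2 ^ k < {x ∈ A | φ x = 0}.card + {x ∈ B | φ x = 0}.card
      · simpa using main 0 0 hc
      · have := main 1 1 (by have := split A; have := split B; rw [pow_succ] at h; omega)
        rwa [show (1 : ZMod 2) + 1 = 0 by decide] at this
    have e1 : 2 ^ k ≤ {x ∈ A + B | φ x = 1}.card := by
      by_cases hc : 2 ^ k < {x ∈ A | φ x = 0}.card + {x ∈ B | φ x = 1}.card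
      · simpa using main 0 1 hc
      · simpa using main 1 0 (by have := split A; have := split B; rw [pow_succ] at h; omega)
    have := split (A + B)
    rw [pow_succ]
    omega

/-- Every element with at least `s * b` representations as a sum of two elements of `X` is
also a sum of two elements of a small subset of `X`. -/
theorem exists_small_subset_covering_popular {X : Finset V} (hX : X.Nonempty) (P : Finset V)
    {s b a t₁ t₂ : ℕ} (hP : ∀ z ∈ P, s * b ≤ {x ∈ X | z + x ∈ X}.card) (ha : 0 < a)
    (hPa : P.card * s ≤ 2 ^ a) (hs : 0 < s) (h₁ : a * X.card ≤ b * t₁)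
    (h₂ : a * X.card ≤ s * t₂) :
    ∃ Y ⊆ X, Y.card ≤ t₁ + t₂ ∧ P ⊆ Y + Y := by
  classical
  have hf : ∀ z : V, ∃ f : Fin s → Finset V, z ∈ P →
      (∀ i, f i ⊆ {x ∈ X | z + x ∈ X}) ∧ (∀ i, b = (f i).card) ∧
      ∀ i j, i ≠ j → Disjoint (f i) (f j) := by
    intro z
    by_cases hz : z ∈ P
    · obtain ⟨f, hf⟩ := exists_pairwiseDisjoint_subsets _ (hP z hz)
      exact ⟨f, fun _ => hf⟩
    · exact ⟨fun _ => ∅, fun h => absurd h hz⟩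
  choose f hf using hf
  -- The representations of each z contain s disjoint blocks of size b. Hitting every block puts at
  -- least s of these representations in U.
  obtain ⟨U, hUX, hUt, hU⟩ := exists_subset_all_hit hX (P ×ˢ (Finset.univ : Finset (Fin s)))
    (fun zi => f zi.1 zi.2)
    (fun zi hzi => ((hf zi.1 (Finset.mem_product.1 hzi).1).1 zi.2).trans (Finset.filter_subset _ _))
    (β := b) (fun zi hzi => ((hf zi.1 (Finset.mem_product.1 hzi).1).2.1 zi.2).le) ha
    (by simpa using hPa) h₁
  -- The partners z + u of the points u just found form at least s elements of X. Hitting one of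
  -- them writes z as a sum from U and W.
  obtain ⟨W, hWX, hWt, hW⟩ := exists_subset_all_hit hX P
    (fun z => ({x ∈ X | z + x ∈ X} ∩ U).image fun x => z + x)
    (by
      intro z _ x hx
      obtain ⟨y, hy, rfl⟩ := Finset.mem_image.1 hx
      exact (Finset.mem_filter.1 (Finset.mem_inter.1 hy).1).2)
    (β := s) (by
      intro z hz
      rw [Finset.card_image_of_injective _ (add_right_injective z)]
      have : ∀ i : Fin s, ∃ x ∈ U, x ∈ f z i := fun i =>
        hU (z, i) (Finset.mem_product.2 ⟨hz, Finset.mem_univ _⟩)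
      choose g hgU hg using this
      have hinj : Function.Injective g := by
        intro i j hij
        by_contra hne
        exact Finset.disjoint_left.1 ((hf z hz).2.2 i j hne) (hg i) (hij ▸ hg j)
      calc s = (Finset.univ.image g).card := by
            rw [Finset.card_image_of_injective _ hinj]; simp
        _ ≤ _ := Finset.card_le_card fun x hx => by
            obtain ⟨i, -, rfl⟩ := Finset.mem_image.1 hx
            exact Finset.mem_inter.2 ⟨(hf z hz).1 i (hg i), hgU i⟩)
    ha (by nlinarith) h₂
  refine ⟨U ∪ W, Finset.union_subset hUX hWX, (Finset.card_union_le _ _).trans (by omega), ?_⟩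
  intro z hz
  obtain ⟨x, hxW, hx⟩ := hW z hz
  obtain ⟨u, hu, rfl⟩ := Finset.mem_image.1 hx
  refine Finset.mem_add.2 ⟨u, Finset.mem_union_left _ (Finset.mem_inter.1 hu).2, z + u,
    Finset.mem_union_right _ hxW, ?_⟩
  rw [add_comm z u, add_add_cancel_two]

end CharTwo

/-! ### Edge isoperimetry along linearly independent directions. -/

/-- If (M₀ + M₁)/M₁ ≥ e^(1/α), the first logarithm is at least 1/α and its term pays for M₁.
Otherwise M₁ is a fixed proportion of M₀ + M₁, so the second logarithm is bounded below and its term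
pays for m₀. -/
theorem min_le_mul_log_add {M₀ M₁ m₀ α : ℝ} (hα : 0 < α) (hM₀ : 0 < M₀) (hM₁ : 0 < M₁)
    (hm₀ : 0 ≤ m₀) :
    min m₀ M₁ ≤ α * M₁ * Real.log ((M₀ + M₁) / M₁) +
      Real.exp (1 / α) * m₀ * Real.log ((M₀ + M₁) / M₀) := by
  have hl₀ : 0 ≤ Real.log ((M₀ + M₁) / M₀) :=
    Real.log_nonneg (by rw [le_div_iff₀ hM₀]; linarith)
  have hl₁ : 0 ≤ Real.log ((M₀ + M₁) / M₁) :=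
    Real.log_nonneg (by rw [le_div_iff₀ hM₁]; linarith)
  have he := Real.exp_pos (1 / α)
  rcases le_total (Real.exp (1 / α)) ((M₀ + M₁) / M₁) with h | h
  · have h1 : 1 / α ≤ Real.log ((M₀ + M₁) / M₁) := by
      rw [Real.le_log_iff_exp_le (by positivity)]; exact h
    calc min m₀ M₁ ≤ M₁ := min_le_right _ _
      _ = α * M₁ * (1 / α) := by field_simp
      _ ≤ α * M₁ * Real.log ((M₀ + M₁) / M₁) := by gcongr
      _ ≤ _ := le_add_of_nonneg_right (by positivity)
  · have h1 : M₁ / (M₀ + M₁) ≤ Real.log ((M₀ + M₁) / M₀) := by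
      have := Real.one_sub_inv_le_log_of_pos (show 0 < (M₀ + M₁) / M₀ by positivity)
      convert this using 1
      field_simp
      ring
    have h2 : 1 ≤ Real.exp (1 / α) * (M₁ / (M₀ + M₁)) := by
      rw [div_le_iff₀ hM₁] at h
      rw [← mul_div_assoc, le_div_iff₀ (by positivity)]
      linarith
    calc min m₀ M₁ ≤ m₀ := min_le_left _ _
      _ = 1 * m₀ := (one_mul _).symm
      _ ≤ (Real.exp (1 / α) * (M₁ / (M₀ + M₁))) * m₀ := by gcongr
      _ ≤ (Real.exp (1 / α) * Real.log ((M₀ + M₁) / M₀)) * m₀ := by gcongr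
      _ = Real.exp (1 / α) * m₀ * Real.log ((M₀ + M₁) / M₀) := by ring
      _ ≤ _ := le_add_of_nonneg_left (by positivity)

/-- The induction step of the isoperimetric inequality. -/
theorem entropy_split {M₀ M₁ m₀ m₁ α f₀ f₁ : ℝ} (hα : 0 < α) (hM₀ : 0 ≤ M₀) (hM₁ : 0 ≤ M₁)
    (h₀' : M₀ = 0 ∨ 1 ≤ M₀) (h₁' : M₁ = 0 ∨ 1 ≤ M₁)
    (hm₀ : 0 ≤ m₀) (hm₁ : 0 ≤ m₁)
    (hf₀ : f₀ ≤ (α * M₀ + Real.exp (1 / α) * m₀) * (1 + Real.log M₀))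
    (hf₁ : f₁ ≤ (α * M₁ + Real.exp (1 / α) * m₁) * (1 + Real.log M₁))
    (hz₀ : M₀ = 0 → f₀ = 0) (hz₁ : M₁ = 0 → f₁ = 0) :
    f₀ + f₁ + min m₀ M₁ + min m₁ M₀ ≤
      (α * (M₀ + M₁) + Real.exp (1 / α) * (m₀ + m₁)) * (1 + Real.log (M₀ + M₁)) := by
  have he : 1 ≤ Real.exp (1 / α) := Real.one_le_exp (by positivity)
  rcases h₀' with rfl | h₀
  · rcases h₁' with rfl | h₁
    · rw [hz₀ rfl, hz₁ rfl, min_eq_right hm₀, min_eq_right hm₁]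
      simp only [add_zero, Real.log_zero, mul_zero, zero_add, mul_one]
      positivity
    · have hl := Real.log_nonneg h₁
      rw [hz₀ rfl, min_eq_right hm₁, zero_add]
      have : min m₀ M₁ ≤ Real.exp (1 / α) * m₀ * (1 + Real.log M₁) := by
        refine (min_le_left _ _).trans ?_
        nlinarith [mul_nonneg hm₀ hl, mul_nonneg (mul_nonneg hm₀ hl) (by linarith : (0:ℝ) ≤ Real.exp (1 / α))]
      simp only [zero_add]
      linarith [show (α * M₁ + Real.exp (1 / α) * (m₀ + m₁)) * (1 + Real.log M₁) =
        (α * M₁ + Real.exp (1 / α) * m₁) * (1 + Real.log M₁) +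
          Real.exp (1 / α) * m₀ * (1 + Real.log M₁) by ring]
  · rcases h₁' with rfl | h₁
    · have hl := Real.log_nonneg h₀
      rw [hz₁ rfl, min_eq_right hm₀]
      have : min m₁ M₀ ≤ Real.exp (1 / α) * m₁ * (1 + Real.log M₀) := by
        refine (min_le_left _ _).trans ?_
        nlinarith [mul_nonneg hm₁ hl, mul_nonneg (mul_nonneg hm₁ hl) (by linarith : (0:ℝ) ≤ Real.exp (1 / α))]
      simp only [add_zero]
      linarith [show (α * M₀ + Real.exp (1 / α) * (m₀ + m₁)) * (1 + Real.log M₀) =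
        (α * M₀ + Real.exp (1 / α) * m₀) * (1 + Real.log M₀) +
          Real.exp (1 / α) * m₁ * (1 + Real.log M₀) by ring]
    · have p₀ : 0 < M₀ := by linarith
      have p₁ : 0 < M₁ := by linarith
      have k₁ := min_le_mul_log_add hα p₀ p₁ hm₀
      have k₂ := min_le_mul_log_add hα p₁ p₀ hm₁
      rw [add_comm M₁ M₀] at k₂
      rw [Real.log_div (by positivity) (by positivity),
        Real.log_div (by positivity) (by positivity)] at k₁ k₂
      calc _ ≤ _ := add_le_add (add_le_add (add_le_add hf₀ hf₁) k₁) k₂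
        _ = _ := by ring

section CharTwo
variable {V : Type*} [AddCommGroup V] [Module (ZMod 2) V] [DecidableEq V]

/-- An edge-isoperimetric inequality in the cube spanned by linearly independent directions. -/
theorem sum_card_filter_add_mem_le {α : ℝ} (hα : 0 < α) (E : Finset V)
    (hE : LinearIndepOn (ZMod 2) id (E : Set V)) : ∀ X S : Finset V,
    ((∑ e ∈ E, {x ∈ X | x + e ∈ S}.card : ℕ) : ℝ) ≤
      (α * S.card + Real.exp (1 / α) * X.card) * (1 + Real.log S.card) := by
  induction E using Finset.induction_on with
  | empty =>
    intro X S
    simp only [Finset.sum_empty, Nat.cast_zero]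
    have : 0 ≤ Real.log S.card := Real.log_natCast_nonneg _
    positivity
  | insert e₀ E he₀ ih =>
    intro X S
    rw [Finset.coe_insert, linearIndepOn_insert (by simpa using he₀)] at hE
    -- By independence some functional vanishes on E and equals 1 at e₀. The directions in E
    -- preserve its fibres, and e₀ exchanges them.
    obtain ⟨f, hf, hfE⟩ := Submodule.exists_le_ker_of_notMem hE.2
    replace hf : f e₀ = 1 := (zmodTwo_ne_zero_iff _).1 hf
    replace hfE : ∀ e ∈ E, f e = 0 := fun e he =>
      hfE (Submodule.subset_span ⟨e, he, rfl⟩)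
    have split : ∀ (C : Finset V) (p : V → Prop) [DecidablePred p], {x ∈ C | p x}.card =
        {x ∈ {y ∈ C | f y = 0} | p x}.card + {x ∈ {y ∈ C | f y = 1} | p x}.card := by
      intro C p _
      rw [← Finset.card_filter_add_card_filter_not (s := {x ∈ C | p x}) (fun x => f x = 0)]
      congr 2 <;> ext x <;> simp [zmodTwo_ne_zero_iff] <;> tauto
    have split' : ∀ C : Finset V, C.card = {y ∈ C | f y = 0}.card + {y ∈ C | f y = 1}.card := by
      intro C
      simpa using split C (fun _ => True)
    set X₀ := {y ∈ X | f y = 0} with hX₀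
    set X₁ := {y ∈ X | f y = 1} with hX₁
    set S₀ := {y ∈ S | f y = 0} with hS₀
    set S₁ := {y ∈ S | f y = 1} with hS₁
    have inner₀ : ∀ e ∈ E, {x ∈ X₀ | x + e ∈ S} = {x ∈ X₀ | x + e ∈ S₀} := by
      intro e he
      ext x
      simp only [hX₀, hS₀, Finset.mem_filter, map_add, hfE e he, add_zero]
      tauto
    have inner₁ : ∀ e ∈ E, {x ∈ X₁ | x + e ∈ S} = {x ∈ X₁ | x + e ∈ S₁} := by
      intro e he
      ext x
      simp only [hX₁, hS₁, Finset.mem_filter, map_add, hfE e he, add_zero]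
      tauto
    have cross : ∀ (i : ZMod 2), {x ∈ {y ∈ X | f y = i} | x + e₀ ∈ S}.card ≤
        min {y ∈ X | f y = i}.card {y ∈ S | f y = i + 1}.card := by
      intro i
      refine le_min (Finset.card_filter_le _ _) ?_
      refine Finset.card_le_card_of_injOn (· + e₀) ?_ (add_left_injective e₀).injOn
      intro x hx
      simp only [Finset.coe_filter, Finset.mem_filter, Set.mem_ofPred_eq] at hx ⊢
      simp [hx.2, hx.1.2, hf]
    have c₀ := cross 0
    have c₁ := cross 1
    rw [zero_add] at c₀
    rw [show (1 : ZMod 2) + 1 = 0 by decide] at c₁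
    have hsum : (∑ e ∈ insert e₀ E, {x ∈ X | x + e ∈ S}.card) ≤
        (∑ e ∈ E, {x ∈ X₀ | x + e ∈ S₀}.card) + (∑ e ∈ E, {x ∈ X₁ | x + e ∈ S₁}.card)
          + min X₀.card S₁.card + min X₁.card S₀.card := by
      rw [Finset.sum_insert he₀, split X, ← Finset.sum_add_distrib]
      rw [Finset.sum_congr rfl (fun e he => (split X (fun x => x + e ∈ S)).trans
        (by rw [← hX₀, ← hX₁, inner₀ e he, inner₁ e he]))]
      linarith
    have cast1 : ∀ N : ℕ, (N : ℝ) = 0 ∨ 1 ≤ (N : ℝ) := by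
      intro N
      rcases Nat.eq_zero_or_pos N with h | h
      · left; exact_mod_cast h
      · right; exact_mod_cast h
    have zero : ∀ X S : Finset V, (S.card : ℝ) = 0 →
        ((∑ e ∈ E, {x ∈ X | x + e ∈ S}.card : ℕ) : ℝ) = 0 := by
      intro X S hS
      have : S = ∅ := by simpa using hS
      simp [this]
    have := entropy_split hα (Nat.cast_nonneg S₀.card) (Nat.cast_nonneg S₁.card) (cast1 _)
      (cast1 _) (Nat.cast_nonneg X₀.card) (Nat.cast_nonneg X₁.card) (ih hE.1 X₀ S₀)
      (ih hE.1 X₁ S₁) (zero X₀ S₀) (zero X₁ S₁)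
    rw [split' X, split' S]
    push_cast at this ⊢
    refine le_trans ?_ this
    exact_mod_cast hsum

end CharTwo

/-! ### Small doubling: the span and the stabiliser of the sumset. -/

theorem inter_card_ge {α : Type*} [DecidableEq α] {P Q T : Finset α} (hP : P ⊆ T) (hQ : Q ⊆ T) :
    P.card + Q.card ≤ T.card + (P ∩ Q).card := by
  rw [← Finset.card_union_add_card_inter]
  have := Finset.card_le_card (Finset.union_subset hP hQ)
  omega

section CharTwo
variable {V : Type*} [AddCommGroup V] [Module (ZMod 2) V] [DecidableEq V]

/-- A set of bounded doubling spans a subspace of comparable size. -/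
theorem two_pow_finrank_span_le [Finite V] {A : Finset V} (hA : A.Nonempty) {K : ℕ}
    (hK : (A + A).card ≤ K * A.card) :
    2 ^ Module.finrank (ZMod 2) (Submodule.span (ZMod 2) (A : Set V)) ≤
      2 ^ K ^ 4 * (K * A.card) := by
  classical
  have hm : (0 : ℝ) < A.card := by exact_mod_cast hA.card_pos
  have h4 : ((3 • A + A).card : ℝ) ≤ ((K ^ 4 : ℕ) : ℝ) * A.card := by
    have h := Finset.pluennecke_ruzsa_inequality_nsmul_add hA A 4
    rw [succ_nsmul] at h
    have h' : ((3 • A + A).card : ℝ) ≤ ((A + A).card / A.card : ℝ) ^ 4 * A.card := by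
      have h'' := (NNRat.cast_le (K := ℝ)).2 h
      simpa using h''
    refine h'.trans ?_
    push_cast
    gcongr
    rw [div_le_iff₀ hm]
    exact_mod_cast hK
  -- Covering gives 3A ⊆ F + (A - A), and A - A = A + A here. So span F + (A + A) contains 0 and is
  -- stable under adding elements of A, and therefore contains the span of A.
  obtain ⟨F, -, hFc, hF⟩ := Finset.ruzsa_covering_add hA h4
  have hFc : F.card ≤ K ^ 4 := by exact_mod_cast hFc
  set W := Submodule.span (ZMod 2) (F : Set V) with hW
  let Z : Set V := (W : Set V) + ((A + A : Finset V) : Set V)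
  have h0 : (0 : V) ∈ Z := by
    obtain ⟨a, ha⟩ := hA
    exact ⟨0, W.zero_mem, 0, by
      rw [Finset.mem_coe, Finset.mem_add]
      exact ⟨a, ha, a, ha, ZModModule.add_self a⟩, add_zero _⟩
  have key : ∀ v ∈ Submodule.span (ZMod 2) (A : Set V), ∀ z ∈ Z, v + z ∈ Z := by
    intro v hv
    induction hv using Submodule.span_induction with
    | mem a ha =>
      rintro _ ⟨w, hw, s, hs, rfl⟩
      obtain ⟨b, hb, c, hc, rfl⟩ := Finset.mem_add.1 (Finset.mem_coe.1 hs)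
      have h3 : b + c + a ∈ 3 • A := by
        rw [succ_nsmul, two_nsmul]
        exact Finset.add_mem_add (Finset.add_mem_add hb hc) ha
      obtain ⟨f, hf, t, ht, hft⟩ := Finset.mem_add.1 (hF h3)
      obtain ⟨b', hb', c', hc', rfl⟩ := Finset.mem_sub.1 ht
      refine ⟨w + f, W.add_mem hw (Submodule.subset_span hf), b' + c',
        Finset.mem_coe.2 (Finset.add_mem_add hb' hc'), ?_⟩
      rw [ZModModule.sub_eq_add] at hft
      change w + f + (b' + c') = a + (w + (b + c))
      rw [add_assoc, hft]
      abel
    | zero => intro z hz; simpa using hz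
    | add x y _ _ hx hy =>
      intro z hz
      rw [add_assoc]
      exact hx _ (hy _ hz)
    | smul c x _ hx =>
      intro z hz
      have : c = 0 ∨ c = 1 := by revert c; decide
      rcases this with rfl | rfl
      · simpa using hz
      · simpa using hx z hz
  have hsub : (Submodule.span (ZMod 2) (A : Set V) : Set V) ⊆ Z := fun v hv => by
    simpa using key v hv 0 h0
  have card_eq : ∀ S : Submodule (ZMod 2) V, Nat.card S = 2 ^ Module.finrank (ZMod 2) S := by
    intro S
    rw [Module.natCard_eq_pow_finrank (K := ZMod 2)]
    simp
  calc 2 ^ Module.finrank (ZMod 2) (Submodule.span (ZMod 2) (A : Set V))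
      = Nat.card (Submodule.span (ZMod 2) (A : Set V)) := (card_eq _).symm
    _ ≤ Nat.card Z := Nat.card_mono (Set.toFinite _) hsub
    _ ≤ Nat.card (W : Set V) * Nat.card ((A + A : Finset V) : Set V) := Set.natCard_add_le
    _ ≤ 2 ^ K ^ 4 * (K * A.card) := by
      gcongr
      · refine (card_eq W).le.trans (Nat.pow_le_pow_right (by norm_num) ?_)
        exact (finrank_span_finset_le_card F).trans hFc
      · rw [Nat.card_coe_set_eq, Set.ncard_coe_finset]
        exact hK

/-- The translations preserving `A + A`. -/
def sumStab [Fintype V] (A : Finset V) : Finset V := {g | ∀ z ∈ A + A, z + g ∈ A + A}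

/-- For a, b ∈ A the translates a + As and b + As both lie in A + A, so they overlap in at least
2|A| - |A + A| points. That exceeds the number of u ∈ As which g moves out of As. Hence some a + u =
b + v has u + g ∈ As, and a + b + g = (u + g) + v lies in As + As. -/
theorem mem_sumStab_of_near_period [Fintype V] {A As : Finset V} (hAAs : A ⊆ As)
    (hAsAs : ∀ x ∈ As, ∀ y ∈ As, x + y ∈ A + A) {g : V}
    (hg : {u ∈ As | u + g ∉ As}.card + (A + A).card < 2 * A.card) : g ∈ sumStab A := by
  set T := A + A with hT
  simp only [sumStab, Finset.mem_filter, Finset.mem_univ, true_and]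
  intro z hz
  obtain ⟨a, ha, b, hb, rfl⟩ := Finset.mem_add.1 hz
  have trAs : ∀ c ∈ A, As.image (c + ·) ⊆ T := by
    intro c hc w hw
    obtain ⟨v, hv, rfl⟩ := Finset.mem_image.1 hw
    exact hAsAs c (hAAs hc) v hv
  have cardtr : ∀ x, (As.image (x + ·)).card = As.card := fun x =>
    Finset.card_image_of_injective _ (add_right_injective x)
  have h1 := inter_card_ge (trAs a ha) (trAs b hb)
  rw [cardtr, cardtr] at h1
  have h2 : {u ∈ As | u + g ∉ As}.card < (As.image (a + ·) ∩ As.image (b + ·)).card := by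
    have := Finset.card_le_card hAAs
    omega
  obtain ⟨s, hs, hsB⟩ : ∃ s ∈ As.image (a + ·) ∩ As.image (b + ·),
      a + s ∉ {u ∈ As | u + g ∉ As} := by
    by_contra! hall
    refine absurd (Finset.card_le_card_of_injOn (fun s => a + s) hall ?_) (not_le.2 h2)
    exact (add_right_injective a).injOn
  rw [Finset.mem_inter, Finset.mem_image, Finset.mem_image] at hs
  obtain ⟨⟨u, hu, rfl⟩, v, hv, huv⟩ := hs
  simp only [add_add_cancel_two, Finset.mem_filter, not_and, not_not] at hsB
  have : a + b + g = u + g + v := by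
    have : v = b + (a + u) := by rw [← huv, add_add_cancel_two]
    rw [this, show u + g + (b + (a + u)) = a + b + g + (u + u) by abel, ZModModule.add_self,
      add_zero]
  rw [this]
  exact hAsAs _ (hsB hu) _ hv

/-- If `|A + A| ≤ (2 - γ) |A|` and `A` is dense in a subspace, then `A + A` has a large
stabiliser. -/
theorem card_le_mul_card_sumStab [Fintype V] {A : Finset V} (hA : A.Nonempty)
    (H : Submodule (ZMod 2) V) (hAH : ∀ a ∈ A, a ∈ H) {C κ : ℕ} (hC : Nat.card H ≤ C * A.card)
    {γ : ℝ} (hγ0 : 0 < γ) (hγ1 : γ ≤ 1) (hγ : ((A + A).card : ℝ) ≤ (2 - γ) * A.card)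
    (hκ : 2 * C * (1 - γ) ^ (κ + 1) ≤ γ) :
    A.card ≤ 2 * C ^ κ * (sumStab A).card := by
  classical
  set T := A + A with hT
  have hm : (0 : ℝ) < A.card := by exact_mod_cast hA.card_pos
  -- All points of H that translate A into T. Since |T| < 2|A|, two such translates of A meet, which
  -- gives As + As ⊆ T. For the same reason a point of H outside As sends at most (1 - γ)|A|
  -- elements of A into T.
  set As : Finset V := {x | x ∈ H ∧ ∀ a ∈ A, x + a ∈ T} with hAs
  have memAs : ∀ x, x ∈ As ↔ x ∈ H ∧ ∀ a ∈ A, x + a ∈ T := by simp [hAs]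
  have hAAs : A ⊆ As := fun a ha => (memAs a).2 ⟨hAH a ha, fun b hb => Finset.add_mem_add ha hb⟩
  have trT : ∀ x ∈ As, A.image (x + ·) ⊆ T := by
    intro x hx y hy
    obtain ⟨a, ha, rfl⟩ := Finset.mem_image.1 hy
    exact ((memAs x).1 hx).2 a ha
  have cardtr : ∀ (B : Finset V) x, (B.image (x + ·)).card = B.card := fun B x =>
    Finset.card_image_of_injective _ (add_right_injective x)
  have hAsAs : ∀ x ∈ As, ∀ y ∈ As, x + y ∈ T := by
    intro x hx y hy
    have h1 := inter_card_ge (trT x hx) (trT y hy)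
    rw [cardtr, cardtr] at h1
    have h2 : 0 < (A.image (x + ·) ∩ A.image (y + ·)).card := by
      have h1' : (A.card : ℝ) + A.card ≤ T.card + (A.image (x + ·) ∩ A.image (y + ·)).card := by
        exact_mod_cast h1
      have : (0 : ℝ) < (A.image (x + ·) ∩ A.image (y + ·)).card := by nlinarith
      exact_mod_cast this
    obtain ⟨z, hz⟩ := Finset.card_pos.1 h2
    rw [Finset.mem_inter, Finset.mem_image, Finset.mem_image] at hz
    obtain ⟨⟨a, ha, rfl⟩, b, hb, hab⟩ := hz
    have : x + y = a + b := by
      have : y = x + a + b := by rw [← hab, add_assoc, ZModModule.add_self, add_zero]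
      rw [this, add_assoc, add_add_cancel_two]
    rw [this]
    exact Finset.add_mem_add ha hb
  -- elements outside `As` are far from being in `As`
  have gap : ∀ x ∈ H, x ∉ As → ({a ∈ A | x + a ∈ T}.card : ℝ) ≤ (1 - γ) * A.card := by
    intro x hxH hx
    by_contra! hlt
    refine hx ((memAs x).2 ⟨hxH, fun a ha => ?_⟩)
    have h1 := inter_card_ge (P := {a ∈ A | x + a ∈ T}.image (x + ·)) (Q := A.image (a + ·))
      (T := T) (by
        intro y hy
        obtain ⟨b, hb, rfl⟩ := Finset.mem_image.1 hy
        exact (Finset.mem_filter.1 hb).2) (trT a (hAAs ha))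
    rw [cardtr, cardtr] at h1
    have h2 : 0 < ({a ∈ A | x + a ∈ T}.image (x + ·) ∩ A.image (a + ·)).card := by
      have h1' : ({a ∈ A | x + a ∈ T}.card : ℝ) + A.card ≤
          T.card + ({a ∈ A | x + a ∈ T}.image (x + ·) ∩ A.image (a + ·)).card := by
        exact_mod_cast h1
      have : (0 : ℝ) < ({a ∈ A | x + a ∈ T}.image (x + ·) ∩ A.image (a + ·)).card := by
        nlinarith
      exact_mod_cast this
    obtain ⟨z, hz⟩ := Finset.card_pos.1 h2
    rw [Finset.mem_inter, Finset.mem_image, Finset.mem_image] at hz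
    obtain ⟨⟨b, hb, rfl⟩, c, hc, hbc⟩ := hz
    have : x + a = b + c := by
      have : a = x + b + c := by rw [← hbc, add_assoc, ZModModule.add_self, add_zero]
      rw [this, add_assoc, add_add_cancel_two]
    rw [this]
    exact Finset.add_mem_add (Finset.mem_filter.1 hb).1 hc
  set Hf : Finset V := {x | x ∈ H} with hHf
  have cardHf : Hf.card ≤ C * A.card := by
    refine le_trans (le_of_eq ?_) hC
    exact (Nat.subtype_card Hf (fun x => by simp [hHf])).symm
  set Ω : Finset (Fin (κ + 1) → V) := Fintype.piFinset fun _ => A with hΩ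
  -- The points outside As that the sample t fails to detect. A given point escapes a random sample
  -- with probability at most (1 - γ)^(κ+1), so by Markov's inequality at least half the samples
  -- leave fewer than γ|A| points undetected.
  let B : (Fin (κ + 1) → V) → Finset V := fun t => {x ∈ Hf \ As | ∀ i, x + t i ∈ T}
  have cardΩ : Ω.card = A.card ^ (κ + 1) := by simp [hΩ]
  have dc : ∑ t ∈ Ω, (B t).card = ∑ x ∈ Hf \ As, {t ∈ Ω | ∀ i, x + t i ∈ T}.card :=
    Finset.sum_card_bipartiteAbove_eq_sum_card_bipartiteBelow
      (fun (t : Fin (κ + 1) → V) x => ∀ i, x + t i ∈ T)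
  have dc' : (∑ t ∈ Ω, ((B t).card : ℝ)) ≤ C * A.card * ((1 - γ) * A.card) ^ (κ + 1) := by
    have : ∀ x ∈ Hf \ As, ({t ∈ Ω | ∀ i, x + t i ∈ T}.card : ℝ) ≤
        ((1 - γ) * A.card) ^ (κ + 1) := by
      intro x hx
      have e : {t ∈ Ω | ∀ i, x + t i ∈ T} = Fintype.piFinset fun _ => {a ∈ A | x + a ∈ T} := by
        ext t
        simp [hΩ, Fintype.mem_piFinset, forall_and]
      rw [e, Fintype.card_piFinset_const]
      push_cast
      rw [Finset.mem_sdiff] at hx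
      gcongr
      exact gap x (by simpa [hHf] using hx.1) hx.2
    calc (∑ t ∈ Ω, ((B t).card : ℝ)) = ∑ x ∈ Hf \ As, ({t ∈ Ω | ∀ i, x + t i ∈ T}.card : ℝ) := by
          exact_mod_cast dc
      _ ≤ (Hf \ As).card • ((1 - γ) * A.card : ℝ) ^ (κ + 1) := Finset.sum_le_card_nsmul _ _ _ this
      _ ≤ C * A.card * ((1 - γ) * A.card) ^ (κ + 1) := by
          rw [nsmul_eq_mul]
          have : ((Hf \ As).card : ℝ) ≤ C * A.card := by
            exact_mod_cast (Finset.card_le_card Finset.sdiff_subset).trans cardHf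
          have h0 : (0 : ℝ) ≤ (1 - γ) * A.card := mul_nonneg (by linarith) hm.le
          gcongr
  set good := {t ∈ Ω | ((B t).card : ℝ) < γ * A.card} with hgood
  have hgoodcard : A.card ^ (κ + 1) ≤ 2 * good.card := by
    have h1 : ({t ∈ Ω | ¬ ((B t).card : ℝ) < γ * A.card}.card : ℝ) * (γ * A.card) ≤
        ∑ t ∈ Ω, ((B t).card : ℝ) := by
      rw [← nsmul_eq_mul]
      refine (Finset.card_nsmul_le_sum _ (fun t => ((B t).card : ℝ)) _ fun t ht =>
        not_lt.1 (Finset.mem_filter.1 ht).2).trans ?_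
      exact Finset.sum_le_sum_of_subset_of_nonneg (Finset.filter_subset _ _)
        fun _ _ _ => Nat.cast_nonneg _
    have h2 : ((good.card : ℝ) + {t ∈ Ω | ¬ ((B t).card : ℝ) < γ * A.card}.card) =
        A.card ^ (κ + 1) := by
      have := Finset.card_filter_add_card_filter_not (s := Ω)
        (fun t => ((B t).card : ℝ) < γ * A.card)
      rw [cardΩ] at this
      exact_mod_cast this
    have h3 : 2 * ({t ∈ Ω | ¬ ((B t).card : ℝ) < γ * A.card}.card : ℝ) ≤ A.card ^ (κ + 1) := by
      have hpos : 0 < γ * A.card := by positivity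
      refine le_of_mul_le_mul_right ?_ hpos
      calc 2 * ({t ∈ Ω | ¬ ((B t).card : ℝ) < γ * A.card}.card : ℝ) * (γ * A.card)
          ≤ 2 * (C * A.card * ((1 - γ) * A.card) ^ (κ + 1)) := by linarith
        _ = (2 * C * (1 - γ) ^ (κ + 1)) * (A.card * A.card ^ (κ + 1)) := by rw [mul_pow]; ring
        _ ≤ γ * (A.card * A.card ^ (κ + 1)) := by gcongr
        _ = _ := by ring
    have h4 : (A.card : ℝ) ^ (κ + 1) ≤ 2 * good.card := by linarith
    exact_mod_cast h4
  -- pigeonhole over diagonal translates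
  have hHpos : 0 < Hf.card := Finset.card_pos.2 ⟨0, by simp [hHf]⟩
  let D : Finset (Fin κ → V) := Fintype.piFinset fun _ => Hf
  have cardD : D.card = Hf.card ^ κ := by simp [D]
  obtain ⟨y, -, hy⟩ : ∃ y ∈ D, good.card ≤
      {t ∈ good | (fun i : Fin κ => t i.succ + t 0) = y}.card * D.card := by
    by_contra! h
    have hmaps : ∀ t ∈ good, (fun i : Fin κ => t i.succ + t 0) ∈ D := by
      intro t ht
      have htA : ∀ i, t i ∈ A := by
        simpa [hΩ] using (Finset.mem_filter.1 ht).1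
      simp only [D, Fintype.mem_piFinset, hHf, Finset.mem_filter, Finset.mem_univ, true_and]
      exact fun i => H.add_mem (hAH _ (htA _)) (hAH _ (htA _))
    have h1 := Finset.card_eq_sum_card_fiberwise hmaps
    have hD : D.Nonempty := Finset.card_pos.1 (by rw [cardD]; positivity)
    have h2 := Finset.sum_lt_sum_of_nonempty hD h
    rw [← Finset.sum_mul, ← h1, Finset.sum_const, smul_eq_mul, mul_comm] at h2
    exact lt_irrefl _ h2
  set Φ := {t ∈ good | (fun i : Fin κ => t i.succ + t 0) = y} with hΦ
  have hle : Φ.card ≤ (sumStab A).card := by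
    rcases Φ.eq_empty_or_nonempty with h0 | ⟨t₀, ht₀⟩
    · simp [h0]
    have memΦ : ∀ t ∈ Φ, (∀ i, t i ∈ A) ∧ ((B t).card : ℝ) < γ * A.card ∧
        ∀ i, t i = t₀ i + (t 0 + t₀ 0) := by
      intro t ht
      have e1 := (Finset.mem_filter.1 ht).2
      have e0 := (Finset.mem_filter.1 ht₀).2
      have g1 := Finset.mem_filter.1 (Finset.mem_filter.1 ht).1
      refine ⟨by simpa [hΩ] using g1.1, g1.2, fun i => ?_⟩
      refine Fin.cases ?_ (fun j => ?_) i
      · rw [add_comm (t 0), add_add_cancel_two]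
      · have := congrFun (e1.trans e0.symm) j
        calc t j.succ = (t j.succ + t 0) + t 0 := by
              rw [add_assoc, ZModModule.add_self, add_zero]
          _ = _ := by rw [this]; abel
    refine Finset.card_le_card_of_injOn (fun t => t 0 + t₀ 0) ?_ ?_
    · intro t ht
      obtain ⟨htA, htB, htr⟩ := memΦ t ht
      obtain ⟨ht₀A, -, -⟩ := memΦ t₀ ht₀
      set g := t 0 + t₀ 0 with hg
      have hgH : g ∈ H := H.add_mem (hAH _ (htA 0)) (hAH _ (ht₀A 0))
      -- As t = t₀ + g in every coordinate, a point u + g outside As is undetected by t, because u +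
      -- t₀ i ∈ T. So g moves fewer than γ|A| points of As out of As, and g stabilises T.
      have hnear : ∀ u ∈ As, u + g ∉ As → u + g ∈ B t := by
        intro u hu hug
        refine Finset.mem_filter.2 ⟨Finset.mem_sdiff.2 ⟨?_, hug⟩, fun i => ?_⟩
        · simpa [hHf] using H.add_mem ((memAs u).1 hu).1 hgH
        · rw [htr i, show u + g + (t₀ i + g) = u + t₀ i + (g + g) by abel, ZModModule.add_self,
            add_zero]
          exact ((memAs u).1 hu).2 _ (ht₀A i)
      refine mem_sumStab_of_near_period hAAs hAsAs ?_
      have h1 : {u ∈ As | u + g ∉ As}.card ≤ (B t).card := by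
        refine Finset.card_le_card_of_injOn (fun u => u + g) (fun u hu => ?_)
          (add_left_injective g).injOn
        have hu := Finset.mem_filter.1 hu
        exact hnear u hu.1 hu.2
      have h2 : (({u ∈ As | u + g ∉ As}.card : ℕ) : ℝ) ≤ (B t).card := by exact_mod_cast h1
      have h3 : (({u ∈ As | u + g ∉ As}.card : ℕ) : ℝ) + T.card < 2 * A.card := by linarith
      exact_mod_cast h3
    · intro t ht t' ht' htt
      have htt : t 0 + t₀ 0 = t' 0 + t₀ 0 := htt
      funext i
      rw [(memΦ t ht).2.2 i, (memΦ t' ht').2.2 i, htt]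
  have hfin : A.card ^ (κ + 1) ≤ 2 * ((sumStab A).card * (C * A.card) ^ κ) := by
    calc A.card ^ (κ + 1) ≤ 2 * good.card := hgoodcard
      _ ≤ 2 * (Φ.card * D.card) := by gcongr
      _ ≤ _ := by rw [cardD]; gcongr
  have hpos : 0 < A.card ^ κ := pow_pos hA.card_pos _
  refine le_of_mul_le_mul_right ?_ hpos
  calc A.card * A.card ^ κ = A.card ^ (κ + 1) := by ring
    _ ≤ _ := hfin
    _ = _ := by rw [mul_pow]; ring

end CharTwo

/-! ### Cheap sumsets, and sets whose span has large dimension. -/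

section CharTwo
variable {V : Type*} [AddCommGroup V] [Module (ZMod 2) V] [DecidableEq V]

omit [Module (ZMod 2) V] in
theorem card_add_insert_ge (x : V) (Y : Finset V) :
    (Y + Y).card + {y ∈ Y | x + y ∉ Y + Y}.card ≤ (insert x Y + insert x Y).card := by
  have hd : Disjoint (Y + Y) ({y ∈ Y | x + y ∉ Y + Y}.image (x + ·)) := by
    rw [Finset.disjoint_right]
    intro z hz
    obtain ⟨y, hy, rfl⟩ := Finset.mem_image.1 hz
    exact (Finset.mem_filter.1 hy).2
  rw [← Finset.card_image_of_injective {y ∈ Y | x + y ∉ Y + Y} (add_right_injective x),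
    ← Finset.card_union_of_disjoint hd]
  refine Finset.card_le_card (Finset.union_subset ?_ ?_)
  · exact Finset.add_subset_add (Finset.subset_insert _ _) (Finset.subset_insert _ _)
  · intro z hz
    obtain ⟨y, hy, rfl⟩ := Finset.mem_image.1 hz
    exact Finset.add_mem_add (Finset.mem_insert_self _ _)
      (Finset.mem_insert_of_mem (Finset.mem_filter.1 hy).1)

/-- `X` contains a subset whose sumset is larger than the number of bits needed to describe it. -/
def HasCheapSumset (n k : ℕ) (X : Finset V) : Prop :=
  ∃ Y₁ Y : Finset V, Y₁ ⊆ Y ∧ Y ⊆ X ∧ Y ⊆ Y₁ + Y₁ + Y₁ ∧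
    n * Module.finrank (ZMod 2) (Submodule.span (ZMod 2) (Y₁ : Set V)) +
      Module.finrank (ZMod 2) (Submodule.span (ZMod 2) (Y₁ : Set V)) * Y₁.card +
      3 * (k + 1) * (Y \ Y₁).card + n ≤ (Y + Y).card

theorem subset_add_add_self (Y : Finset V) : Y ⊆ Y + Y + Y := by
  intro y hy
  have : y = y + y + y := by rw [ZModModule.add_self, zero_add]
  rw [this]
  exact Finset.add_mem_add (Finset.add_mem_add hy hy) hy

theorem card_add_self_lt_of_not_hasCheapSumset {n k : ℕ} {X : Finset V}
    (hX : ¬ HasCheapSumset n k X) {Y : Finset V} (hY : Y ⊆ X) :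
    (Y + Y).card < n * Module.finrank (ZMod 2) (Submodule.span (ZMod 2) (Y : Set V)) +
      Module.finrank (ZMod 2) (Submodule.span (ZMod 2) (Y : Set V)) * Y.card + n := by
  by_contra! h
  exact hX ⟨Y, Y, subset_rfl, hY, subset_add_add_self Y, by simpa using h⟩

/-- The ratio of dimension to log-cardinality above which isoperimetry applies. -/
noncomputable def dimConst : ℕ := ⌈16 * Real.exp 256⌉₊ + 24

/-- Sets whose span has dimension much larger than the logarithm of their cardinality have
cheap sumsets. -/
theorem hasCheapSumset_of_large_dim [Finite V] {n k : ℕ} {X : Finset V} (hX : X.card = 2 ^ k + 1)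
    (hk : 4 ≤ k) (hnk : n * k ≤ 2 ^ (k + 1))
    (hdn : Module.finrank (ZMod 2) (Submodule.span (ZMod 2) (X : Set V)) ≤ n)
    (hd : dimConst * k ≤ Module.finrank (ZMod 2) (Submodule.span (ZMod 2) (X : Set V))) :
    HasCheapSumset n k X := by
  classical
  set d := Module.finrank (ZMod 2) (Submodule.span (ZMod 2) (X : Set V)) with hddef
  obtain ⟨E', hE'X, hE'span, hE'ind⟩ := exists_linearIndependent (ZMod 2) (X : Set V)
  have hE'fin : E'.Finite := X.finite_toSet.subset hE'X
  obtain ⟨E, rfl⟩ := hE'fin.exists_finset_coe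
  have hEX : E ⊆ X := by exact_mod_cast hE'X
  have hEcard : E.card = d := by
    rw [hddef, ← hE'span]
    exact (finrank_span_finset_eq_card hE'ind).symm
  have h2k : n * 4 ≤ 2 ^ (k + 1) := (Nat.mul_le_mul_left n hk).trans hnk
  rw [pow_succ] at h2k
  have hdim24 : 24 ≤ dimConst := by unfold dimConst; omega
  have hd24 : 24 * k ≤ d := (Nat.mul_le_mul_right k hdim24).trans hd
  obtain ⟨Y₀, hEY₀, hY₀X, hY₀⟩ := Finset.exists_subsuperset_card_eq hEX (n := 2 * d)
    (by omega) (by rw [hX]; omega)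
  -- first extension
  obtain ⟨Y₁, hY₁mem, hY₁max⟩ := Finset.exists_max_image
    {Y ∈ X.powerset | Y₀ ⊆ Y ∧ 2 * d * Y.card ≤ (Y + Y).card + 4 * d ^ 2} Finset.card
    ⟨Y₀, by
      simp only [Finset.mem_filter, Finset.mem_powerset]
      exact ⟨hY₀X, subset_rfl, by rw [hY₀]; nlinarith⟩⟩
  simp only [Finset.mem_filter, Finset.mem_powerset] at hY₁mem hY₁max
  obtain ⟨hY₁X, hY₀₁, hY₁gain⟩ := hY₁mem
  have hY₁card : 2 * d ≤ Y₁.card := hY₀ ▸ Finset.card_le_card hY₀₁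
  -- Adding to Y₁ a point outside Y₁ + Y₁ + Y₁ creates |Y₁| ≥ 2d new sums, against maximality.
  have hX3 : X ⊆ Y₁ + Y₁ + Y₁ := by
    intro x hx
    by_contra hx3
    have hxY : x ∉ Y₁ := fun h => hx3 (subset_add_add_self Y₁ h)
    have hall : {y ∈ Y₁ | x + y ∉ Y₁ + Y₁} = Y₁ := by
      refine Finset.filter_true_of_mem fun y hy hxy => hx3 ?_
      have : x = x + y + y := by rw [add_assoc, ZModModule.add_self, add_zero]
      rw [this]
      exact Finset.add_mem_add hxy hy
    have h1 := card_add_insert_ge x Y₁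
    rw [hall] at h1
    have h2 := hY₁max (insert x Y₁) ⟨Finset.insert_subset hx hY₁X,
      hY₀₁.trans (Finset.subset_insert _ _), by
        rw [Finset.card_insert_of_notMem hxY]; nlinarith⟩
    rw [Finset.card_insert_of_notMem hxY] at h2
    omega
  -- second extension
  obtain ⟨Y, hYmem, hYmax⟩ := Finset.exists_max_image
    {Y ∈ X.powerset | Y₁ ⊆ Y ∧ 4 * d * Y₁.card + d * (Y \ Y₁).card ≤ 2 * (Y + Y).card + 8 * d ^ 2}
    Finset.card
    ⟨Y₁, by
      simp only [Finset.mem_filter, Finset.mem_powerset]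
      exact ⟨hY₁X, subset_rfl, by simp only [sdiff_self, Finset.bot_eq_empty, Finset.card_empty]; linarith⟩⟩
  simp only [Finset.mem_filter, Finset.mem_powerset] at hYmem hYmax
  obtain ⟨hYX, hY₁Y, hYgain⟩ := hYmem
  set S := Y + Y with hS
  have hEY : E ⊆ Y := hEY₀.trans (hY₀₁.trans hY₁Y)
  -- If more than half of the sums x + e with e ∈ E were outside S, inserting x would create over
  -- d/2 new sums, against the maximality of Y.
  have hdeg : ∀ x ∈ X, d ≤ 2 * {e ∈ E | x + e ∈ S}.card := by
    intro x hx
    by_cases hxY : x ∈ Y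
    · have : {e ∈ E | x + e ∈ S} = E :=
        Finset.filter_true_of_mem fun e he => Finset.add_mem_add hxY (hEY he)
      rw [this]; omega
    · by_contra! hlt
      have h1 := card_add_insert_ge x Y
      rw [← hS] at h1
      have h2 : {e ∈ E | x + e ∉ S}.card ≤ {y ∈ Y | x + y ∉ S}.card :=
        Finset.card_le_card (Finset.filter_subset_filter _ hEY)
      have h3 := Finset.card_filter_add_card_filter_not (s := E) (fun e => x + e ∈ S)
      have h4 : (insert x Y \ Y₁).card = (Y \ Y₁).card + 1 := by
        rw [Finset.insert_sdiff_of_notMem _ (fun h => hxY (hY₁Y h)),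
          Finset.card_insert_of_notMem (fun h => hxY (Finset.mem_sdiff.1 h).1)]
      have h5 := hYmax (insert x Y) ⟨Finset.insert_subset hx hYX,
        hY₁Y.trans (Finset.subset_insert _ _), by rw [h4, mul_add, mul_one]; omega⟩
      rw [Finset.card_insert_of_notMem hxY] at h5
      omega
  have hcount : X.card * d ≤ 2 * ∑ e ∈ E, {x ∈ X | x + e ∈ S}.card := by
    have := Finset.sum_card_bipartiteAbove_eq_sum_card_bipartiteBelow (s := X) (t := E)
      (fun x e => x + e ∈ S)
    simp only [Finset.bipartiteAbove, Finset.bipartiteBelow] at this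
    rw [← this, Finset.mul_sum, ← smul_eq_mul]
    exact Finset.card_nsmul_le_sum _ _ _ hdeg
  -- With α = 1/256 the term in |S| becomes |S|k/32, and d ≥ 16 e^256 k makes the term in |X| at
  -- most half of |X|d. What remains, with nk ≤ 2|X|, is |S| ≥ 8nd.
  have hiso := sum_card_filter_add_mem_le (α := 1 / 256) (by norm_num) E hE'ind X S
  have hXle : X.card ≤ 2 ^ (k + 1) := by rw [hX, pow_succ]; have := Nat.one_le_two_pow (n := k); omega
  have hlog : 1 + Real.log S.card ≤ 4 * k := by
    have h1 : S.card ≤ 2 ^ (2 * (k + 1)) := by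
      calc S.card ≤ Y.card * Y.card := Finset.card_add_le
        _ ≤ 2 ^ (k + 1) * 2 ^ (k + 1) := by
          have := (Finset.card_le_card hYX).trans hXle
          gcongr
        _ = _ := by ring
    have h2 : Real.log S.card ≤ 2 * (k + 1) := by
      rcases Nat.eq_zero_or_pos S.card with h0 | h0
      · rw [h0]; simp; positivity
      calc Real.log S.card ≤ Real.log ((2 : ℝ) ^ (2 * (k + 1))) :=
            Real.log_le_log (by exact_mod_cast h0) (by exact_mod_cast h1)
        _ = (2 * (k + 1) : ℕ) * Real.log 2 := Real.log_pow _ _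
        _ ≤ (2 * (k + 1) : ℕ) * 1 := by
            gcongr; linarith [Real.log_two_lt_d9]
        _ = _ := by push_cast; ring
    have : (4 : ℝ) ≤ k := by exact_mod_cast hk
    linarith
  have hkpos : (4 : ℝ) ≤ k := by exact_mod_cast hk
  have hγd : 16 * Real.exp 256 * k ≤ d := by
    have h1 : 16 * Real.exp 256 ≤ dimConst := by
      unfold dimConst; push_cast
      linarith [Nat.le_ceil (16 * Real.exp 256)]
    have h2 : (dimConst : ℝ) * k ≤ d := by exact_mod_cast hd
    exact (mul_le_mul_of_nonneg_right h1 (by positivity)).trans h2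
  have hS8 : 8 * n * d ≤ S.card := by
    have hm : (n * k : ℝ) ≤ 2 * X.card := by
      have : n * k ≤ 2 * X.card := by rw [hX]; rw [pow_succ] at hnk; omega
      exact_mod_cast this
    have h1 : (X.card * d : ℝ) ≤ 2 * ((1 / 256 * S.card + Real.exp 256 * X.card) * (4 * k)) := by
      calc (X.card * d : ℝ) ≤ 2 * (∑ e ∈ E, {x ∈ X | x + e ∈ S}.card : ℕ) := by
            exact_mod_cast hcount
        _ ≤ 2 * ((1 / 256 * S.card + Real.exp (1 / (1 / 256)) * X.card) *
            (1 + Real.log S.card)) := by gcongr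
        _ ≤ _ := by
            rw [show (1 : ℝ) / (1 / 256) = 256 by norm_num]
            gcongr
    have h2 : 8 * Real.exp 256 * X.card * k ≤ X.card * d / 2 := by
      have : (0 : ℝ) ≤ X.card := Nat.cast_nonneg _
      nlinarith
    have h3 : (X.card * d : ℝ) ≤ S.card * k / 16 := by
      have : 2 * ((1 / 256 * (S.card : ℝ) + Real.exp 256 * X.card) * (4 * k)) =
        S.card * k / 32 + 8 * Real.exp 256 * X.card * k := by ring
      linarith
    have h4 : (8 * n * d : ℝ) * k ≤ S.card * k := by
      have : (n * k : ℝ) * d ≤ 2 * X.card * d := by gcongr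
      linarith
    have h5 := le_of_mul_le_mul_right h4 (by linarith)
    exact_mod_cast h5
  have hle : Module.finrank (ZMod 2) (Submodule.span (ZMod 2) (Y₁ : Set V)) ≤ d :=
    Submodule.finrank_mono (Submodule.span_mono (by exact_mod_cast hY₁X))
  refine ⟨Y₁, Y, hY₁Y, hYX, hYX.trans hX3, ?_⟩
  calc _ ≤ n * d + d * Y₁.card + 3 * (k + 1) * (Y \ Y₁).card + n := by gcongr
    -- Half of |S| pays for d|Y₁| + 3(k+1)|Y ∖ Y₁| up to 2d², by the gain recorded for Y and 12(k+1)
    -- ≤ d. The other half is at least 4nd, which covers nd, n and 2d².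
    _ ≤ S.card := by
      have h1 : 12 * (k + 1) * (Y \ Y₁).card ≤ d * (Y \ Y₁).card := by
        gcongr; omega
      have h2 : n ≤ n * d := Nat.le_mul_of_pos_right n (by omega)
      have h3 : d ^ 2 ≤ n * d := by rw [pow_two]; gcongr
      nlinarith

end CharTwo

/-! ### Popular sums and the popular core. -/

theorem exists_cover_small_subsets {α : Type*} [DecidableEq α] (q b : ℕ) :
    ∀ X : Finset α, X.card ≤ q * b →
      ∃ f : Fin b → Finset α, (∀ i, f i ⊆ X) ∧ (∀ i, (f i).card ≤ q) ∧ ∀ x ∈ X, ∃ i, x ∈ f i := by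
  induction b with
  | zero =>
    intro X hX
    have : X = ∅ := by simpa using hX
    exact ⟨fun _ => ∅, by simp, by simp, by simp [this]⟩
  | succ b ih =>
    intro X hX
    obtain ⟨U, hUX, hU⟩ := Finset.exists_subset_card_eq (min_le_right q X.card)
    obtain ⟨f, hf1, hf2, hf3⟩ := ih (X \ U) (by
      rw [Finset.card_sdiff_of_subset hUX, hU]
      rw [mul_add, mul_one] at hX
      omega)
    refine ⟨Fin.cons U f, fun i => ?_, fun i => ?_, fun x hx => ?_⟩
    · refine Fin.cases hUX (fun j => ?_) i
      exact (hf1 j).trans Finset.sdiff_subset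
    · refine Fin.cases (by simp [hU]) (fun j => ?_) i
      exact hf2 j
    · by_cases hxU : x ∈ U
      · exact ⟨0, hxU⟩
      · obtain ⟨j, hj⟩ := hf3 x (Finset.mem_sdiff.2 ⟨hx, hxU⟩)
        exact ⟨j.succ, hj⟩

section CharTwo
variable {V : Type*} [AddCommGroup V] [Module (ZMod 2) V] [DecidableEq V]

omit [Module (ZMod 2) V] in
/-- If all small subsets of `X` have sumsets of size at most `L`, the sumset of `X` is not much
larger. -/
theorem card_add_self_le_of_small_subsets {X : Finset V} {q b L : ℕ} (hX : X.card ≤ q * b)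
    (h : ∀ Y ⊆ X, Y.card ≤ 2 * q → (Y + Y).card ≤ L) : (X + X).card ≤ b ^ 2 * L := by
  obtain ⟨f, hf1, hf2, hf3⟩ := exists_cover_small_subsets q b X hX
  have hsub : X + X ⊆ (Finset.univ : Finset (Fin b × Fin b)).biUnion
      fun p => (f p.1 ∪ f p.2) + (f p.1 ∪ f p.2) := by
    intro z hz
    obtain ⟨x, hx, y, hy, rfl⟩ := Finset.mem_add.1 hz
    obtain ⟨i, hi⟩ := hf3 x hx
    obtain ⟨j, hj⟩ := hf3 y hy
    refine Finset.mem_biUnion.2 ⟨(i, j), Finset.mem_univ _, ?_⟩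
    exact Finset.add_mem_add (Finset.mem_union_left _ hi) (Finset.mem_union_right _ hj)
  refine (Finset.card_le_card hsub).trans ((Finset.card_biUnion_le_card_mul _ _ L ?_).trans ?_)
  · intro p _
    refine h _ (Finset.union_subset (hf1 _) (hf1 _)) ((Finset.card_union_le _ _).trans ?_)
    have := hf2 p.1
    have := hf2 p.2
    omega
  · simp [pow_two]

/-- The elements of `X + X` with at least `ρ` representations. -/
def popularSums (X : Finset V) (ρ : ℕ) : Finset V := {z ∈ X + X | ρ ≤ {x ∈ X | z + x ∈ X}.card}

/-- The elements of `X` all but a proportion `1 / q` of whose sums with `X` are popular. -/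
def popularCore (X : Finset V) (ρ q : ℕ) : Finset V :=
  {x ∈ X | q * {y ∈ X | x + y ∉ popularSums X ρ}.card ≤ X.card}

/-- Double counting of the pairs in X with unpopular sum. Each unpopular value accounts for at most
ρ of them, and each point outside the core for at least |X|/q. -/
theorem card_sdiff_popularCore_mul_le (X : Finset V) (ρ q : ℕ) :
    (X \ popularCore X ρ q).card * X.card ≤ q * ρ * (X + X).card := by
  set P := popularSums X ρ with hP
  have h1 : (X \ popularCore X ρ q).card * X.card ≤
      q * ∑ x ∈ X, {y ∈ X | x + y ∉ P}.card := by
    rw [← smul_eq_mul, Finset.mul_sum]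
    refine (Finset.card_nsmul_le_sum _ (fun x => q * {y ∈ X | x + y ∉ P}.card) _ ?_).trans
      (Finset.sum_le_sum_of_subset Finset.sdiff_subset)
    intro x hx
    rw [Finset.mem_sdiff] at hx
    by_contra! hlt
    exact hx.2 (Finset.mem_filter.2 ⟨hx.1, hlt.le⟩)
  have h2 : ∑ x ∈ X, {y ∈ X | x + y ∉ P}.card ≤ ∑ z ∈ (X + X) \ P, {x ∈ X | z + x ∈ X}.card := by
    have e1 : ∑ x ∈ X, {y ∈ X | x + y ∉ P}.card =
        ∑ x ∈ X, {z ∈ (X + X) \ P | z + x ∈ X}.card := by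
      refine Finset.sum_congr rfl fun x hx => ?_
      refine Finset.card_bij (fun y _ => x + y) ?_ ?_ ?_
      · intro y hy
        rw [Finset.mem_filter] at hy
        refine Finset.mem_filter.2 ⟨Finset.mem_sdiff.2 ⟨Finset.add_mem_add hx hy.1, hy.2⟩, ?_⟩
        rw [add_comm x y, add_assoc, ZModModule.add_self, add_zero]
        exact hy.1
      · intro y _ y' _ h
        simpa using h
      · intro z hz
        rw [Finset.mem_filter, Finset.mem_sdiff] at hz
        have hxz : x + (z + x) = z := by rw [add_comm z x, add_add_cancel_two]
        exact ⟨z + x, Finset.mem_filter.2 ⟨hz.2, by rw [hxz]; exact hz.1.2⟩, hxz⟩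
    rw [e1]
    exact (Finset.sum_card_bipartiteAbove_eq_sum_card_bipartiteBelow
      (fun x z => z + x ∈ X)).le
  have h3 : ∑ z ∈ (X + X) \ P, {x ∈ X | z + x ∈ X}.card ≤ (X + X).card * ρ := by
    calc _ ≤ ((X + X) \ P).card • ρ := by
          refine Finset.sum_le_card_nsmul _ _ _ fun z hz => ?_
          rw [Finset.mem_sdiff] at hz
          by_contra! hlt
          exact hz.2 (Finset.mem_filter.2 ⟨hz.1, hlt.le⟩)
      _ ≤ (X + X).card * ρ := by
          rw [smul_eq_mul]
          exact Nat.mul_le_mul_right _ (Finset.card_le_card Finset.sdiff_subset)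
  calc _ ≤ _ := h1
    _ ≤ q * ((X + X).card * ρ) := Nat.mul_le_mul_left _ (h2.trans h3)
    _ = _ := by ring

omit [Module (ZMod 2) V] in
theorem popularCore_subset (X : Finset V) (ρ q : ℕ) : popularCore X ρ q ⊆ X :=
  Finset.filter_subset _ _

omit [Module (ZMod 2) V] in
theorem mul_card_filter_notMem_popularSums_le {X : Finset V} {ρ q : ℕ} {x : V}
    (hx : x ∈ popularCore X ρ q) :
    q * {y ∈ X | x + y ∉ popularSums X ρ}.card ≤ X.card := (Finset.mem_filter.1 hx).2

omit [Module (ZMod 2) V] in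
/-- A pair of core elements have many common popular sums. -/
theorem card_filter_both_popular {X : Finset V} {ρ q : ℕ} {x x' : V}
    (hx : x ∈ popularCore X ρ q) (hx' : x' ∈ popularCore X ρ q) :
    q * X.card ≤ q * {y ∈ X | x + y ∈ popularSums X ρ ∧ x' + y ∈ popularSums X ρ}.card +
      2 * X.card := by
  set P := popularSums X ρ with hP
  have h1 := mul_card_filter_notMem_popularSums_le hx
  have h2 := mul_card_filter_notMem_popularSums_le hx'
  rw [← hP] at h1 h2
  have h3 := Finset.card_filter_add_card_filter_not (s := X) (fun y => x + y ∈ P ∧ x' + y ∈ P)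
  have h4 : {y ∈ X | ¬ (x + y ∈ P ∧ x' + y ∈ P)} ⊆ {y ∈ X | x + y ∉ P} ∪ {y ∈ X | x' + y ∉ P} := by
    intro y hy
    simp only [Finset.mem_union, Finset.mem_filter] at hy ⊢
    tauto
  have h5 := (Finset.card_le_card h4).trans (Finset.card_union_le _ _)
  calc q * X.card = q * ({y ∈ X | x + y ∈ P ∧ x' + y ∈ P}.card +
        {y ∈ X | ¬ (x + y ∈ P ∧ x' + y ∈ P)}.card) := by rw [h3]
    _ ≤ q * ({y ∈ X | x + y ∈ P ∧ x' + y ∈ P}.card + ({y ∈ X | x + y ∉ P}.card +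
        {y ∈ X | x' + y ∉ P}.card)) := by gcongr
    _ ≤ _ := by rw [mul_add, mul_add]; omega

/-- The core has a small sumset if there are few popular sums. -/
theorem card_popularCore_add_self_mul_le (X : Finset V) (ρ : ℕ) :
    (popularCore X ρ 8 + popularCore X ρ 8).card * (3 * X.card) ≤
      4 * (popularSums X ρ).card ^ 2 := by
  set P := popularSums X ρ with hP
  set C := popularCore X ρ 8 with hC
  -- Write x + x' = (x + y) + (x' + y). With q = 8 at least three quarters of the y ∈ X make both
  -- brackets popular.
  have h1 : ∀ z ∈ C + C, 3 * X.card ≤ 4 * {p ∈ P | z + p ∈ P}.card := by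
    intro z hz
    obtain ⟨x, hx, x', hx', rfl⟩ := Finset.mem_add.1 hz
    have h := card_filter_both_popular hx hx'
    rw [← hP] at h
    have h' : {y ∈ X | x + y ∈ P ∧ x' + y ∈ P}.card ≤ {p ∈ P | x + x' + p ∈ P}.card := by
      refine Finset.card_le_card_of_injOn (fun y => x + y) ?_ (add_right_injective x).injOn
      intro y hy
      have hy := Finset.mem_filter.1 hy
      refine Finset.mem_filter.2 ⟨hy.2.1, ?_⟩
      rw [show x + x' + (x + y) = x + x + (x' + y) by abel, ZModModule.add_self, zero_add]
      exact hy.2.2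
    omega
  have h2 : ∑ z ∈ C + C, {p ∈ P | z + p ∈ P}.card ≤ P.card * P.card := by
    have := Finset.sum_card_bipartiteAbove_eq_sum_card_bipartiteBelow (s := C + C) (t := P)
      (fun z p => z + p ∈ P)
    simp only [Finset.bipartiteAbove, Finset.bipartiteBelow] at this
    rw [this, ← smul_eq_mul]
    refine Finset.sum_le_card_nsmul _ _ _ fun p _ => ?_
    refine Finset.card_le_card_of_injOn (fun z => z + p) ?_ (add_left_injective p).injOn
    intro z hz
    exact (Finset.mem_filter.1 hz).2
  calc _ ≤ ∑ z ∈ C + C, 4 * {p ∈ P | z + p ∈ P}.card := by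
        rw [← smul_eq_mul]; exact Finset.card_nsmul_le_sum _ _ _ h1
    _ = 4 * ∑ z ∈ C + C, {p ∈ P | z + p ∈ P}.card := by rw [Finset.mul_sum]
    _ ≤ _ := by rw [pow_two]; gcongr

/-- If there are few popular sums, all sums of two core elements are popular. -/
theorem popularCore_add_self_subset {X : Finset V} {ρ q : ℕ}
    (h : q * ((popularSums X ρ).card + ρ) + 2 * X.card ≤ 2 * q * X.card) (hq : 0 < q) :
    popularCore X ρ q + popularCore X ρ q ⊆ popularSums X ρ := by
  set P := popularSums X ρ with hP
  intro z hz
  obtain ⟨x, hx, x', hx', rfl⟩ := Finset.mem_add.1 hz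
  have h1 := mul_card_filter_notMem_popularSums_le hx
  have h2 := mul_card_filter_notMem_popularSums_le hx'
  rw [← hP] at h1 h2
  refine Finset.mem_filter.2 ⟨Finset.add_mem_add (popularCore_subset _ _ _ hx)
    (popularCore_subset _ _ _ hx'), ?_⟩
  have e : ∀ w, q * X.card = q * {y ∈ X | w + y ∈ P}.card + q * {y ∈ X | w + y ∉ P}.card := by
    intro w
    rw [← mul_add, Finset.card_filter_add_card_filter_not]
  have tr : ∀ w, ({y ∈ X | w + y ∈ P}.image (w + ·)).card = {y ∈ X | w + y ∈ P}.card := fun w =>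
    Finset.card_image_of_injective _ (add_right_injective w)
  have trP : ∀ w, {y ∈ X | w + y ∈ P}.image (w + ·) ⊆ P := by
    intro w y hy
    obtain ⟨v, hv, rfl⟩ := Finset.mem_image.1 hy
    exact (Finset.mem_filter.1 hv).2
  -- Two large subsets of P overlap in at least ρ points. A common point x + u = x' + v gives the
  -- representation x + x' = u + v with u, v ∈ X.
  have h3 := inter_card_ge (trP x) (trP x')
  rw [tr, tr] at h3
  have h4 : ({y ∈ X | x + y ∈ P}.image (x + ·) ∩ {y ∈ X | x' + y ∈ P}.image (x' + ·)).card ≤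
      {y ∈ X | x + x' + y ∈ X}.card := by
    refine Finset.card_le_card_of_injOn (fun s => x + s) ?_ (add_right_injective x).injOn
    intro s hs
    rw [Finset.mem_coe, Finset.mem_inter, Finset.mem_image, Finset.mem_image] at hs
    obtain ⟨⟨u, hu, rfl⟩, v, hv, huv⟩ := hs
    simp only [add_add_cancel_two]
    refine Finset.mem_filter.2 ⟨(Finset.mem_filter.1 hu).1, ?_⟩
    rw [show x + x' + u = x' + (x + u) by abel, ← huv, add_add_cancel_two]
    exact (Finset.mem_filter.1 hv).1
  refine le_trans ?_ h4
  refine le_of_mul_le_mul_left ?_ hq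
  have h5 := Nat.mul_le_mul_left q h3
  rw [mul_add, mul_add] at h5
  have := e x
  have := e x'
  rw [mul_add] at h
  have h6 : 2 * q * X.card = q * X.card + q * X.card := by ring
  omega

/-- The popular sums are sums of two elements of a small subset. -/
theorem exists_small_subset_covering_popularSums {n k : ℕ} {X : Finset V} (hX : X.Nonempty)
    (hXc : X.card ≤ 2 ^ (k + 1)) (hk : 0 < k) (hn : 4 * k ≤ n) (hnk : 2 ^ k ≤ n * k)
    (hk3 : 40 * k ^ 3 ≤ 2 ^ k) :
    ∃ Y ⊆ X, k * Y.card ≤ n ∧ popularSums X ((40 * k ^ 3) * (40 * k ^ 3)) ⊆ Y + Y := by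
  set t := n / (2 * k) with ht
  have ht1 : 2 * k * t ≤ n := Nat.mul_div_le n (2 * k)
  have ht2 : n < 2 * k * (t + 1) := Nat.lt_mul_div_succ n (by omega)
  have ht3 : n ≤ 4 * k * t := by
    rw [mul_add, mul_one] at ht2
    have : 4 * k * t = 2 * (2 * k * t) := by ring
    omega
  have hbound : 5 * k * X.card ≤ 40 * k ^ 3 * t := by
    calc 5 * k * X.card ≤ 5 * k * (2 * (n * k)) := by
          gcongr; refine hXc.trans ?_; rw [pow_succ]; omega
      _ ≤ 5 * k * (2 * ((4 * k * t) * k)) := by gcongr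
      _ = _ := by ring
  have hPc : (popularSums X ((40 * k ^ 3) * (40 * k ^ 3))).card ≤ 2 ^ (k + 1) * 2 ^ (k + 1) := by
    calc _ ≤ (X + X).card := Finset.card_le_card (Finset.filter_subset _ _)
      _ ≤ X.card * X.card := Finset.card_add_le
      _ ≤ _ := by gcongr
  -- The choice a = 5k works because |P| s ≤ 2^(2k+2) 2^k. As |X| ≤ 2nk and n ≤ 4kt, block size and
  -- block count 40k³ = 5k · 2k · 4k are what the hitting condition needs. Two hitting sets of size
  -- t ≤ n/(2k) make k|Y| ≤ n.
  obtain ⟨Y, hYX, hYc, hY⟩ := exists_small_subset_covering_popular hX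
    (popularSums X ((40 * k ^ 3) * (40 * k ^ 3))) (s := 40 * k ^ 3) (b := 40 * k ^ 3) (a := 5 * k)
    (t₁ := t) (t₂ := t) (fun z hz => (Finset.mem_filter.1 hz).2) (by omega)
    (by
      calc _ ≤ (2 ^ (k + 1) * 2 ^ (k + 1)) * 2 ^ k := by gcongr
        _ = 2 ^ (3 * k + 2) := by ring
        _ ≤ _ := Nat.pow_le_pow_right (by norm_num) (by omega))
    (by positivity) hbound hbound
  refine ⟨Y, hYX, ?_, hY⟩
  calc k * Y.card ≤ k * (t + t) := by gcongr
    _ = 2 * k * t := by ring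
    _ ≤ n := ht1

end CharTwo

/-! ### Structured sumsets from a large stabiliser. -/

theorem exists_fin_image_eq {α : Type*} [DecidableEq α] {F : Finset α} (hF : F.Nonempty) {c : ℕ}
    (hc : F.card ≤ c) : ∃ f : Fin c → α, Finset.univ.image f = F := by
  have : Nonempty (F ↪ Fin c) := Function.Embedding.nonempty_of_card_le (by simpa using hc)
  obtain ⟨e⟩ := this
  have : Nonempty F := hF.to_subtype
  refine ⟨fun i => (Function.invFun e i : F), ?_⟩
  ext x
  simp only [Finset.mem_image, Finset.mem_univ, true_and]
  constructor
  · rintro ⟨i, rfl⟩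
    exact (Function.invFun e i).2
  · intro hx
    obtain ⟨i, hi⟩ := Function.invFun_surjective e.injective ⟨x, hx⟩
    exact ⟨i, by rw [hi]⟩

theorem exists_fin_span_eq {K V : Type*} [Field K] [AddCommGroup V] [Module K V] [Finite V]
    (G : Submodule K V) {k : ℕ} (hk : Module.finrank K G ≤ k) :
    ∃ g : Fin k → V, Submodule.span K (Set.range g) = G := by
  have : Module.Finite K V := Module.Finite.of_finite
  let b := Module.finBasis K G
  have hinj : Function.Injective (Fin.castLE hk) := Fin.castLE_injective hk
  refine ⟨Function.extend (Fin.castLE hk) (fun i => (b i : V)) 0, le_antisymm ?_ ?_⟩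
  · rw [Submodule.span_le]
    rintro _ ⟨i, rfl⟩
    by_cases hi : ∃ j, Fin.castLE hk j = i
    · obtain ⟨j, rfl⟩ := hi
      rw [hinj.extend_apply]
      exact (b j).2
    · rw [Function.extend_apply' _ _ _ hi]
      exact G.zero_mem
  · intro v hv
    have h1 : (⟨v, hv⟩ : G) ∈ Submodule.span K (Set.range b) := by
      rw [b.span_eq]; trivial
    have h2 := Submodule.mem_map_of_mem (f := G.subtype) h1
    rw [Submodule.map_span, ← Set.range_comp] at h2
    refine Submodule.span_mono ?_ h2
    rintro _ ⟨i, rfl⟩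
    exact ⟨Fin.castLE hk i, by rw [hinj.extend_apply]; rfl⟩

section CharTwo
variable {V : Type*} [AddCommGroup V] [Module (ZMod 2) V] [DecidableEq V] [Fintype V]

open Classical in
/-- A union of `c` cosets of the subspace spanned by `k` vectors. -/
noncomputable def cosetUnion {k c : ℕ} (g : Fin k → V) (f : Fin c → V) : Finset V :=
  Finset.univ.image f + ({v | v ∈ Submodule.span (ZMod 2) (Set.range g)} : Finset V)

/-- The sums `x + y` with `x ∈ A` and `y ∈ A ∪ {v}`. -/
def pointedSumset (v : V) (A : Finset V) : Finset V := (A + A) ∪ A.image (v + ·)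

/-- The sumset of `X` contains a large set that is almost described by a few vectors. -/
def HasStructuredSumset (k c p : ℕ) (X : Finset V) : Prop :=
  ∃ (g : Fin k → V) (f : Fin c → V) (v : V), ∃ D ⊆ cosetUnion g f,
    (cosetUnion g f).card ≤ 2 ^ k ∧ D.card ≤ p ∧ pointedSumset v (cosetUnion g f \ D) ⊆ X + X ∧
    2 ^ (k + 1) ≤ (pointedSumset v (cosetUnion g f \ D)).card + p

omit [Module (ZMod 2) V] in
theorem mem_sumStab {A : Finset V} {g : V} : g ∈ sumStab A ↔ ∀ z ∈ A + A, z + g ∈ A + A := by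
  simp [sumStab]

/-- The stabiliser of `A + A`, as a subspace. -/
def sumStabSubmodule (A : Finset V) : Submodule (ZMod 2) V where
  carrier := {g | g ∈ sumStab A}
  add_mem' := by
    intro a b ha hb
    rw [Set.mem_ofPred_eq, mem_sumStab] at *
    intro z hz
    rw [← add_assoc]
    exact hb _ (ha _ hz)
  zero_mem' := by
    rw [Set.mem_ofPred_eq, mem_sumStab]
    intro z hz
    simpa using hz
  smul_mem' := by
    intro c x hx
    have : c = 0 ∨ c = 1 := by revert c; decide
    rcases this with rfl | rfl
    · rw [Set.mem_ofPred_eq, mem_sumStab]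
      intro z hz
      simpa using hz
    · simpa using hx

theorem mem_sumStabSubmodule {A : Finset V} {g : V} : g ∈ sumStabSubmodule A ↔ g ∈ sumStab A :=
  Iff.rfl

theorem card_sumStab (A : Finset V) :
    (sumStab A).card = 2 ^ Module.finrank (ZMod 2) (sumStabSubmodule A) := by
  have h := Module.natCard_eq_pow_finrank (K := ZMod 2) (V := sumStabSubmodule A)
  rw [Nat.card_zmod] at h
  rw [← h]
  exact (Nat.subtype_card (sumStab A) (fun x => mem_sumStabSubmodule.symm)).symm

/-- Let G be the stabiliser of A + A. Then J = A + G is a union of at most c cosets of G, satisfies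
J + J ⊆ A + A, and has exactly 2^k points. Since |X| > 2^k, some x ∈ X lies outside J, and A + A
together with x + J has at least 2^(k+1) elements. Replacing J by A in x + J loses at most p of
them. -/
theorem hasStructuredSumset_of_large_stab {k c p : ℕ} {X A : Finset V} (hAX : A ⊆ X)
    (hA : A.Nonempty) (hX : 2 ^ k < X.card) (hAA : (A + A).card < 2 ^ (k + 1))
    (hAp : 2 ^ k ≤ A.card + p) (hp : p < (sumStab A).card)
    (hc : 2 ^ k ≤ c * (sumStab A).card) : HasStructuredSumset k c p X := by
  classical
  set G := sumStab A with hG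
  set T := A + A with hT
  have G0 : (0 : V) ∈ G := (sumStabSubmodule A).zero_mem
  have Gadd : ∀ a ∈ G, ∀ b ∈ G, a + b ∈ G := fun a ha b hb => (sumStabSubmodule A).add_mem ha hb
  have T0 : (0 : V) ∈ T := by
    obtain ⟨a, ha⟩ := hA
    rw [← ZModModule.add_self a]
    exact Finset.add_mem_add ha ha
  have GT : G ⊆ T := fun g hg => by simpa using mem_sumStab.1 hg 0 T0
  set J := A + G with hJ
  have hAJ : A ⊆ J := fun a ha => by
    rw [← add_zero a]; exact Finset.add_mem_add ha G0
  have hJG : ∀ j ∈ J, ∀ g ∈ G, j + g ∈ J := by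
    intro j hj g hg
    obtain ⟨a, ha, g', hg', rfl⟩ := Finset.mem_add.1 hj
    rw [add_assoc]
    exact Finset.add_mem_add ha (Gadd _ hg' _ hg)
  have hJG' : J + G = J := by
    refine Finset.Subset.antisymm (fun x hx => ?_) (fun x hx => ?_)
    · obtain ⟨j, hj, g, hg, rfl⟩ := Finset.mem_add.1 hx
      exact hJG j hj g hg
    · rw [← add_zero x]
      exact Finset.add_mem_add hx G0
  have hJJ : J + J ⊆ T := by
    intro z hz
    obtain ⟨x, hx, y, hy, rfl⟩ := Finset.mem_add.1 hz
    obtain ⟨a, ha, g, hg, rfl⟩ := Finset.mem_add.1 hx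
    obtain ⟨b, hb, g', hg', rfl⟩ := Finset.mem_add.1 hy
    rw [show a + g + (b + g') = a + b + (g + g') by abel]
    exact mem_sumStab.1 (Gadd _ hg _ hg') _ (Finset.add_mem_add ha hb)
  have hJne : J.Nonempty := hA.mono hAJ
  have hJle : J.card ≤ 2 ^ k := by
    by_contra! hlt
    have h1 := two_pow_le_card_add (k + 1) J J hJne hJne (by rw [pow_succ]; omega)
    have h2 := Finset.card_le_card hJJ
    omega
  have hGJ : G.card ∣ J.card := by
    refine Finset.card_dvd_card_add_right (s := A) (t := G) ?_
    have coset : ∀ a b z : V, z ∈ a +ᵥ G → z ∈ b +ᵥ G → a +ᵥ G ⊆ b +ᵥ G := by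
      intro a b z ha hb w hw
      obtain ⟨g₁, hg₁, rfl⟩ := Finset.mem_vadd_finset.1 ha
      obtain ⟨g₂, hg₂, h₂⟩ := Finset.mem_vadd_finset.1 hb
      obtain ⟨g₃, hg₃, rfl⟩ := Finset.mem_vadd_finset.1 hw
      refine Finset.mem_vadd_finset.2 ⟨g₂ + (g₁ + g₃), Gadd _ hg₂ _ (Gadd _ hg₁ _ hg₃), ?_⟩
      rw [vadd_eq_add] at h₂ ⊢
      rw [← add_assoc, h₂, vadd_eq_add, vadd_eq_add,
        show a + g₁ + (g₁ + g₃) = a + g₃ + (g₁ + g₁) by abel, ZModModule.add_self, add_zero]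
    rintro _ ⟨a, -, rfl⟩ _ ⟨b, -, rfl⟩ hne
    refine Finset.disjoint_left.2 fun z ha hb => hne ?_
    exact Finset.Subset.antisymm (coset a b z ha hb) (coset b a z hb ha)
  have hGpow : G.card = 2 ^ Module.finrank (ZMod 2) (sumStabSubmodule A) := card_sumStab A
  have hGk : Module.finrank (ZMod 2) (sumStabSubmodule A) ≤ k := by
    have : G.card ≤ 2 ^ k := (Nat.le_of_dvd hJne.card_pos hGJ).trans hJle
    rw [hGpow] at this
    exact (Nat.pow_le_pow_iff_right (by norm_num)).1 this
  -- Both |J| and 2^k are multiples of |G|, and they differ by at most p < |G|.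
  have hJeq : J.card = 2 ^ k := by
    have h1 : G.card ∣ 2 ^ k := hGpow ▸ pow_dvd_pow 2 hGk
    have h2 : G.card ∣ 2 ^ k - J.card := Nat.dvd_sub h1 hGJ
    have h3 := Finset.card_le_card hAJ
    rcases Nat.eq_zero_or_pos (2 ^ k - J.card) with h | h
    · omega
    · have := Nat.le_of_dvd h h2
      omega
  obtain ⟨x, hxX, hxJ⟩ : ∃ x ∈ X, x ∉ J := by
    by_contra! h
    have := Finset.card_le_card (show X ⊆ J from h)
    omega
  -- The set J ∪ (x + G) has more than 2^k points, so its sumset has at least 2^(k+1). Stability of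
  -- J and T under G keeps that sumset inside T ∪ (x + J).
  have hJx : 2 ^ (k + 1) ≤ (T ∪ J.image (x + ·)).card := by
    set J' := J ∪ G.image (x + ·) with hJ'
    have h1 : 2 ^ k < J'.card := by
      rw [← hJeq]
      refine Finset.card_lt_card (Finset.ssubset_iff_of_subset Finset.subset_union_left |>.2
        ⟨x, Finset.mem_union_right _ (Finset.mem_image.2 ⟨0, G0, add_zero x⟩), hxJ⟩)
    have hJ'ne : J'.Nonempty := hJne.mono Finset.subset_union_left
    refine (two_pow_le_card_add (k + 1) J' J' hJ'ne hJ'ne (by rw [pow_succ]; omega)).trans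
      (Finset.card_le_card ?_)
    intro z hz
    obtain ⟨y, hy, w, hw, rfl⟩ := Finset.mem_add.1 hz
    rw [hJ', Finset.mem_union, Finset.mem_image] at hy hw
    rw [Finset.mem_union, Finset.mem_image]
    rcases hy with hy | ⟨g, hg, rfl⟩ <;> rcases hw with hw | ⟨g', hg', rfl⟩
    · exact Or.inl (hJJ (Finset.add_mem_add hy hw))
    · exact Or.inr ⟨y + g', hJG _ hy _ hg', by abel⟩
    · exact Or.inr ⟨w + g, hJG _ hw _ hg, by abel⟩
    · left
      rw [show x + g + (x + g') = x + x + (g + g') by abel, ZModModule.add_self, zero_add]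
      exact GT (Gadd _ hg _ hg')
  obtain ⟨F, hFJ, hFc, hF⟩ := Finset.ruzsa_covering_add (A := J) (B := G) (K := c) ⟨0, G0⟩ (by
    rw [hJG', hJeq]; exact_mod_cast hc)
  have hFc : F.card ≤ c := by exact_mod_cast hFc
  have hFne : F.Nonempty := by
    rw [Finset.nonempty_iff_ne_empty]
    rintro rfl
    obtain ⟨j, hj⟩ := hJne
    simpa using hF hj
  obtain ⟨f, hf⟩ := exists_fin_image_eq hFne hFc
  obtain ⟨g, hg⟩ := exists_fin_span_eq (sumStabSubmodule A) hGk
  have hcu : cosetUnion g f = J := by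
    unfold cosetUnion
    rw [hf, hg]
    have : ({v | v ∈ sumStabSubmodule A} : Finset V) = G := by
      ext v; simp [mem_sumStabSubmodule, hG]
    rw [this]
    refine Finset.Subset.antisymm (fun z hz => ?_) (hF.trans ?_)
    · obtain ⟨j, hj, g, hg, rfl⟩ := Finset.mem_add.1 hz
      exact hJG _ (hFJ hj) _ hg
    · refine Finset.add_subset_add subset_rfl fun z hz => ?_
      obtain ⟨a, ha, b, hb, rfl⟩ := Finset.mem_sub.1 hz
      rw [ZModModule.sub_eq_add]
      exact Gadd _ ha _ hb
  have hDc : (J \ A).card ≤ p := by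
    rw [Finset.card_sdiff_of_subset hAJ]; omega
  refine ⟨g, f, x, J \ A, ?_⟩
  rw [hcu, Finset.sdiff_sdiff_eq_self hAJ]
  refine ⟨Finset.sdiff_subset, hJle, hDc, ?_, ?_⟩
  · refine Finset.union_subset (Finset.add_subset_add hAX hAX) fun z hz => ?_
    obtain ⟨a, ha, rfl⟩ := Finset.mem_image.1 hz
    exact Finset.add_mem_add hxX (hAX ha)
  · refine hJx.trans ?_
    have : T ∪ J.image (x + ·) ⊆ pointedSumset x A ∪ (J \ A).image (x + ·) := by
      intro z hz
      rw [Finset.mem_union, Finset.mem_image] at hz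
      rw [pointedSumset, Finset.mem_union, Finset.mem_union]
      rcases hz with hz | ⟨j, hj, rfl⟩
      · exact Or.inl (Or.inl hz)
      · by_cases hjA : j ∈ A
        · exact Or.inl (Or.inr (Finset.mem_image_of_mem _ hjA))
        · exact Or.inr (Finset.mem_image_of_mem _ (Finset.mem_sdiff.2 ⟨hj, hjA⟩))
    refine (Finset.card_le_card this).trans ((Finset.card_union_le _ _).trans ?_)
    have := Finset.card_image_le (s := J \ A) (f := (x + ·))
    omega

end CharTwo

/-! ### The dichotomy between cheap and structured sumsets. -/

theorem eventually_mul_pow_le_two_pow (E j : ℕ) : ∀ᶠ k : ℕ in atTop, E * k ^ j ≤ 2 ^ k := by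
  have h := tendsto_pow_const_div_const_pow_of_one_lt j (r := (2 : ℝ)) (by norm_num)
  have h' := h.const_mul (E : ℝ)
  rw [mul_zero] at h'
  filter_upwards [h'.eventually (gt_mem_nhds one_pos)] with k hk
  have h2 : (0 : ℝ) < 2 ^ k := by positivity
  rw [← mul_div_assoc, div_lt_one h2] at hk
  exact_mod_cast hk.le

section CharTwo
variable {V : Type*} [AddCommGroup V] [Module (ZMod 2) V] [DecidableEq V]

/-- A set of small dimension without cheap sumset has a large piece of bounded doubling. -/
theorem exists_popularCore_small_doubling {n k C : ℕ} {X : Finset V} (hC : 0 < C)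
    (hX : X.card = 2 ^ k + 1) (hk : 0 < k) (hn : 4 * k ≤ n) (hnk : n * k ≤ 2 ^ (k + 1))
    (hnk' : 2 ^ k ≤ n * k) (hk3 : 40 * k ^ 3 ≤ 2 ^ k)
    (hd : Module.finrank (ZMod 2) (Submodule.span (ZMod 2) (X : Set V)) ≤ C * k)
    (hcheap : ¬ HasCheapSumset n k X) {ρ : ℕ} (hρ : ρ = (40 * k ^ 3) * (40 * k ^ 3)) :
    (X \ popularCore X ρ 8).card ≤ 3072 * C * k ^ 2 * ρ ∧
      (popularCore X ρ 8 + popularCore X ρ 8).card ≤ 48 * C ^ 2 * 2 ^ k := by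
  have small : ∀ Y ⊆ X, Y.card ≤ n → (Y + Y).card ≤ 6 * C * 2 ^ k := by
    intro Y hYX hYn
    have h1 := card_add_self_lt_of_not_hasCheapSumset hcheap hYX
    have h2 : Module.finrank (ZMod 2) (Submodule.span (ZMod 2) (Y : Set V)) ≤ C * k :=
      (Submodule.finrank_mono (Submodule.span_mono (by exact_mod_cast hYX))).trans hd
    calc (Y + Y).card ≤ _ := h1.le
      _ ≤ n * (C * k) + (C * k) * n + n := by gcongr
      _ ≤ n * (C * k) + (C * k) * n + n * (C * k) := by
          gcongr; exact Nat.le_mul_of_pos_right n (Nat.mul_pos hC hk)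
      _ = 3 * C * (n * k) := by ring
      _ ≤ 3 * C * 2 ^ (k + 1) := by gcongr
      _ = _ := by ring
  have hM : 1 ≤ 2 ^ k := Nat.one_le_two_pow
  -- Pieces of size n/2 are used so that the union of two of them still has at most n elements; 8k
  -- pieces suffice because 2^k ≤ nk.
  have hXX : (X + X).card ≤ (8 * k) ^ 2 * (6 * C * 2 ^ k) := by
    refine card_add_self_le_of_small_subsets (q := n / 2) ?_ fun Y hY hYc =>
      small Y hY (hYc.trans (by omega))
    have h1 : n ≤ 4 * (n / 2) := by omega
    have h2 : n * k ≤ 4 * (n / 2) * k := Nat.mul_le_mul_right k h1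
    have : n / 2 * (8 * k) = 2 * (4 * (n / 2) * k) := by ring
    omega
  constructor
  · have h1 := card_sdiff_popularCore_mul_le X ρ 8
    refine le_of_mul_le_mul_right (a := X.card) ?_ (by omega)
    calc _ ≤ 8 * ρ * (X + X).card := h1
      _ ≤ 8 * ρ * ((8 * k) ^ 2 * (6 * C * 2 ^ k)) := by gcongr
      _ = 3072 * C * k ^ 2 * ρ * 2 ^ k := by ring
      _ ≤ _ := by gcongr; omega
  · have hXne : X.Nonempty := Finset.card_pos.1 (by omega)
    obtain ⟨Y, hYX, hYc, hYP⟩ := exists_small_subset_covering_popularSums hXne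
      (by rw [hX, pow_succ]; omega) hk hn hnk' hk3
    have hP : (popularSums X ρ).card ≤ 6 * C * 2 ^ k := by
      rw [hρ]
      exact (Finset.card_le_card hYP).trans
        (small Y hYX ((Nat.le_mul_of_pos_left _ hk).trans hYc))
    have h1 := card_popularCore_add_self_mul_le X ρ
    refine le_of_mul_le_mul_right (a := 3 * X.card) ?_ (by omega)
    calc _ ≤ 4 * (popularSums X ρ).card ^ 2 := h1
      _ ≤ 4 * (6 * C * 2 ^ k) ^ 2 := by gcongr
      _ = 48 * C ^ 2 * 2 ^ k * (3 * 2 ^ k) := by ring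
      _ ≤ _ := by gcongr; omega

/-- If a dense subset of a subspace of dimension close to `k` lies in a set without cheap
sumset, the number of its popular sums is smaller than `2 ^ (k + 1)`. -/
theorem card_popularSums_le {n k c : ℕ} {X X₁ : Finset V} (hX₁ : X₁ ⊆ X) (hne : X₁.Nonempty)
    (hX : X.card ≤ 2 ^ (k + 1)) (hk : 0 < k) (hn : 4 * k ≤ n) (hnk' : 2 ^ k ≤ n * k)
    (hk3 : 40 * k ^ 3 ≤ 2 ^ k) (hcheap : ¬ HasCheapSumset n k X)
    (hd : Module.finrank (ZMod 2) (Submodule.span (ZMod 2) (X₁ : Set V)) ≤ k + c) :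
    (popularSums X₁ ((40 * k ^ 3) * (40 * k ^ 3))).card ≤ n * k + (2 * c + 2) * n := by
  obtain ⟨Y, hYX, hYc, hYP⟩ := exists_small_subset_covering_popularSums hne
    ((Finset.card_le_card hX₁).trans hX) hk hn hnk' hk3
  have h1 := card_add_self_lt_of_not_hasCheapSumset hcheap (hYX.trans hX₁)
  have h2 : Module.finrank (ZMod 2) (Submodule.span (ZMod 2) (Y : Set V)) ≤ k + c :=
    (Submodule.finrank_mono (Submodule.span_mono (by exact_mod_cast hYX))).trans hd
  have h3 : Y.card ≤ n := (Nat.le_mul_of_pos_left _ hk).trans hYc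
  -- Since k|Y| ≤ n, the cost of listing Y inside its span is O(n), and nk enters with coefficient
  -- one.
  calc _ ≤ (Y + Y).card := Finset.card_le_card hYP
    _ ≤ _ := h1.le
    _ ≤ n * (k + c) + (k + c) * Y.card + n := by gcongr
    _ = n * (k + c) + k * Y.card + c * Y.card + n := by ring
    _ ≤ n * (k + c) + n + c * n + n := by gcongr
    _ = _ := by ring

end CharTwo

set_option maxHeartbeats 1000000 in
/-- Every set of more than `2 ^ k` vectors has a large sumset of low complexity. -/
theorem exists_cheap_or_structured {δ : ℝ} (hδ : 0 < δ) (hδ1 : δ ≤ 1) :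
    ∃ c e k₀ : ℕ, ∀ k ≥ k₀, ∀ (n : ℕ) (V : Type) [AddCommGroup V] [Module (ZMod 2) V]
      [DecidableEq V] [Fintype V], Module.finrank (ZMod 2) V = n →
      (1 + δ) * n * k ≤ 2 ^ (k + 1) → 2 ^ k ≤ n * k → ∀ X : Finset V, X.card = 2 ^ k + 1 →
      HasCheapSumset n k X ∨ HasStructuredSumset k c (e * k ^ 8) X := by
  obtain ⟨C, hCdef⟩ : ∃ N : ℕ, N = dimConst := ⟨_, rfl⟩
  have hC : 0 < C := by rw [hCdef]; unfold dimConst; omega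
  obtain ⟨K, hK⟩ : ∃ N : ℕ, N = 96 * C ^ 2 := ⟨_, rfl⟩
  obtain ⟨c₁, hc₁⟩ : ∃ N : ℕ, N = K ^ 4 + K + 1 := ⟨_, rfl⟩
  obtain ⟨q, hq⟩ : ∃ N : ℕ, N = ⌈8 / δ⌉₊ := ⟨_, rfl⟩
  obtain ⟨C', hC'⟩ : ∃ N : ℕ, N = 2 ^ K ^ 4 * K * 2 := ⟨_, rfl⟩
  obtain ⟨κ, hκ⟩ : ∃ κ : ℕ, 2 * C' * (1 - δ / 4) ^ (κ + 1) ≤ δ / 4 := by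
    have h := (tendsto_pow_atTop_nhds_zero_of_lt_one (r := 1 - δ / 4) (by linarith)
      (by linarith)).const_mul (2 * C' : ℝ)
    rw [mul_zero] at h
    obtain ⟨κ, hκ⟩ := (((tendsto_add_atTop_iff_nat 1).2 h).eventually
      (ge_mem_nhds (show (0 : ℝ) < δ / 4 by positivity))).exists
    exact ⟨κ, hκ⟩
  -- The two summands bound |X ∖ X₁| and |X₁ ∖ X₂| in units of k^8. Here 4915200 = 3072 · 1600, with
  -- ρ = 1600 k^6.
  obtain ⟨e, he⟩ : ∃ N : ℕ, N = 4915200 * C + 1600 * q * K := ⟨_, rfl⟩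
  obtain ⟨c, hc⟩ : ∃ N : ℕ, N = 4 * C' ^ κ := ⟨_, rfl⟩
  obtain ⟨E, hE⟩ : ∃ N : ℕ, N = ⌈8 * (1600 + 2 * e) / δ⌉₊ + c * e + 41 := ⟨_, rfl⟩
  obtain ⟨k₀, hk₀⟩ := eventually_atTop.1 (eventually_mul_pow_le_two_pow E 8)
  refine ⟨c, e, max k₀ (max 4 ⌈4 * (2 * c₁ + 2) / δ⌉₊), fun k hkk n V _ _ _ _ hV hδnk hnk' X hX => ?_⟩
  by_contra! hcon
  obtain ⟨hcheap, hstruct⟩ := hcon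
  have hk4 : 4 ≤ k := (le_max_left _ _).trans ((le_max_right _ _).trans hkk)
  have hkc : 4 * (2 * c₁ + 2) ≤ δ * k := by
    have h1 : ⌈4 * (2 * c₁ + 2) / δ⌉₊ ≤ k :=
      (le_max_right _ _).trans ((le_max_right _ _).trans hkk)
    have h2 := Nat.ceil_le.1 h1
    rw [div_le_iff₀ hδ] at h2
    linarith
  have hEk : E * k ^ 8 ≤ 2 ^ k := hk₀ k ((le_max_left _ _).trans hkk)
  set M := 2 ^ k with hM
  have hMpos : 1 ≤ M := Nat.one_le_two_pow
  have hsucc : 2 ^ (k + 1) = 2 * M := by rw [pow_succ]; ring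
  have hnk : n * k ≤ 2 ^ (k + 1) := by
    have : (n * k : ℝ) ≤ (2 : ℝ) ^ (k + 1) := by
      refine le_trans ?_ hδnk
      have : (0 : ℝ) ≤ n * k := by positivity
      nlinarith
    exact_mod_cast this
  have hk8 : ∀ j ≤ 8, k ^ j ≤ k ^ 8 := fun j hj => Nat.pow_le_pow_right (by omega) hj
  have h41 : 41 * k ^ 8 ≤ M := (Nat.mul_le_mul_right _ (by omega)).trans hEk
  have hn : 4 * k ≤ n := by
    have h1 : 4 * k * k ≤ n * k := by
      calc 4 * k * k = 4 * k ^ 2 := by ring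
        _ ≤ 41 * k ^ 8 := Nat.mul_le_mul (by norm_num) (hk8 2 (by norm_num))
        _ ≤ M := h41
        _ ≤ _ := hnk'
    exact le_of_mul_le_mul_right h1 (by omega)
  have hk3 : 40 * k ^ 3 ≤ 2 ^ k :=
    (Nat.mul_le_mul (by norm_num) (hk8 3 (by norm_num))).trans h41
  have hdn : Module.finrank (ZMod 2) (Submodule.span (ZMod 2) (X : Set V)) ≤ n :=
    hV ▸ Submodule.finrank_le _
  have hd : Module.finrank (ZMod 2) (Submodule.span (ZMod 2) (X : Set V)) ≤ C * k := by
    by_contra! h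
    exact hcheap (hasCheapSumset_of_large_dim hX hk4 hnk hdn (hCdef ▸ h.le))
  obtain ⟨ρ, hρ⟩ : ∃ N : ℕ, N = (40 * k ^ 3) * (40 * k ^ 3) := ⟨_, rfl⟩
  obtain ⟨hbad₁, hdoub⟩ := exists_popularCore_small_doubling hC hX (by omega) hn hnk hnk' hk3 hd
    hcheap hρ
  set X₁ := popularCore X ρ 8 with hX₁
  have hX₁X : X₁ ⊆ X := popularCore_subset _ _ _
  obtain ⟨p, hp⟩ : ∃ N : ℕ, N = e * k ^ 8 := ⟨_, rfl⟩
  rw [← hp] at hstruct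
  have hp1 : 3072 * C * k ^ 2 * ρ = 4915200 * C * k ^ 8 := by rw [hρ]; ring
  rw [hp1] at hbad₁
  have hpsplit : p = 4915200 * C * k ^ 8 + 1600 * q * K * k ^ 8 := by rw [hp, he]; ring
  -- numeric consequences of `k` being large
  have hEp : c * p < M := by
    calc c * p = c * e * k ^ 8 := by rw [hp]; ring
      _ < E * k ^ 8 := by
          refine Nat.mul_lt_mul_of_pos_right (by omega) (by positivity)
      _ ≤ M := hEk
  have hδM : 8 * (ρ + 2 * p : ℝ) ≤ δ * M := by
    have h1 : 8 * (1600 + 2 * e : ℝ) / δ ≤ E := by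
      refine (Nat.le_ceil _).trans ?_
      rw [hE]; push_cast
      have : (0 : ℝ) ≤ c * e := by positivity
      linarith
    have h2 : (E : ℝ) * k ^ 8 ≤ M := by exact_mod_cast hEk
    have h3 : (ρ : ℝ) ≤ 1600 * k ^ 8 := by
      have : ρ ≤ 1600 * k ^ 8 := by
        calc ρ = 1600 * k ^ 6 := by rw [hρ]; ring
          _ ≤ _ := Nat.mul_le_mul_left _ (hk8 6 (by norm_num))
      exact_mod_cast this
    have h4 : (p : ℝ) = e * k ^ 8 := by rw [hp]; push_cast; ring
    calc 8 * (ρ + 2 * p : ℝ) ≤ 8 * (1600 * k ^ 8 + 2 * (e * k ^ 8)) := by rw [h4]; gcongr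
      _ = δ * (8 * (1600 + 2 * e : ℝ) / δ * k ^ 8) := by field_simp
      _ ≤ δ * (E * k ^ 8) := by gcongr
      _ ≤ δ * M := by gcongr
  have hMR : (1 : ℝ) ≤ M := by exact_mod_cast hMpos
  have h2p : 16 * p ≤ M := by
    have h0 : (0 : ℝ) ≤ ρ := Nat.cast_nonneg _
    have : (16 * p : ℝ) ≤ M := by nlinarith
    exact_mod_cast this
  have hX₁card : X.card = (X \ X₁).card + X₁.card := (Finset.card_sdiff_add_card_eq_card hX₁X).symm
  have hX₁lo : M + 1 ≤ X₁.card + 4915200 * C * k ^ 8 := by omega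
  have hX₁half : M ≤ 2 * X₁.card := by omega
  have hX₁hi : X₁.card ≤ M + 1 := by omega
  have hX₁ne : X₁.Nonempty := Finset.card_pos.1 (by omega)
  have hdoub' : (X₁ + X₁).card ≤ K * X₁.card := by
    calc _ ≤ 48 * C ^ 2 * M := hdoub
      _ ≤ 48 * C ^ 2 * (2 * X₁.card) := by gcongr
      _ = _ := by rw [hK]; ring
  have hspan := two_pow_finrank_span_le hX₁ne hdoub'
  have hdim : Module.finrank (ZMod 2) (Submodule.span (ZMod 2) (X₁ : Set V)) ≤ k + c₁ := by
    have h1 : 2 ^ Module.finrank (ZMod 2) (Submodule.span (ZMod 2) (X₁ : Set V)) ≤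
        2 ^ (k + c₁) := by
      calc _ ≤ _ := hspan
        _ ≤ 2 ^ K ^ 4 * (2 ^ K * 2 ^ (k + 1)) := by
            gcongr
            · exact Nat.lt_two_pow_self.le
            · omega
        _ = _ := by rw [hc₁]; ring
    exact (Nat.pow_le_pow_iff_right (by norm_num)).1 h1
  have hP₁ := card_popularSums_le hX₁X hX₁ne (by omega) (by omega) hn hnk' hk3 hcheap hdim
  rw [← hρ] at hP₁
  set P₁ := popularSums X₁ ρ with hP₁def
  -- The margin gives (1 + δ) nk ≤ 2M, and for large k the extra (2c₁ + 2)n is at most (δ/4) nk.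
  have hP₁R : (P₁.card : ℝ) ≤ (2 - δ / 2) * M := by
    have h1 : (P₁.card : ℝ) ≤ n * k + (2 * c₁ + 2) * n := by exact_mod_cast hP₁
    have h2 : ((2 * c₁ + 2) * n : ℝ) ≤ δ / 4 * (n * k) := by
      have h0 : (0 : ℝ) ≤ n := Nat.cast_nonneg _
      calc ((2 * c₁ + 2) * n : ℝ) ≤ (δ * k / 4) * n := by gcongr; linarith
        _ = _ := by ring
    have h3 : (1 + δ) * (n * k : ℝ) ≤ 2 * M := by
      have : (2 : ℝ) ^ (k + 1) = 2 * M := by rw [hM]; push_cast; ring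
      linarith
    have h4 : (0 : ℝ) ≤ n * k := by positivity
    have h5 : (1 + δ / 4) * (n * k : ℝ) ≤ (1 - δ / 4) * ((1 + δ) * (n * k)) := by
      have : 0 ≤ (δ / 2 - δ ^ 2 / 4) * (n * k : ℝ) := mul_nonneg (by nlinarith) h4
      nlinarith
    have h6 : (1 - δ / 4) * ((1 + δ) * (n * k : ℝ)) ≤ (1 - δ / 4) * (2 * M) :=
      mul_le_mul_of_nonneg_left h3 (by linarith)
    linarith
  -- A second core is needed because the first popular sums were bounded only by a large multiple of
  -- M. With |P₁| < 2M, all sums of two points of this core are popular.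
  set X₂ := popularCore X₁ ρ q with hX₂
  have hX₂X₁ : X₂ ⊆ X₁ := popularCore_subset _ _ _
  have hqpos : 0 < q := hq ▸ Nat.ceil_pos.2 (by positivity)
  have hq8 : 8 ≤ q * δ := by
    have := Nat.le_ceil (8 / δ)
    rwa [div_le_iff₀ hδ, ← hq] at this
  have hbad₂ : (X₁ \ X₂).card ≤ 1600 * q * K * k ^ 8 := by
    have h1 := card_sdiff_popularCore_mul_le X₁ ρ q
    have h2 : (X₁ \ X₂).card ≤ q * ρ * K := by
      refine le_of_mul_le_mul_right (a := X₁.card) ?_ hX₁ne.card_pos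
      calc _ ≤ q * ρ * (X₁ + X₁).card := h1
        _ ≤ q * ρ * (K * X₁.card) := by gcongr
        _ = _ := by ring
    calc _ ≤ q * ρ * K := h2
      _ = 1600 * q * K * k ^ 6 := by rw [hρ]; ring
      _ ≤ _ := Nat.mul_le_mul_left _ (hk8 6 (by norm_num))
  have hX₂card : X₁.card = (X₁ \ X₂).card + X₂.card :=
    (Finset.card_sdiff_add_card_eq_card hX₂X₁).symm
  have hX₂lo : M + 1 ≤ X₂.card + p := by omega
  have hX₂ne : X₂.Nonempty := Finset.card_pos.1 (by omega)
  have hT : X₂ + X₂ ⊆ P₁ := by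
    refine popularCore_add_self_subset ?_ hqpos
    have h1 : ((M : ℝ) - p) ≤ X₁.card := by
      have : M ≤ X₁.card + p := by omega
      have : (M : ℝ) ≤ X₁.card + p := by exact_mod_cast this
      linarith
    have h0 : (0 : ℝ) ≤ ρ := Nat.cast_nonneg _
    have hp0 : (0 : ℝ) ≤ p := Nat.cast_nonneg _
    have hqR : (1 : ℝ) ≤ q := by exact_mod_cast hqpos
    have h2 : (q : ℝ) * (P₁.card + ρ) ≤ (2 * q - 2) * (M - p) := by
      have h3 : (q : ℝ) * (P₁.card + ρ) ≤ q * ((2 - δ / 2) * M + ρ) := by gcongr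
      have h4 : (q : ℝ) * (8 * (ρ + 2 * p)) ≤ q * (δ * M) := by gcongr
      have h5 : 8 * (M : ℝ) ≤ q * δ * M := by gcongr
      nlinarith
    have h6 : (2 * (q : ℝ) - 2) * (M - p) ≤ (2 * q - 2) * X₁.card :=
      mul_le_mul_of_nonneg_left h1 (by linarith)
    have h7 : (q : ℝ) * (P₁.card + ρ) + 2 * X₁.card ≤ 2 * q * X₁.card := by linarith
    exact_mod_cast h7
  have hTc : ((X₂ + X₂).card : ℝ) ≤ (2 - δ / 2) * M :=
    (Nat.cast_le.2 (Finset.card_le_card hT)).trans hP₁R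
  have hstab := card_le_mul_card_sumStab hX₂ne (Submodule.span (ZMod 2) (X₁ : Set V))
    (fun a ha => Submodule.subset_span (hX₂X₁ ha)) (C := C') (κ := κ) (γ := δ / 4)
    (by
      rw [Module.natCard_eq_pow_finrank (K := ZMod 2), Nat.card_zmod]
      calc _ ≤ _ := hspan
        _ ≤ 2 ^ K ^ 4 * (K * (2 * X₂.card)) := by gcongr; omega
        _ = _ := by rw [hC']; ring) (by positivity) (by linarith)
    (by
      refine hTc.trans ?_
      have h1 : ((M : ℝ) - p) ≤ X₂.card := by
        have : M ≤ X₂.card + p := by omega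
        have : (M : ℝ) ≤ X₂.card + p := by exact_mod_cast this
        linarith
      have h2 : (2 - δ / 4) * ((M : ℝ) - p) ≤ (2 - δ / 4) * X₂.card :=
        mul_le_mul_of_nonneg_left h1 (by linarith)
      have h0 : (0 : ℝ) ≤ ρ := Nat.cast_nonneg _
      have hp0 : (0 : ℝ) ≤ p := Nat.cast_nonneg _
      nlinarith) hκ
  have hMstab : M ≤ c * (sumStab X₂).card := by
    calc M ≤ 2 * X₂.card := by omega
      _ ≤ 2 * (2 * C' ^ κ * (sumStab X₂).card) := by gcongr
      _ = _ := by rw [hc]; ring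
  refine hstruct (hasStructuredSumset_of_large_stab (hX₂X₁.trans hX₁X) hX₂ne (by omega) ?_
    (by omega) ?_ hMstab)
  · have : ((X₂ + X₂).card : ℝ) < (2 ^ (k + 1) : ℕ) := by
      rw [hsucc]; push_cast
      nlinarith
    exact_mod_cast this
  · exact lt_of_mul_lt_mul_left (hEp.trans_le hMstab) (Nat.zero_le c)

/-! ### Counting the two families, and the upper bound on the clique number. -/

theorem card_filter_card_le {α : Type*} [DecidableEq α] (J : Finset α) (p : ℕ) :
    {D ∈ J.powerset | D.card ≤ p}.card ≤ (J.card + 1) ^ p := by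
  induction p with
  | zero =>
    have : {D ∈ J.powerset | D.card ≤ 0} = {∅} := by
      ext D
      simp only [Finset.mem_filter, Finset.mem_powerset, Nat.le_zero, Finset.card_eq_zero,
        Finset.mem_singleton]
      exact ⟨fun h => h.2, fun h => by simp [h]⟩
    rw [this]; simp
  | succ p ih =>
    have hsub : {D ∈ J.powerset | D.card ≤ p + 1} ⊆ {D ∈ J.powerset | D.card ≤ p} ∪
        ({D ∈ J.powerset | D.card ≤ p} ×ˢ J).image (fun Dx => insert Dx.2 Dx.1) := by
      intro D hD
      simp only [Finset.mem_filter, Finset.mem_powerset, Finset.mem_union, Finset.mem_image,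
        Finset.mem_product, Prod.exists] at hD ⊢
      by_cases h : D.card ≤ p
      · exact Or.inl ⟨hD.1, h⟩
      · right
        obtain ⟨x, hx⟩ := Finset.card_pos.1 (show 0 < D.card by omega)
        refine ⟨D.erase x, x, ⟨⟨(Finset.erase_subset _ _).trans hD.1, ?_⟩, hD.1 hx⟩,
          Finset.insert_erase hx⟩
        rw [Finset.card_erase_of_mem hx]; omega
    calc _ ≤ _ := Finset.card_le_card hsub
      _ ≤ {D ∈ J.powerset | D.card ≤ p}.card + {D ∈ J.powerset | D.card ≤ p}.card * J.card := by
          refine (Finset.card_union_le _ _).trans (Nat.add_le_add_left ?_ _)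
          exact Finset.card_image_le.trans (Finset.card_product _ _).le
      _ = {D ∈ J.powerset | D.card ≤ p}.card * (J.card + 1) := by ring
      _ ≤ _ := by rw [pow_succ]; gcongr

section Measure
variable {n : ℕ}

instance (n : ℕ) : IsProbabilityMeasure (randomSubsetLaw n) := by
  unfold randomSubsetLaw; infer_instance

theorem randomSubsetLaw_real_singleton (A : Set (Fin n → ZMod 2)) :
    (randomSubsetLaw n).real {A} = (1 / 2) ^ 2 ^ n := by
  have h1 : (1 : ℝ) - 1 / 2 = 1 / 2 := by norm_num
  unfold randomSubsetLaw
  rw [setBernoulli_real_singleton _ (Set.subset_univ A) Set.finite_univ]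
  simp only [halfProb]
  rw [h1, ← pow_add, ← Set.compl_eq_univ_sdiff, Set.ncard_add_ncard_compl]
  simp [Nat.card_eq_fintype_card]

theorem randomSubsetLaw_real_apply (E : Set (Set (Fin n → ZMod 2))) :
    (randomSubsetLaw n).real E = E.ncard * (1 / 2) ^ 2 ^ n := by
  have hE : E.Finite := Set.toFinite E
  lift E to Finset (Set (Fin n → ZMod 2)) using hE
  rw [← sum_measureReal_singleton]
  simp [randomSubsetLaw_real_singleton]

theorem ncard_superset_mul {α : Type*} [Fintype α] (S : Finset α) :
    {A : Set α | ↑S ⊆ A}.ncard * 2 ^ S.card = 2 ^ Fintype.card α := by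
  classical
  have h1 : {A : Set α | ↑S ⊆ A} = (fun T : Finset α => (T : Set α)) '' (Finset.Icc S Finset.univ : Finset (Finset α)) := by
    ext A
    simp only [Set.mem_ofPred_eq, Finset.coe_Icc, Set.mem_image, Set.mem_Icc]
    constructor
    · intro h
      refine ⟨A.toFinset, ⟨?_, Finset.subset_univ _⟩, by simp⟩
      intro x hx
      simpa using h hx
    · rintro ⟨T, ⟨hT, -⟩, rfl⟩
      exact_mod_cast hT
  rw [h1, Set.ncard_image_of_injective _ Finset.coe_injective, Set.ncard_coe_finset,
    Finset.card_Icc_finset (Finset.subset_univ S), ← pow_add, Finset.card_univ,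
    Nat.sub_add_cancel (Finset.card_le_univ S)]

theorem randomSubsetLaw_real_superset (S : Finset (Fin n → ZMod 2)) :
    (randomSubsetLaw n).real {A | ↑S ⊆ A} = (1 / 2) ^ S.card := by
  rw [randomSubsetLaw_real_apply]
  have h := ncard_superset_mul S
  have hc : Fintype.card (Fin n → ZMod 2) = 2 ^ n := by simp
  rw [hc] at h
  have h' : (({A : Set (Fin n → ZMod 2) | ↑S ⊆ A}.ncard : ℕ) : ℝ) * 2 ^ S.card = 2 ^ 2 ^ n := by
    exact_mod_cast h
  rw [one_div_pow, one_div_pow, eq_div_iff (by positivity), mul_one_div, div_mul_eq_mul_div, h',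
    div_self (by positivity)]

/-- The union bound over a family of large sets. -/
theorem randomSubsetLaw_real_union_le (F : Finset (Finset (Fin n → ZMod 2))) {a b : ℕ}
    (hF : F.card ≤ 2 ^ a) (hS : ∀ S ∈ F, a + b ≤ S.card) :
    (randomSubsetLaw n).real {A | ∃ S ∈ F, ∀ v ∈ S, v ≠ 0 → v ∈ A} ≤ 2 * (1 / 2) ^ b := by
  have hsub : {A : Set (Fin n → ZMod 2) | ∃ S ∈ F, ∀ v ∈ S, v ≠ 0 → v ∈ A} ⊆
      ⋃ S ∈ F, {A | ↑(S.erase 0) ⊆ A} := by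
    rintro A ⟨S, hS, h⟩
    rw [Set.mem_iUnion₂]
    refine ⟨S, hS, fun v hv => ?_⟩
    rw [Finset.mem_coe, Finset.mem_erase] at hv
    exact h v hv.2 hv.1
  calc _ ≤ (randomSubsetLaw n).real (⋃ S ∈ F, {A | ↑(S.erase 0) ⊆ A}) :=
        measureReal_mono hsub (measure_ne_top _ _)
    _ ≤ ∑ S ∈ F, (randomSubsetLaw n).real {A | ↑(S.erase 0) ⊆ A} :=
        measureReal_biUnion_finset_le _ _
    -- The factor 2 pays for the vector 0, which S may contain and A need not.
    _ ≤ ∑ S ∈ F, 2 * (1 / 2 : ℝ) ^ (a + b) := by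
        refine Finset.sum_le_sum fun S hSF => ?_
        rw [randomSubsetLaw_real_superset]
        have h1 : a + b ≤ (S.erase 0).card + 1 := by
          have := hS S hSF
          have := Finset.pred_card_le_card_erase (s := S) (a := (0 : Fin n → ZMod 2))
          omega
        calc (1 / 2 : ℝ) ^ (S.erase 0).card = 2 * (1 / 2) ^ ((S.erase 0).card + 1) := by
              rw [pow_succ]; ring
          _ ≤ _ := by
              gcongr 2 * ?_
              exact pow_le_pow_of_le_one (by norm_num) (by norm_num) h1
    _ = F.card * (1 / 2) ^ a * (2 * (1 / 2) ^ b) := by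
        rw [Finset.sum_const, nsmul_eq_mul, pow_add]; ring
    _ ≤ 2 ^ a * (1 / 2) ^ a * (2 * (1 / 2) ^ b) := by
        gcongr; exact_mod_cast hF
    _ = _ := by rw [← mul_pow]; norm_num

end Measure

section CharTwo
variable {V : Type*} [AddCommGroup V] [Module (ZMod 2) V] [DecidableEq V] [Fintype V]

open Classical in
/-- The span of a tuple of vectors, as a finite set. -/
noncomputable def spanFinset {d : ℕ} (g : Fin d → V) : Finset V :=
  {v | v ∈ Submodule.span (ZMod 2) (Set.range g)}

omit [DecidableEq V] in
theorem mem_spanFinset {d : ℕ} {g : Fin d → V} {v : V} :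
    v ∈ spanFinset g ↔ v ∈ Submodule.span (ZMod 2) (Set.range g) := by
  simp [spanFinset]

/-- The sumsets `Y + Y` with `Y = Y₁ ∪ Z`, `Y₁` a set of `t₁` vectors in a subspace of dimension
`d` and `Z ⊆ Y₁ + Y₁ + Y₁` of cardinality `t₂`. -/
noncomputable def cheapFamily (V : Type*) [AddCommGroup V] [Module (ZMod 2) V] [DecidableEq V] [Fintype V]
    (d t₁ t₂ : ℕ) : Finset (Finset V) :=
  (Finset.univ : Finset (Fin d → V)).biUnion fun g =>
    (Finset.powersetCard t₁ (spanFinset g)).biUnion fun Y₁ =>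
      (Finset.powersetCard t₂ (Y₁ + Y₁ + Y₁)).image fun Z => (Y₁ ∪ Z) + (Y₁ ∪ Z)

omit [DecidableEq V] in
theorem card_spanFinset_le {d : ℕ} (g : Fin d → V) : (spanFinset g).card ≤ 2 ^ d := by
  have h1 := Module.natCard_eq_pow_finrank (K := ZMod 2)
    (V := Submodule.span (ZMod 2) (Set.range g))
  rw [Nat.card_zmod] at h1
  have h2 : (spanFinset g).card = Nat.card (Submodule.span (ZMod 2) (Set.range g)) :=
    (Nat.subtype_card _ (fun x => mem_spanFinset)).symm
  rw [h2, h1]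
  refine Nat.pow_le_pow_right (by norm_num) ?_
  exact (finrank_range_le_card (R := ZMod 2) g).trans (by simp)

omit [DecidableEq V] in
theorem card_fun_fin {n : ℕ} (hV : Module.finrank (ZMod 2) V = n) (d : ℕ) :
    Fintype.card (Fin d → V) = 2 ^ (n * d) := by
  have := Module.card_eq_pow_finrank (K := ZMod 2) (V := V)
  rw [ZMod.card, hV] at this
  rw [Fintype.card_fun, this, Fintype.card_fin, pow_mul]

/-- The exponent counts bits: nd for the generators, d for each point of Y₁ in their span, and
3(k+1) for each further point, because |Y₁ + Y₁ + Y₁| ≤ 2^(3(k+1)). -/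
theorem card_cheapFamily_le {n k d t₁ t₂ : ℕ} (hV : Module.finrank (ZMod 2) V = n)
    (ht : t₁ ≤ 2 ^ (k + 1)) :
    (cheapFamily V d t₁ t₂).card ≤ 2 ^ (n * d + d * t₁ + 3 * (k + 1) * t₂) := by
  unfold cheapFamily
  refine (Finset.card_biUnion_le_card_mul _ _ (2 ^ (d * t₁) * 2 ^ (3 * (k + 1) * t₂)) ?_).trans ?_
  · intro g _
    refine (Finset.card_biUnion_le_card_mul _ _ (2 ^ (3 * (k + 1) * t₂)) ?_).trans ?_
    · intro Y₁ hY₁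
      have hc := (Finset.mem_powersetCard.1 hY₁).2
      have h3 : (Y₁ + Y₁ + Y₁).card ≤ 2 ^ (3 * (k + 1)) := by
        calc _ ≤ (Y₁ + Y₁).card * Y₁.card := Finset.card_add_le
          _ ≤ Y₁.card * Y₁.card * Y₁.card := by gcongr; exact Finset.card_add_le
          _ ≤ 2 ^ (k + 1) * 2 ^ (k + 1) * 2 ^ (k + 1) := by rw [hc]; gcongr
          _ = _ := by ring
      refine Finset.card_image_le.trans ?_
      rw [Finset.card_powersetCard, pow_mul]
      exact (Nat.choose_le_pow _ _).trans (Nat.pow_le_pow_left h3 _)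
    · gcongr
      rw [Finset.card_powersetCard, pow_mul]
      exact (Nat.choose_le_pow _ _).trans (Nat.pow_le_pow_left (card_spanFinset_le g) _)
  · rw [Finset.card_univ, card_fun_fin hV, ← pow_add, ← pow_add]
    refine Nat.pow_le_pow_right (by norm_num) (by omega)

theorem exists_mem_cheapFamily {n k : ℕ} {X : Finset V} (hV : Module.finrank (ZMod 2) V = n)
    (h : HasCheapSumset n k X) :
    ∃ d ≤ n, ∃ t₁ ≤ X.card, ∃ t₂ ≤ X.card, ∃ S ∈ cheapFamily V d t₁ t₂, S ⊆ X + X ∧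
      n * d + d * t₁ + 3 * (k + 1) * t₂ + n ≤ S.card := by
  obtain ⟨Y₁, Y, hY₁Y, hYX, hY3, hcard⟩ := h
  set d := Module.finrank (ZMod 2) (Submodule.span (ZMod 2) (Y₁ : Set V))
  refine ⟨d, hV ▸ Submodule.finrank_le _, Y₁.card, Finset.card_le_card (hY₁Y.trans hYX),
    (Y \ Y₁).card, Finset.card_le_card (Finset.sdiff_subset.trans hYX), Y + Y, ?_,
    Finset.add_subset_add hYX hYX, hcard⟩
  obtain ⟨g, hg⟩ := exists_fin_span_eq (Submodule.span (ZMod 2) (Y₁ : Set V)) (le_refl d)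
  unfold cheapFamily
  simp only [Finset.mem_biUnion, Finset.mem_univ, true_and, Finset.mem_image,
    Finset.mem_powersetCard]
  refine ⟨g, Y₁, ⟨fun v hv => ?_, rfl⟩, Y \ Y₁, ⟨?_, rfl⟩, ?_⟩
  · rw [mem_spanFinset, hg]
    exact Submodule.subset_span hv
  · exact Finset.sdiff_subset.trans hY3
  · rw [Finset.union_sdiff_of_subset hY₁Y]

/-- The sets occurring in `HasStructuredSumset`. -/
noncomputable def structuredFamily (V : Type*) [AddCommGroup V] [Module (ZMod 2) V] [DecidableEq V] [Fintype V]
    (k c p : ℕ) : Finset (Finset V) :=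
  (Finset.univ : Finset ((Fin k → V) × (Fin c → V) × V)).biUnion fun gfv =>
    if (cosetUnion gfv.1 gfv.2.1).card ≤ 2 ^ k then
      {D ∈ (cosetUnion gfv.1 gfv.2.1).powerset | D.card ≤ p}.image fun D =>
        pointedSumset gfv.2.2 (cosetUnion gfv.1 gfv.2.1 \ D)
    else ∅

/-- The k generators, c representatives and one extra vector cost n bits each. Each deleted point
costs k + 1 bits, because 2^k + 1 ≤ 2^(k+1). -/
theorem card_structuredFamily_le {n k c p : ℕ} (hV : Module.finrank (ZMod 2) V = n) :
    (structuredFamily V k c p).card ≤ 2 ^ (n * (k + c + 1) + (k + 1) * p) := by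
  unfold structuredFamily
  refine (Finset.card_biUnion_le_card_mul _ _ (2 ^ ((k + 1) * p)) ?_).trans ?_
  · rintro ⟨g, f, v⟩ _
    dsimp only
    split_ifs with h
    · refine Finset.card_image_le.trans ((card_filter_card_le _ _).trans ?_)
      rw [pow_mul]
      gcongr
      rw [pow_succ]
      have := Nat.one_le_two_pow (n := k)
      omega
    · simp
  · have h1 : Fintype.card V = 2 ^ n := by
      have := Module.card_eq_pow_finrank (K := ZMod 2) (V := V)
      rwa [ZMod.card, hV] at this
    rw [Finset.card_univ, Fintype.card_prod, Fintype.card_prod, card_fun_fin hV, card_fun_fin hV,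
      h1, ← pow_add, ← pow_add, ← pow_add]
    exact Nat.pow_le_pow_right (by norm_num) (le_of_eq (by ring))

theorem exists_mem_structuredFamily {k c p : ℕ} {X : Finset V}
    (h : HasStructuredSumset k c p X) :
    ∃ S ∈ structuredFamily V k c p, S ⊆ X + X ∧ 2 ^ (k + 1) ≤ S.card + p := by
  obtain ⟨g, f, v, D, hD, hJ, hDp, hS, hc⟩ := h
  refine ⟨_, ?_, hS, hc⟩
  unfold structuredFamily
  rw [Finset.mem_biUnion]
  refine ⟨(g, f, v), Finset.mem_univ _, ?_⟩
  dsimp only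
  rw [if_pos hJ]
  exact Finset.mem_image.2 ⟨D, Finset.mem_filter.2 ⟨Finset.mem_powerset.2 hD, hDp⟩, rfl⟩

end CharTwo

theorem exists_card_eq_of_lt_cliqueNum {V : Type*} [AddCommGroup V] [Fintype V] [DecidableEq V]
    [Module (ZMod 2) V]
    {A : Set V} {m : ℕ} (h : m < (cayleySumGraph A).cliqueNum) :
    ∃ X : Finset V, X.card = m + 1 ∧ ∀ v ∈ X + X, v ≠ 0 → v ∈ A := by
  obtain ⟨s, hs⟩ := (cayleySumGraph A).exists_isNClique_cliqueNum
  obtain ⟨X, hXs, hX⟩ := Finset.exists_subset_card_eq (s := s) (n := m + 1)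
    (by rw [hs.card_eq]; omega)
  refine ⟨X, hX, fun v hv hv0 => ?_⟩
  obtain ⟨x, hx, y, hy, rfl⟩ := Finset.mem_add.1 hv
  have hxy : x ≠ y := by
    rintro rfl
    exact hv0 (ZModModule.add_self x)
  exact (hs.isClique (hXs hx) (hXs hy) hxy).2

theorem mem_iUnion_of_lt_cliqueNum {n k c p : ℕ} {A : Set (Fin n → ZMod 2)}
    (hdich : ∀ X : Finset (Fin n → ZMod 2), X.card = 2 ^ k + 1 →
      HasCheapSumset n k X ∨ HasStructuredSumset k c p X)
    (h : 2 ^ k < (cayleySumGraph A).cliqueNum) :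
    A ∈ {A : Set (Fin n → ZMod 2) | ∃ S ∈ {S ∈ structuredFamily (Fin n → ZMod 2) k c p |
        2 ^ (k + 1) ≤ S.card + p}, ∀ v ∈ S, v ≠ 0 → v ∈ A} ∪
      ⋃ q ∈ Finset.range (n + 1) ×ˢ Finset.range (2 ^ k + 2) ×ˢ Finset.range (2 ^ k + 2),
        {A | ∃ S ∈ {S ∈ cheapFamily (Fin n → ZMod 2) q.1 q.2.1 q.2.2 |
          n * q.1 + q.1 * q.2.1 + 3 * (k + 1) * q.2.2 + n ≤ S.card},
            ∀ v ∈ S, v ≠ 0 → v ∈ A} := by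
  obtain ⟨X, hX, hXA⟩ := exists_card_eq_of_lt_cliqueNum h
  rcases hdich X hX with hch | hst
  · obtain ⟨d, hd, t₁, ht₁, t₂, ht₂, S, hS, hSX, hc⟩ := exists_mem_cheapFamily (by simp) hch
    refine Or.inr (Set.mem_iUnion₂.2 ⟨(d, t₁, t₂), ?_, S, Finset.mem_filter.2 ⟨hS, hc⟩,
      fun v hv => hXA v (hSX hv)⟩)
    simp only [Finset.mem_product, Finset.mem_range]
    omega
  · obtain ⟨S, hS, hSX, hc⟩ := exists_mem_structuredFamily hst
    exact Or.inl ⟨S, Finset.mem_filter.2 ⟨hS, hc⟩, fun v hv => hXA v (hSX hv)⟩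

/-- The structured family and every cheap family each contribute at most 2 · 2^(-n). There are at
most 2^(3k+4) parameter triples for the cheap families, and n ≥ 4k + 7 absorbs that number. -/
theorem randomSubsetLaw_real_lt_cliqueNum_le {n k c p : ℕ} (hk : 1 ≤ k)
    (hn : n ≤ 2 ^ (k + 1)) (hkn : 4 * k + 7 ≤ n)
    (hp : n * (k + c + 1) + (k + 1) * p + n + p ≤ 2 ^ (k + 1))
    (hdich : ∀ X : Finset (Fin n → ZMod 2), X.card = 2 ^ k + 1 →
      HasCheapSumset n k X ∨ HasStructuredSumset k c p X) :
    (randomSubsetLaw n).real {A | 2 ^ k < (cayleySumGraph A).cliqueNum} ≤ (1 / 2) ^ k := by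
  have h2k : 2 ≤ 2 ^ k := by
    calc 2 = 2 ^ 1 := by norm_num
      _ ≤ 2 ^ k := Nat.pow_le_pow_right (by norm_num) hk
  refine (measureReal_mono (fun A hA => mem_iUnion_of_lt_cliqueNum hdich hA)
    (measure_ne_top _ _)).trans ?_
  refine (measureReal_union_le _ _).trans ?_
  have h1 : (randomSubsetLaw n).real {A : Set (Fin n → ZMod 2) | ∃ S ∈
      {S ∈ structuredFamily (Fin n → ZMod 2) k c p |
        2 ^ (k + 1) ≤ S.card + p}, ∀ v ∈ S, v ≠ 0 → v ∈ A} ≤ 2 * (1 / 2) ^ n := by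
    refine randomSubsetLaw_real_union_le _
      ((Finset.card_filter_le _ _).trans (card_structuredFamily_le (n := n) (by simp))) ?_
    intro S hS
    have := (Finset.mem_filter.1 hS).2
    omega
  have h2 : ∀ q ∈ Finset.range (n + 1) ×ˢ Finset.range (2 ^ k + 2) ×ˢ Finset.range (2 ^ k + 2),
      (randomSubsetLaw n).real {A | ∃ S ∈ {S ∈ cheapFamily (Fin n → ZMod 2) q.1 q.2.1 q.2.2 |
          n * q.1 + q.1 * q.2.1 + 3 * (k + 1) * q.2.2 + n ≤ S.card},
            ∀ v ∈ S, v ≠ 0 → v ∈ A} ≤ 2 * (1 / 2) ^ n := by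
    rintro ⟨d, t₁, t₂⟩ hq
    simp only [Finset.mem_product, Finset.mem_range] at hq
    refine randomSubsetLaw_real_union_le _
      ((Finset.card_filter_le _ _).trans (card_cheapFamily_le (n := n) (k := k) (by simp) ?_)) ?_
    · dsimp only
      rw [pow_succ]
      omega
    · intro S hS
      exact (Finset.mem_filter.1 hS).2
  have h3 : (randomSubsetLaw n).real (⋃ q ∈ Finset.range (n + 1) ×ˢ Finset.range (2 ^ k + 2) ×ˢ
      Finset.range (2 ^ k + 2),
        {A | ∃ S ∈ {S ∈ cheapFamily (Fin n → ZMod 2) q.1 q.2.1 q.2.2 |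
          n * q.1 + q.1 * q.2.1 + 3 * (k + 1) * q.2.2 + n ≤ S.card},
            ∀ v ∈ S, v ≠ 0 → v ∈ A}) ≤ 2 ^ (3 * k + 4) * (2 * (1 / 2) ^ n) := by
    refine (measureReal_biUnion_finset_le _ _).trans ((Finset.sum_le_card_nsmul _ _ _ h2).trans ?_)
    rw [nsmul_eq_mul]
    gcongr
    simp only [Finset.card_product, Finset.card_range]
    have e1 : n + 1 ≤ 2 ^ (k + 2) := by rw [pow_succ] at hn ⊢; rw [pow_succ]; omega
    have e2 : 2 ^ k + 2 ≤ 2 ^ (k + 1) := by rw [pow_succ]; omega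
    have e3 : (n + 1) * ((2 ^ k + 2) * (2 ^ k + 2)) ≤
        2 ^ (k + 2) * (2 ^ (k + 1) * 2 ^ (k + 1)) := by gcongr
    calc (((n + 1) * ((2 ^ k + 2) * (2 ^ k + 2)) : ℕ) : ℝ) ≤
        ((2 ^ (k + 2) * (2 ^ (k + 1) * 2 ^ (k + 1)) : ℕ) : ℝ) := by exact_mod_cast e3
      _ = _ := by push_cast; ring
  have h4 : (1 / 2 : ℝ) ^ n ≤ (1 / 2) ^ (4 * k + 7) :=
    pow_le_pow_of_le_one (by norm_num) (by norm_num) hkn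
  have h5 : (1 : ℝ) ≤ 2 ^ (3 * k + 4) := one_le_pow₀ (by norm_num)
  calc _ ≤ 2 * (1 / 2 : ℝ) ^ n + 2 ^ (3 * k + 4) * (2 * (1 / 2) ^ n) := add_le_add h1 h3
    _ ≤ 2 ^ (3 * k + 4) * (2 * (1 / 2 : ℝ) ^ n) + 2 ^ (3 * k + 4) * (2 * (1 / 2) ^ n) := by
        exact add_le_add (le_mul_of_one_le_left (by positivity) h5) le_rfl
    _ = 2 ^ (3 * k + 6) * (1 / 2) ^ n := by ring
    _ ≤ 2 ^ (3 * k + 6) * (1 / 2) ^ (4 * k + 7) := by gcongr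
    _ = (2 ^ (3 * k + 6) * (1 / 2) ^ (3 * k + 6)) * ((1 / 2) ^ k * (1 / 2)) := by
        rw [mul_assoc, ← pow_succ, ← pow_add]; congr 2; omega
    _ = (1 / 2) ^ k * (1 / 2) := by rw [← mul_pow]; norm_num
    _ ≤ _ := mul_le_of_le_one_right (by positivity) (by norm_num)

/-- The margin leaves δnk to spare. For large k half of it covers n(c + 2), and the other half
covers the deletion terms, which are at most 3e k^9. -/
theorem exists_forall_real_lt_cliqueNum_le {δ : ℝ} (hδ : 0 < δ) (hδ1 : δ ≤ 1) :
    ∃ k₀ : ℕ, ∀ k ≥ k₀, ∀ n : ℕ, (1 + δ) * n * k ≤ 2 ^ (k + 1) → 2 ^ k ≤ n * k →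
      (randomSubsetLaw n).real {A | 2 ^ k < (cayleySumGraph A).cliqueNum} ≤ (1 / 2) ^ k := by
  obtain ⟨c, e, k₁, hdich⟩ := exists_cheap_or_structured hδ hδ1
  obtain ⟨E, hE⟩ := exists_nat_ge (6 * e / δ)
  obtain ⟨C, hC⟩ := exists_nat_ge (2 * (c + 2) / δ)
  obtain ⟨k₂, hk₂⟩ := eventually_atTop.1 ((eventually_mul_pow_le_two_pow E 9).and
    (eventually_mul_pow_le_two_pow 12 2))
  refine ⟨max (max k₁ k₂) (max C 1), fun k hk n h1 h2 => ?_⟩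
  simp only [ge_iff_le, max_le_iff] at hk
  obtain ⟨⟨hk1, hk2⟩, hkC, hk0⟩ := hk
  obtain ⟨hE9, h12⟩ := hk₂ k hk2
  have hn : n ≤ 2 ^ (k + 1) := by
    have : (n : ℝ) ≤ 2 ^ (k + 1) := by
      have hk0' : (1 : ℝ) ≤ k := by exact_mod_cast hk0
      have hn0 : (0 : ℝ) ≤ n := n.cast_nonneg
      nlinarith [mul_nonneg hn0 (sub_nonneg.2 hk0'), mul_nonneg hδ.le (mul_nonneg hn0 (k.cast_nonneg (α := ℝ)))]
    exact_mod_cast this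
  have hkn : 4 * k + 7 ≤ n := by
    by_contra hlt
    push Not at hlt
    have : n * k < 12 * k ^ 2 := by nlinarith
    omega
  refine randomSubsetLaw_real_lt_cliqueNum_le (c := c) (p := e * k ^ 8) hk0 hn hkn ?_
    (hdich k hk1 n _ (by simp) h1 h2)
  have hreal : (n : ℝ) * (k + c + 1) + (k + 1) * (e * k ^ 8) + n + e * k ^ 8 ≤ 2 ^ (k + 1) := by
    refine le_trans ?_ h1
    have hk0' : (1 : ℝ) ≤ k := by exact_mod_cast hk0
    have hn0 : (0 : ℝ) ≤ n := n.cast_nonneg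
    have a1 : 2 * (c + 2) ≤ δ * k := by
      have : 2 * (c + 2) / δ ≤ (k : ℝ) := hC.trans (by exact_mod_cast hkC)
      rw [div_le_iff₀ hδ] at this
      linarith
    have a2 : 6 * e ≤ δ * E := by
      rw [div_le_iff₀ hδ] at hE
      linarith
    have a3 : (E : ℝ) * k ^ 9 ≤ n * k := by exact_mod_cast hE9.trans h2
    have a4 : 6 * (e : ℝ) * k ^ 9 ≤ δ * (n * k) := by
      calc 6 * (e : ℝ) * k ^ 9 ≤ δ * E * k ^ 9 := by gcongr
        _ = δ * (E * k ^ 9) := by ring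
        _ ≤ _ := by gcongr
    have a5 : ((k : ℝ) + 2) * (e * k ^ 8) ≤ 3 * k * (e * k ^ 8) := by
      gcongr; linarith
    have a6 : (n : ℝ) * (2 * (c + 2)) ≤ n * (δ * k) := by gcongr
    nlinarith
  exact_mod_cast hreal

/-! ### The lower bound: a second moment over subspaces. -/

/-- Chebyshev's inequality for the variables 2^s · 1[S_i ⊆ A]. They have mean 1 and mixed moments
2^|S_i ∩ S_j|, and on the event their centred sum equals -|I|. -/
theorem randomSubsetLaw_real_forall_not_subset_le {n : ℕ} {ι : Type*} (I : Finset ι)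
    (S : ι → Finset (Fin n → ZMod 2)) {s : ℕ} (hS : ∀ i ∈ I, (S i).card = s) :
    (randomSubsetLaw n).real {A | ∀ i ∈ I, ¬ ((S i : Set (Fin n → ZMod 2)) ⊆ A)} * I.card ^ 2 ≤
      ∑ i ∈ I, ∑ j ∈ I, ((2 : ℝ) ^ (S i ∩ S j).card - 1) := by
  classical
  set w : ℝ := (1 / 2) ^ 2 ^ n with hw
  have hw0 : 0 ≤ w := by positivity
  have hreal : ∀ E : Set (Set (Fin n → ZMod 2)),
      ∑ A : Set (Fin n → ZMod 2), w * (if A ∈ E then (1 : ℝ) else 0) =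
        (randomSubsetLaw n).real E := by
    intro E
    rw [randomSubsetLaw_real_apply, ← Finset.mul_sum, Finset.sum_boole, mul_comm,
      Set.ncard_eq_toFinset_card']
    congr 3
    ext A
    simp
  have hsup : ∀ T : Finset (Fin n → ZMod 2),
      ∑ A : Set (Fin n → ZMod 2), w * (if (T : Set (Fin n → ZMod 2)) ⊆ A then (1 : ℝ) else 0) =
        (1 / 2) ^ T.card := by
    intro T
    rw [← randomSubsetLaw_real_superset T, ← hreal]
    rfl
  set x : ι → Set (Fin n → ZMod 2) → ℝ := fun i A =>
    2 ^ s * (if (S i : Set (Fin n → ZMod 2)) ⊆ A then (1 : ℝ) else 0) with hx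
  have hpp : (2 : ℝ) ^ s * (1 / 2) ^ s = 1 := by rw [← mul_pow]; norm_num
  have hE1 : ∀ i ∈ I, ∑ A, w * x i A = 1 := by
    intro i hi
    have := hsup (S i)
    rw [hS i hi] at this
    rw [← hpp, ← this, Finset.mul_sum]
    exact Finset.sum_congr rfl fun A _ => by simp only [hx]; ring
  have hE0 : ∑ _A : Set (Fin n → ZMod 2), w = 1 := by
    have := hsup ∅
    simpa using this
  have hE2 : ∀ i ∈ I, ∀ j ∈ I, ∑ A, w * (x i A * x j A) = 2 ^ (S i ∩ S j).card := by
    intro i hi j hj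
    have h1 := hsup (S i ∪ S j)
    have h2 : (S i ∪ S j).card + (S i ∩ S j).card = s + s := by
      rw [Finset.card_union_add_card_inter, hS i hi, hS j hj]
    have h3 : (2 : ℝ) ^ (S i ∩ S j).card = 2 ^ s * 2 ^ s * (1 / 2) ^ (S i ∪ S j).card := by
      rw [← pow_add, ← h2, pow_add, mul_right_comm, ← mul_pow]
      norm_num
    rw [h3, ← h1, Finset.mul_sum]
    refine Finset.sum_congr rfl fun A _ => ?_
    simp only [hx, Finset.coe_union, Set.union_subset_iff]
    by_cases hi' : (S i : Set (Fin n → ZMod 2)) ⊆ A <;>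
      by_cases hj' : (S j : Set (Fin n → ZMod 2)) ⊆ A <;>
        simp only [hi', hj', and_true, and_false, and_self, if_true, if_false] <;> ring_nf
  calc _ = ∑ A : Set (Fin n → ZMod 2), w * ((if A ∈ {A : Set (Fin n → ZMod 2) |
        ∀ i ∈ I, ¬ ((S i : Set (Fin n → ZMod 2)) ⊆ A)} then (1 : ℝ) else 0) * I.card ^ 2) := by
        rw [← hreal, Finset.sum_mul]
        exact Finset.sum_congr rfl fun A _ => by ring
    _ ≤ ∑ A, w * (∑ i ∈ I, (x i A - 1)) ^ 2 := by
        refine Finset.sum_le_sum fun A _ => mul_le_mul_of_nonneg_left ?_ hw0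
        split_ifs with h
        · have h0 : ∀ i ∈ I, x i A - 1 = -1 := fun i hi => by simp [hx, h i hi]
          rw [Finset.sum_congr rfl h0]
          simp
        · rw [zero_mul]; positivity
    _ = ∑ i ∈ I, ∑ j ∈ I, ∑ A, (w * (x i A * x j A) - w * x i A - w * x j A + w) := by
        simp_rw [sq, Finset.sum_mul_sum, Finset.mul_sum]
        rw [Finset.sum_comm]
        refine Finset.sum_congr rfl fun i _ => ?_
        rw [Finset.sum_comm]
        refine Finset.sum_congr rfl fun j _ => Finset.sum_congr rfl fun A _ => ?_
        ring
    _ = _ := by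
        refine Finset.sum_congr rfl fun i hi => Finset.sum_congr rfl fun j hj => ?_
        rw [Finset.sum_add_distrib, Finset.sum_sub_distrib, Finset.sum_sub_distrib,
          hE2 i hi j hj, hE1 i hi, hE1 j hj, hE0]
        ring

/-- Evaluation at the independent vectors h, modulo W, is a surjection onto (V/W)^r. The maps
counted form its kernel. -/
theorem natCard_linearMap_forall_mem {K U V : Type*} [Field K] [AddCommGroup U] [Module K U]
    [AddCommGroup V] [Module K V] [Finite K] [Module.Finite K U] [Module.Finite K V] {r : ℕ}
    {h : Fin r → U} (hh : LinearIndependent K h) (W : Submodule K V) :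
    Nat.card {M : U →ₗ[K] V // ∀ i, M (h i) ∈ W} * (Nat.card K) ^ (r * Module.finrank K (V ⧸ W)) =
      Nat.card K ^ (Module.finrank K U * Module.finrank K V) := by
  let Φ : (U →ₗ[K] V) →ₗ[K] (Fin r → V ⧸ W) :=
    { toFun := fun M i => W.mkQ (M (h i))
      map_add' := fun M N => by ext i; simp
      map_smul' := fun c M => by ext i; simp }
  have hsurj : Function.Surjective Φ := by
    intro y
    choose v hv using fun i => W.mkQ_surjective (y i)
    obtain ⟨L, hL⟩ := (Fintype.linearCombination K h).exists_leftInverse_of_injective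
      (LinearMap.ker_eq_bot.2 hh.fintypeLinearCombination_injective)
    refine ⟨(Fintype.linearCombination K v).comp L, funext fun i => ?_⟩
    have h1 : L (h i) = Pi.single i 1 := by
      have := LinearMap.congr_fun hL (Pi.single i 1)
      simpa using this
    change W.mkQ (Fintype.linearCombination K v (L (h i))) = y i
    rw [h1, ← hv]
    simp
  have hker : Nat.card {M : U →ₗ[K] V // ∀ i, M (h i) ∈ W} = Nat.card (LinearMap.ker Φ) := by
    refine Nat.card_congr (Equiv.subtypeEquivRight fun M => ?_)
    rw [LinearMap.mem_ker, funext_iff]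
    exact forall_congr' fun i => (Submodule.Quotient.mk_eq_zero W).symm
  have hrank := Φ.finrank_range_add_finrank_ker
  rw [LinearMap.range_eq_top.2 hsurj, finrank_top, Module.finrank_linearMap,
    Module.finrank_pi_fintype, Finset.sum_const, Finset.card_univ, Fintype.card_fin,
    smul_eq_mul] at hrank
  have : Finite V := Module.finite_of_finite K
  have : Finite U := Module.finite_of_finite K
  rw [hker, Module.natCard_eq_pow_finrank (K := K) (V := LinearMap.ker Φ), ← pow_add, ← hrank,
    add_comm]

section LinearMaps
variable {U V : Type*} [AddCommGroup U] [Module (ZMod 2) U] [AddCommGroup V] [Module (ZMod 2) V]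

-- A union bound over the at most 2^(kr) tuples h.
open Classical in
theorem card_filter_exists_linearIndependent_mul_le [Fintype U] [Finite V]
    [Fintype (U →ₗ[ZMod 2] V)] {k n : ℕ}
    (hU : Module.finrank (ZMod 2) U = k) (hV : Module.finrank (ZMod 2) V = n)
    (W : Submodule (ZMod 2) V) (r : ℕ) :
    Finset.card {M : U →ₗ[ZMod 2] V | ∃ h : Fin r → U, LinearIndependent (ZMod 2) h ∧
      ∀ i, M (h i) ∈ W} * 2 ^ (r * Module.finrank (ZMod 2) (V ⧸ W)) ≤ 2 ^ (k * r) * 2 ^ (k * n) := by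
  have hsub : ({M : U →ₗ[ZMod 2] V | ∃ h : Fin r → U, LinearIndependent (ZMod 2) h ∧
      ∀ i, M (h i) ∈ W} : Finset (U →ₗ[ZMod 2] V)) ⊆
      ({h : Fin r → U | LinearIndependent (ZMod 2) h} : Finset (Fin r → U)).biUnion fun h =>
        {M : U →ₗ[ZMod 2] V | ∀ i, M (h i) ∈ W} := by
    intro M hM
    simpa using hM
  refine (Nat.mul_le_mul_right _ ((Finset.card_le_card hsub).trans Finset.card_biUnion_le)).trans ?_
  rw [Finset.sum_mul]
  have hterm : ∀ h ∈ ({h : Fin r → U | LinearIndependent (ZMod 2) h} : Finset (Fin r → U)),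
      Finset.card {M : U →ₗ[ZMod 2] V | ∀ i, M (h i) ∈ W} *
        2 ^ (r * Module.finrank (ZMod 2) (V ⧸ W)) ≤ 2 ^ (k * n) := by
    intro h hh
    have := natCard_linearMap_forall_mem (Finset.mem_filter.1 hh).2 W
    rw [Nat.card_zmod, hU, hV] at this
    rw [← this]
    refine Nat.mul_le_mul_right _ (le_of_eq ?_)
    exact (Nat.subtype_card _ (fun x => by simp)).symm
  refine (Finset.sum_le_card_nsmul _ _ _ hterm).trans ?_
  rw [smul_eq_mul]
  refine Nat.mul_le_mul_right _ ((Finset.card_filter_le _ _).trans ?_)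
  rw [Finset.card_univ, card_fun_fin hU]

theorem exists_linearIndependent_fin_of_finrank_eq [Finite U] {S : Submodule (ZMod 2) U} {r : ℕ}
    (h : Module.finrank (ZMod 2) S = r) :
    ∃ g : Fin r → U, LinearIndependent (ZMod 2) g ∧ ∀ i, g i ∈ S := by
  have b := Module.finBasisOfFinrankEq (ZMod 2) S h
  exact ⟨fun i => b i, b.linearIndependent.map' S.subtype S.ker_subtype, fun i => (b i).2⟩

-- The preceding count for r = 1 and W = ⊥: a noninjective map kills a nonzero vector.
open Classical in
theorem two_mul_card_filter_not_injective_le [Fintype U] [Finite V]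
    [Fintype (U →ₗ[ZMod 2] V)] {k n : ℕ}
    (hU : Module.finrank (ZMod 2) U = k) (hV : Module.finrank (ZMod 2) V = n) (hkn : k < n) :
    2 * Finset.card {M : U →ₗ[ZMod 2] V | ¬ Function.Injective M} ≤ 2 ^ (k * n) := by
  have h1 := card_filter_exists_linearIndependent_mul_le hU hV ⊥ 1
  have h2 : Module.finrank (ZMod 2) (V ⧸ (⊥ : Submodule (ZMod 2) V)) = n := by
    rw [← hV]
    exact (Submodule.quotEquivOfEqBot ⊥ rfl).finrank_eq
  rw [h2] at h1
  have hsub : ({M : U →ₗ[ZMod 2] V | ¬ Function.Injective M} : Finset (U →ₗ[ZMod 2] V)) ⊆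
      ({M : U →ₗ[ZMod 2] V | ∃ h : Fin 1 → U, LinearIndependent (ZMod 2) h ∧
        ∀ i, M (h i) ∈ (⊥ : Submodule (ZMod 2) V)} : Finset (U →ₗ[ZMod 2] V)) := by
    intro M hM
    have hM := (Finset.mem_filter.1 hM).2
    rw [← LinearMap.ker_eq_bot, Submodule.eq_bot_iff] at hM
    push Not at hM
    obtain ⟨u, hu, hu0⟩ := hM
    refine Finset.mem_filter.2 ⟨Finset.mem_univ _, fun _ => u, ?_, fun _ => by simpa using hu⟩
    exact linearIndependent_unique_iff.2 hu0
  have h3 := (Nat.mul_le_mul_right _ (Finset.card_le_card hsub)).trans h1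
  rw [mul_one, one_mul] at h3
  have h4 : 2 * 2 ^ k ≤ 2 ^ n := by
    rw [← pow_succ']
    exact Nat.pow_le_pow_right (by norm_num) hkn
  refine le_of_mul_le_mul_left (a := 2 ^ k) ?_ (Nat.two_pow_pos k)
  refine le_trans ?_ h3
  calc _ = Finset.card {M : U →ₗ[ZMod 2] V | ¬ Function.Injective M} * (2 * 2 ^ k) := by ring
    _ ≤ _ := by gcongr

/-- The nonzero vectors in the range of a linear map. -/
def nonzeroRange [Fintype U] [DecidableEq V] (M : U →ₗ[ZMod 2] V) : Finset V :=
  (Finset.univ.image M).erase 0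

theorem mem_nonzeroRange [Fintype U] [DecidableEq V] {M : U →ₗ[ZMod 2] V} {v : V} :
    v ∈ nonzeroRange M ↔ v ≠ 0 ∧ v ∈ LinearMap.range M := by
  simp [nonzeroRange]

theorem card_nonzeroRange_inter_add_one [Fintype U] [DecidableEq V] {M M' : U →ₗ[ZMod 2] V}
    (hM' : Function.Injective M') :
    (nonzeroRange M ∩ nonzeroRange M').card + 1 =
      2 ^ Module.finrank (ZMod 2) ((LinearMap.range M).comap M') := by
  classical
  have h1 : nonzeroRange M ∩ nonzeroRange M' =
      (({u : U | M' u ∈ LinearMap.range M} : Finset U).image M').erase 0 := by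
    ext v
    simp only [Finset.mem_inter, mem_nonzeroRange, Finset.mem_erase, Finset.mem_image,
      Finset.mem_filter, Finset.mem_univ, true_and]
    constructor
    · rintro ⟨⟨h0, h⟩, -, u, rfl⟩
      exact ⟨h0, u, h, rfl⟩
    · rintro ⟨h0, u, h, rfl⟩
      exact ⟨⟨h0, h⟩, h0, u, rfl⟩
  have h0 : (0 : V) ∈ ({u : U | M' u ∈ LinearMap.range M} : Finset U).image M' :=
    Finset.mem_image.2 ⟨0, Finset.mem_filter.2 ⟨Finset.mem_univ _, by rw [map_zero]; exact zero_mem _⟩, map_zero _⟩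
  rw [h1, Finset.card_erase_add_one h0, Finset.card_image_of_injective _ hM']
  have h2 := Module.natCard_eq_pow_finrank (K := ZMod 2) (V := (LinearMap.range M).comap M')
  rw [Nat.card_zmod] at h2
  rw [← h2]
  exact (Nat.subtype_card _ (fun x => by simp)).symm

theorem card_nonzeroRange_add_one [Fintype U] [DecidableEq V] {M : U →ₗ[ZMod 2] V} {k : ℕ}
    (hU : Module.finrank (ZMod 2) U = k) (hM : Function.Injective M) :
    (nonzeroRange M).card + 1 = 2 ^ k := by
  have := card_nonzeroRange_inter_add_one (M := M) hM
  rwa [Finset.inter_self, show (LinearMap.range M).comap M = ⊤ by ext; simp, finrank_top, hU]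
    at this

/-- Monotonicity of 2^r / r, which reduces every intersection dimension r to the hypothesis on k. -/
theorem mul_two_pow_le_mul_two_pow {r k : ℕ} (hr : 1 ≤ r) (hrk : r ≤ k) :
    k * 2 ^ r ≤ r * 2 ^ k := by
  induction k, hrk using Nat.le_induction with
  | base => rfl
  | succ k hk ih =>
    calc (k + 1) * 2 ^ r ≤ 2 * (k * 2 ^ r) := by
          rw [← mul_assoc]; gcongr; omega
      _ ≤ 2 * (r * 2 ^ k) := by gcongr
      _ = _ := by ring

-- Maps M' whose range meets that of M trivially contribute 0. Those meeting it in dimension r ≥ 1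
-- form a proportion at most 2^(kr - r(n-k)) and contribute at most 2^(2^r) each, so the exponent to
-- control is 2^r + 2kr - rn.
open Classical in
theorem sum_two_pow_card_inter_sub_one_le [Fintype U] [Finite V] [DecidableEq V]
    [Fintype (U →ₗ[ZMod 2] V)] {k n : ℕ}
    (hU : Module.finrank (ZMod 2) U = k) (hV : Module.finrank (ZMod 2) V = n)
    (hkn : 2 ^ k + 4 * k ^ 2 ≤ n * k) {M : U →ₗ[ZMod 2] V} (hM : Function.Injective M) :
    ∑ M' ∈ ({M' | Function.Injective M'} : Finset (U →ₗ[ZMod 2] V)),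
      ((2 : ℝ) ^ (nonzeroRange M ∩ nonzeroRange M').card - 1) ≤
        k * (2 ^ (k * n) * (1 / 2) ^ (2 * k)) := by
  set W := LinearMap.range M with hWdef
  have hW : Module.finrank (ZMod 2) (V ⧸ W) + k = n := by
    have := Submodule.finrank_quotient_add_finrank W
    rwa [LinearMap.finrank_range_of_inj hM, hU, hV] at this
  set P : ℕ → (U →ₗ[ZMod 2] V) → Prop := fun r M' =>
    ∃ h : Fin r → U, LinearIndependent (ZMod 2) h ∧ ∀ i, M' (h i) ∈ W with hP
  calc _ ≤ ∑ M' ∈ ({M' | Function.Injective M'} : Finset (U →ₗ[ZMod 2] V)), ∑ r ∈ Finset.Icc 1 k,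
        (if P r M' then (2 : ℝ) ^ 2 ^ r else 0) := by
        refine Finset.sum_le_sum fun M' hM' => ?_
        have hc := card_nonzeroRange_inter_add_one (M := M) (Finset.mem_filter.1 hM').2
        rw [← hWdef] at hc
        set r := Module.finrank (ZMod 2) (W.comap M') with hr
        rcases Nat.eq_zero_or_pos r with h0 | h0
        · rw [h0] at hc
          have : (nonzeroRange M ∩ nonzeroRange M').card = 0 := by simpa using hc
          rw [this, pow_zero, sub_self]
          exact Finset.sum_nonneg fun r _ => by split_ifs <;> positivity
        · have hrk : r ≤ k := by rw [← hU]; exact Submodule.finrank_le _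
          have hPr : P r M' := exists_linearIndependent_fin_of_finrank_eq hr.symm
          calc _ ≤ (2 : ℝ) ^ (nonzeroRange M ∩ nonzeroRange M').card := by linarith
            _ ≤ 2 ^ 2 ^ r := pow_le_pow_right₀ (by norm_num) (by omega)
            _ = (if P r M' then (2 : ℝ) ^ 2 ^ r else 0) := by rw [if_pos hPr]
            _ ≤ _ := Finset.single_le_sum (f := fun r => if P r M' then (2 : ℝ) ^ 2 ^ r else 0)
                (fun r _ => by split_ifs <;> positivity) (Finset.mem_Icc.2 ⟨h0, hrk⟩)
    _ ≤ ∑ M' : U →ₗ[ZMod 2] V, ∑ r ∈ Finset.Icc 1 k,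
        (if P r M' then (2 : ℝ) ^ 2 ^ r else 0) := by
        refine Finset.sum_le_sum_of_subset_of_nonneg (Finset.filter_subset _ _) fun M' _ _ => ?_
        exact Finset.sum_nonneg fun r _ => by split_ifs <;> positivity
    _ = ∑ r ∈ Finset.Icc 1 k, ∑ M' : U →ₗ[ZMod 2] V,
        (if P r M' then (2 : ℝ) ^ 2 ^ r else 0) := Finset.sum_comm
    _ ≤ ∑ r ∈ Finset.Icc 1 k, 2 ^ (k * n) * (1 / 2) ^ (2 * k) := by
        refine Finset.sum_le_sum fun r hr => ?_
        obtain ⟨hr1, hrk⟩ := Finset.mem_Icc.1 hr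
        rw [← Finset.sum_filter, Finset.sum_const, nsmul_eq_mul]
        have h1 := card_filter_exists_linearIndependent_mul_le hU hV W r
        set c := Finset.card {M' : U →ₗ[ZMod 2] V | P r M'} with hc
        set m := Module.finrank (ZMod 2) (V ⧸ W) with hm
        -- After multiplying by k, 2^r is replaced using k 2^r ≤ r 2^k. The 4k² of the hypothesis
        -- splits into 2k² for the term 2kr and 2k² for the gain 2k.
        have h2 : 2 * k * r + 2 ^ r + 2 * k ≤ r * n := by
          refine le_of_mul_le_mul_left (a := k) ?_ (hr1.trans hrk)
          have h3 := mul_two_pow_le_mul_two_pow hr1 hrk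
          have h4 : 2 * k ^ 2 ≤ r * (2 * k ^ 2) := Nat.le_mul_of_pos_left _ hr1
          have h5 : r * (2 ^ k + 4 * k ^ 2) ≤ r * (n * k) := by gcongr
          nlinarith
        have h3 : k * r + k * n + 2 ^ r + 2 * k ≤ k * n + r * m := by
          have : r * n = r * m + r * k := by rw [← hW]; ring
          nlinarith
        have h4 : c * 2 ^ 2 ^ r * 2 ^ (2 * k) ≤ 2 ^ (k * n) := by
          refine le_of_mul_le_mul_right (a := 2 ^ (r * m)) ?_ (by positivity)
          calc c * 2 ^ 2 ^ r * 2 ^ (2 * k) * 2 ^ (r * m)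
              = (c * 2 ^ (r * m)) * (2 ^ 2 ^ r * 2 ^ (2 * k)) := by ring
            _ ≤ (2 ^ (k * r) * 2 ^ (k * n)) * (2 ^ 2 ^ r * 2 ^ (2 * k)) :=
                Nat.mul_le_mul_right _ h1
            _ = 2 ^ (k * r + k * n + 2 ^ r + 2 * k) := by
                rw [← pow_add, ← pow_add, ← pow_add, add_assoc, add_assoc, add_assoc]
            _ ≤ 2 ^ (k * n + r * m) := Nat.pow_le_pow_right (by norm_num) h3
            _ = _ := pow_add _ _ _
        have h5 : (c : ℝ) * 2 ^ 2 ^ r * 2 ^ (2 * k) ≤ 2 ^ (k * n) := by exact_mod_cast h4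
        rw [one_div_pow, mul_one_div, le_div_iff₀ (by positivity)]
        exact h5
    _ = _ := by simp

end LinearMaps

theorem two_pow_le_cliqueNum {U V : Type*} [AddCommGroup U] [Module (ZMod 2) U] [Fintype U]
    [AddCommGroup V] [Module (ZMod 2) V] [Finite V] [DecidableEq V] {k : ℕ} {A : Set V}
    (hU : Module.finrank (ZMod 2) U = k) {M : U →ₗ[ZMod 2] V} (hM : Function.Injective M)
    (hMA : (nonzeroRange M : Set V) ⊆ A) : 2 ^ k ≤ (cayleySumGraph A).cliqueNum := by
  have hc : (cayleySumGraph A).IsNClique (2 ^ k) (Finset.univ.image M) := by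
    constructor
    · intro x hx y hy hxy
      simp only [Finset.coe_image, Finset.coe_univ, Set.image_univ, Set.mem_range] at hx hy
      obtain ⟨a, rfl⟩ := hx
      obtain ⟨b, rfl⟩ := hy
      refine ⟨hxy, hMA ?_⟩
      rw [Finset.mem_coe, mem_nonzeroRange]
      refine ⟨fun h => hxy ?_, a + b, map_add M a b⟩
      rw [← sub_eq_zero, ZModModule.sub_eq_add, h]
    · rw [Finset.card_image_of_injective _ hM, Finset.card_univ,
        Module.card_eq_pow_finrank (K := ZMod 2), ZMod.card, hU]
  exact hc.card_eq ▸ hc.isClique.card_le_cliqueNum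

/-- At least half of all linear maps are injective, so dividing the variance by the squared mean
gives at most 2k · 4^(-k). -/
theorem randomSubsetLaw_real_cliqueNum_lt_le {n k : ℕ} (hk : 1 ≤ k)
    (hkn : 2 ^ k + 4 * k ^ 2 ≤ n * k) :
    (randomSubsetLaw n).real {A | (cayleySumGraph A).cliqueNum < 2 ^ k} ≤ 2 * (1 / 2) ^ k := by
  classical
  let U := Fin k → ZMod 2
  let V := Fin n → ZMod 2
  have hU : Module.finrank (ZMod 2) U = k := by simp [U]
  have hV : Module.finrank (ZMod 2) V = n := by simp [V]
  have : Finite (U →ₗ[ZMod 2] V) := DFunLike.finite _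
  let : Fintype (U →ₗ[ZMod 2] V) := Fintype.ofFinite _
  set I : Finset (U →ₗ[ZMod 2] V) := {M | Function.Injective M} with hI
  have hlt : k < n := by
    by_contra h
    push Not at h
    have := Nat.pow_pos (n := k) (show 0 < 2 by norm_num)
    nlinarith
  have hcard : (2 : ℝ) ^ (k * n) ≤ 2 * I.card := by
    have h1 : 2 * Finset.card {M : U →ₗ[ZMod 2] V | ¬ Function.Injective M} ≤ 2 ^ (k * n) := by
      convert two_mul_card_filter_not_injective_le hU hV hlt
    have h2 := Finset.card_filter_add_card_filter_not (s := Finset.univ)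
      (fun M : U →ₗ[ZMod 2] V => Function.Injective M)
    have h3 : Fintype.card (U →ₗ[ZMod 2] V) = 2 ^ (k * n) := by
      rw [Module.card_eq_pow_finrank (K := ZMod 2), ZMod.card, Module.finrank_linearMap, hU, hV]
    rw [Finset.card_univ, h3, ← hI] at h2
    have : 2 ^ (k * n) ≤ 2 * I.card := by omega
    exact_mod_cast this
  have hsm := randomSubsetLaw_real_forall_not_subset_le (n := n) I nonzeroRange (s := 2 ^ k - 1)
    (fun M hM => by
      have := card_nonzeroRange_add_one hU (Finset.mem_filter.1 hM).2
      omega)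
  set p := (randomSubsetLaw n).real
    {A | ∀ M ∈ I, ¬ ((nonzeroRange M : Set (Fin n → ZMod 2)) ⊆ A)} with hp
  have hle : (randomSubsetLaw n).real {A | (cayleySumGraph A).cliqueNum < 2 ^ k} ≤ p := by
    refine measureReal_mono (fun A hA M hM hMA => ?_) (measure_ne_top _ _)
    exact absurd (two_pow_le_cliqueNum hU (Finset.mem_filter.1 hM).2 hMA) (not_le.2 hA)
  refine hle.trans ?_
  have hsum : p * I.card ^ 2 ≤ I.card * (k * (2 ^ (k * n) * (1 / 2) ^ (2 * k))) := by
    refine hsm.trans ?_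
    rw [← nsmul_eq_mul]
    exact Finset.sum_le_card_nsmul _ _ _ fun M hM =>
      sum_two_pow_card_inter_sub_one_le hU hV hkn (Finset.mem_filter.1 hM).2
  have hpos : (0 : ℝ) < I.card := by
    have : (0 : ℝ) < 2 ^ (k * n) := by positivity
    linarith
  have h1 : p * I.card ≤ 2 * I.card * (k * (1 / 2) ^ (2 * k)) := by
    have : p * I.card ≤ k * (2 ^ (k * n) * (1 / 2) ^ (2 * k)) := by
      refine le_of_mul_le_mul_left ?_ hpos
      linarith
    refine this.trans ?_
    calc _ = (2 : ℝ) ^ (k * n) * (k * (1 / 2) ^ (2 * k)) := by ring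
      _ ≤ _ := by gcongr
  have h2 : p ≤ 2 * (k * (1 / 2) ^ (2 * k)) := by
    refine le_of_mul_le_mul_right ?_ hpos
    linarith
  have h3 : (k : ℝ) * (1 / 2) ^ k ≤ 1 := by
    rw [one_div_pow, mul_one_div, div_le_one (by positivity)]
    exact_mod_cast (Nat.lt_two_pow_self (n := k)).le
  calc p ≤ 2 * (k * (1 / 2) ^ (2 * k)) := h2
    _ = 2 * ((k * (1 / 2) ^ k) * (1 / 2) ^ k) := by ring
    _ ≤ 2 * (1 * (1 / 2) ^ k) := by gcongr
    _ = _ := by ring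

/-! ### The level log n + log log n, and concentration at a single good n. -/

/-- The real number whose floor is the typical logarithm of the clique number. -/
noncomputable def logLevel (n : ℕ) : ℝ := Real.logb 2 n + Real.logb 2 (Real.logb 2 n)

theorem one_le_logb_two {n : ℕ} (hn : 2 ≤ n) : 1 ≤ Real.logb 2 n := by
  rw [Real.le_logb_iff_rpow_le (by norm_num) (by positivity), Real.rpow_one]
  exact_mod_cast hn

theorem logLevel_nonneg {n : ℕ} (hn : 2 ≤ n) : 0 ≤ logLevel n := by
  have h1 := one_le_logb_two hn
  have h2 := Real.logb_nonneg (b := 2) (by norm_num) h1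
  unfold logLevel
  linarith

theorem two_rpow_logLevel {n : ℕ} (hn : 2 ≤ n) : (2 : ℝ) ^ logLevel n = n * Real.logb 2 n := by
  have h1 := one_le_logb_two hn
  unfold logLevel
  rw [Real.rpow_add (by norm_num), Real.rpow_logb (by norm_num) (by norm_num) (by positivity),
    Real.rpow_logb (by norm_num) (by norm_num) (by linarith)]

theorem two_pow_floor_logLevel_le {n : ℕ} (hn : 2 ≤ n) :
    (2 : ℝ) ^ ⌊logLevel n⌋₊ ≤ n * Real.logb 2 n := by
  rw [← two_rpow_logLevel hn, ← Real.rpow_natCast]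
  exact Real.rpow_le_rpow_of_exponent_le (by norm_num) (Nat.floor_le (logLevel_nonneg hn))

theorem lt_two_pow_floor_logLevel_add_one {n : ℕ} (hn : 2 ≤ n) :
    n * Real.logb 2 n < (2 : ℝ) ^ (⌊logLevel n⌋₊ + 1) := by
  rw [← two_rpow_logLevel hn, ← Real.rpow_natCast]
  refine Real.rpow_lt_rpow_of_exponent_lt (by norm_num) ?_
  push_cast
  exact Nat.lt_floor_add_one _

theorem tendsto_logb_two_natCast : Tendsto (fun n : ℕ => Real.logb 2 (n : ℝ)) atTop atTop :=
  (Real.tendsto_logb_atTop (by norm_num)).comp tendsto_natCast_atTop_atTop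

theorem tendsto_floor_logLevel : Tendsto (fun n : ℕ => ⌊logLevel n⌋₊) atTop atTop := by
  refine tendsto_nat_floor_atTop.comp ?_
  exact tendsto_logb_two_natCast.atTop_add_atTop
    ((Real.tendsto_logb_atTop (by norm_num)).comp tendsto_logb_two_natCast)

theorem eventually_logb_logb_le {ε : ℝ} (hε : 0 < ε) :
    ∀ᶠ n : ℕ in atTop, Real.logb 2 (Real.logb 2 n) ≤ ε * Real.logb 2 n := by
  have hl2 : 0 < Real.log 2 := Real.log_pos (by norm_num)
  have h := Real.isLittleO_log_id_atTop.bound (mul_pos hε hl2)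
  filter_upwards [tendsto_logb_two_natCast.eventually h,
    tendsto_logb_two_natCast.eventually_ge_atTop 0] with n hn hn0
  rw [Real.norm_eq_abs, Real.norm_eq_abs, id, abs_of_nonneg hn0] at hn
  rw [Real.logb, div_le_iff₀ hl2]
  linarith [le_abs_self (Real.log (Real.logb 2 n))]

theorem eventually_sq_logb_le {ε : ℝ} (hε : 0 < ε) :
    ∀ᶠ n : ℕ in atTop, Real.logb 2 n ^ 2 ≤ ε * n := by
  have hl2 : 0 < Real.log 2 := Real.log_pos (by norm_num)
  have h := (Real.isLittleO_pow_log_id_atTop (n := 2)).bound (show 0 < ε * Real.log 2 ^ 2 by positivity)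
  filter_upwards [tendsto_natCast_atTop_atTop.eventually h] with n hn
  rw [Real.norm_eq_abs, Real.norm_eq_abs, id, abs_of_nonneg (by positivity),
    abs_of_nonneg (by positivity)] at hn
  rw [Real.logb, div_pow, div_le_iff₀ (by positivity)]
  linarith

theorem one_sub_le_probCliqueNumEq {n m : ℕ} {a b : ℝ}
    (h1 : (randomSubsetLaw n).real {A | (cayleySumGraph A).cliqueNum < m} ≤ a)
    (h2 : (randomSubsetLaw n).real {A | m < (cayleySumGraph A).cliqueNum} ≤ b) :
    1 - (a + b) ≤ probCliqueNumEq n m := by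
  have hu : (Set.univ : Set (Set (Fin n → ZMod 2))) =
      {A | (cayleySumGraph A).cliqueNum = m} ∪ ({A | (cayleySumGraph A).cliqueNum < m} ∪
        {A | m < (cayleySumGraph A).cliqueNum}) := by
    ext A
    simp only [Set.mem_univ, Set.mem_union, Set.mem_ofPred_eq, true_iff]
    omega
  have h3 : (1 : ℝ) = (randomSubsetLaw n).real Set.univ := by simp
  have h4 := measureReal_union_le (μ := randomSubsetLaw n)
    {A | (cayleySumGraph A).cliqueNum = m} ({A | (cayleySumGraph A).cliqueNum < m} ∪
        {A | m < (cayleySumGraph A).cliqueNum})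
  have h5 := measureReal_union_le (μ := randomSubsetLaw n)
    {A | (cayleySumGraph A).cliqueNum < m} {A | m < (cayleySumGraph A).cliqueNum}
  rw [← hu, ← h3] at h4
  unfold probCliqueNumEq
  linarith

/-- For large n, log n + 1 ≤ k ≤ (1 + δ/4) log n, so nk can replace n log n in both bounds. The
margin drops from δ to δ/2. -/
theorem eventually_one_sub_le_probCliqueNumEq {δ η : ℝ} (hδ : 0 < δ) (hδ1 : δ ≤ 1) (hη : 0 < η) :
    ∀ᶠ n : ℕ in atTop, (1 + δ) * (n * Real.logb 2 n) ≤ 2 ^ (⌊logLevel n⌋₊ + 1) →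
      1 - η ≤ probCliqueNumEq n (2 ^ ⌊logLevel n⌋₊) := by
  obtain ⟨k₀, hk₀⟩ := exists_forall_real_lt_cliqueNum_le (δ := δ / 2) (by linarith) (by linarith)
  have hpow : ∀ᶠ k : ℕ in atTop, 3 * (1 / 2 : ℝ) ^ k ≤ η := by
    have := (tendsto_pow_atTop_nhds_zero_of_lt_one (r := (1 / 2 : ℝ)) (by norm_num)
      (by norm_num)).const_mul 3
    rw [mul_zero] at this
    exact this.eventually_le_const hη
  filter_upwards [eventually_ge_atTop 2, eventually_logb_logb_le (show 0 < δ / 4 by linarith),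
    eventually_sq_logb_le (show (0 : ℝ) < 1 / 16 by norm_num),
    ((Real.tendsto_logb_atTop (b := 2) (by norm_num)).comp
      tendsto_logb_two_natCast).eventually_ge_atTop 2,
    tendsto_floor_logLevel.eventually_ge_atTop (max 1 k₀),
    tendsto_floor_logLevel.eventually hpow] with n hn hll hsq hll2 hkk hη' hgood
  set k := ⌊logLevel n⌋₊ with hk
  set L := Real.logb 2 n with hL
  have hL1 : 1 ≤ L := one_le_logb_two hn
  have hkle : (k : ℝ) ≤ L + Real.logb 2 L := Nat.floor_le (logLevel_nonneg hn)
  have hkge : L + Real.logb 2 L < k + 1 := Nat.lt_floor_add_one _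
  have h2k : (2 : ℝ) ^ k ≤ n * L := two_pow_floor_logLevel_le hn
  have hll2' : 2 ≤ Real.logb 2 L := hll2
  have hn0 : (0 : ℝ) ≤ n := n.cast_nonneg
  have hk4 : (k : ℝ) ≤ (1 + δ / 4) * L := by linarith
  have hk2 : (k : ℝ) ≤ 2 * L := by nlinarith
  -- As log L ≥ 2, the floor loses at most one unit and k still exceeds L + 1. The spare n absorbs
  -- 4k² ≤ 16L².
  have hnk : (n : ℝ) * L + n ≤ n * k := by nlinarith
  have hlow : 2 ^ k + 4 * k ^ 2 ≤ n * k := by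
    have : (2 : ℝ) ^ k + 4 * k ^ 2 ≤ n * k := by nlinarith [k.cast_nonneg (α := ℝ)]
    exact_mod_cast this
  have hup1 : (1 + δ / 2) * n * k ≤ 2 ^ (k + 1) := by
    refine le_trans ?_ hgood
    have h1 : (1 + δ / 2) * (1 + δ / 4) ≤ 1 + δ := by nlinarith
    calc (1 + δ / 2) * n * k ≤ (1 + δ / 2) * n * ((1 + δ / 4) * L) := by gcongr
      _ = (1 + δ / 2) * (1 + δ / 4) * (n * L) := by ring
      _ ≤ _ := by gcongr
  have hup2 : 2 ^ k ≤ n * k := by omega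
  have hk1 := (le_max_left _ _).trans hkk
  have := one_sub_le_probCliqueNumEq (randomSubsetLaw_real_cliqueNum_lt_le hk1 hlow)
    (hk₀ k ((le_max_right _ _).trans hkk) n hup1 hup2)
  linarith

/-! ### The exceptional dimensions have density zero. -/

theorem logb_two_le_logb_two {m n : ℕ} (hm : 1 ≤ m) (h : m ≤ n) :
    Real.logb 2 m ≤ Real.logb 2 n :=
  Real.logb_le_logb_of_le (by norm_num) (by exact_mod_cast hm) (by exact_mod_cast h)

theorem logLevel_mono {m n : ℕ} (hm : 2 ≤ m) (h : m ≤ n) : logLevel m ≤ logLevel n := by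
  have h1 := logb_two_le_logb_two (by omega) h
  have h2 := one_le_logb_two hm
  exact add_le_add h1 (Real.logb_le_logb_of_le (by norm_num) (by linarith) h1)

theorem logLevel_le_add_two {m n : ℕ} (hn : 4 ≤ n) (h : n ≤ 2 * m) :
    logLevel n ≤ logLevel m + 2 := by
  have hm : 2 ≤ m := by omega
  have h1 : Real.logb 2 n ≤ Real.logb 2 m + 1 := by
    have h2 : Real.logb 2 ((2 * m : ℕ) : ℝ) = 1 + Real.logb 2 m := by
      push_cast
      rw [Real.logb_mul (by norm_num) (by positivity), Real.logb_self_eq_one (by norm_num)]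
    linarith [logb_two_le_logb_two (show 1 ≤ n by omega) h]
  have h3 := one_le_logb_two hm
  have h5 := one_le_logb_two (show 2 ≤ n by omega)
  have h4 : Real.logb 2 (Real.logb 2 n) ≤ 1 + Real.logb 2 (Real.logb 2 m) := by
    calc Real.logb 2 (Real.logb 2 n) ≤ Real.logb 2 (2 * Real.logb 2 m) :=
          Real.logb_le_logb_of_le (by norm_num) (by linarith) (by linarith)
      _ = _ := by
        rw [Real.logb_mul (by norm_num) (by positivity), Real.logb_self_eq_one (by norm_num)]
  unfold logLevel
  linarith

/-- The dimensions `n` for which `n log n` is slightly smaller than a power of two. -/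
def nearPowerSet (δ : ℝ) : Set ℕ :=
  {n | 2 ^ (⌊logLevel n⌋₊ + 1) < (1 + δ) * (n * Real.logb 2 n)}

-- Let m be the least element and b any other. Then b log b < 2^(κ+1) < (1 + δ) m log m, so b < (1 +
-- δ) m and the set lies in an interval of length at most δN.
open Classical in
theorem card_filter_nearPowerSet_floor_eq_le {δ : ℝ} (hδ : 0 ≤ δ) {a N : ℕ} (ha : 1 ≤ a) (κ : ℕ) :
    (Finset.card {n ∈ Finset.Ioc a N | n ∈ nearPowerSet δ ∧ ⌊logLevel n⌋₊ = κ} : ℝ) ≤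
      δ * N + 1 := by
  set F := {n ∈ Finset.Ioc a N | n ∈ nearPowerSet δ ∧ ⌊logLevel n⌋₊ = κ} with hF
  rcases F.eq_empty_or_nonempty with h0 | hne
  · rw [h0]; simp; positivity
  have hmin := F.min'_mem hne
  set m := F.min' hne with hm
  have hmF := Finset.mem_filter.1 hmin
  have hmI := Finset.mem_Ioc.1 hmF.1
  have hsub : F ⊆ Finset.Icc m (m + ⌊δ * N⌋₊) := by
    intro b hb
    have hmb : m ≤ b := F.min'_le b hb
    have hbF := Finset.mem_filter.1 hb
    refine Finset.mem_Icc.2 ⟨hmb, ?_⟩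
    have h1 := hmF.2.1
    have h2 := lt_two_pow_floor_logLevel_add_one (n := b) (by omega)
    unfold nearPowerSet at h1
    rw [Set.mem_ofPred_eq, hmF.2.2] at h1
    rw [hbF.2.2] at h2
    have h3 := logb_two_le_logb_two (show 1 ≤ m by omega) hmb
    have h4 := one_le_logb_two (show 2 ≤ m by omega)
    have h5 : (b : ℝ) * Real.logb 2 m < (1 + δ) * m * Real.logb 2 m := by
      have : (b : ℝ) * Real.logb 2 m ≤ b * Real.logb 2 b := by gcongr
      linarith
    have h6 : (b : ℝ) < (1 + δ) * m := lt_of_mul_lt_mul_right h5 (by linarith)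
    have h7 : ((b - m : ℕ) : ℝ) ≤ δ * N := by
      rw [Nat.cast_sub hmb]
      have : δ * m ≤ δ * N := by
        gcongr
        exact_mod_cast hmI.2
      linarith
    have := Nat.le_floor h7
    omega
  have hc := Finset.card_le_card hsub
  rw [Nat.card_Icc] at hc
  have h1 : F.card ≤ ⌊δ * N⌋₊ + 1 := by omega
  have h2 : (⌊δ * N⌋₊ : ℝ) ≤ δ * N := Nat.floor_le (by positivity)
  have h3 : (F.card : ℝ) ≤ ⌊δ * N⌋₊ + 1 := by exact_mod_cast h1
  linarith

-- Doubling n raises `logLevel` by at most 2, so its floor takes at most three values on (N/2, N].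
open Classical in
theorem card_filter_nearPowerSet_Ioc_le {δ : ℝ} (hδ : 0 ≤ δ) {N : ℕ} (hN : 4 ≤ N) :
    (Finset.card {n ∈ Finset.Ioc (N / 2) N | n ∈ nearPowerSet δ} : ℝ) ≤ 3 * (δ * N + 1) := by
  set K := ⌊logLevel N⌋₊ with hK
  have hsub : {n ∈ Finset.Ioc (N / 2) N | n ∈ nearPowerSet δ} ⊆
      (Finset.Icc (K - 2) K).biUnion fun κ =>
        {n ∈ Finset.Ioc (N / 2) N | n ∈ nearPowerSet δ ∧ ⌊logLevel n⌋₊ = κ} := by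
    intro n hn
    obtain ⟨hnI, hnB⟩ := Finset.mem_filter.1 hn
    have hnI' := Finset.mem_Ioc.1 hnI
    refine Finset.mem_biUnion.2 ⟨⌊logLevel n⌋₊, Finset.mem_Icc.2 ⟨?_, ?_⟩,
      Finset.mem_filter.2 ⟨hnI, hnB, rfl⟩⟩
    · have h1 := logLevel_le_add_two hN (show N ≤ 2 * n by omega)
      have h2 : K ≤ ⌊logLevel n + (2 : ℕ)⌋₊ := Nat.floor_le_floor (by exact_mod_cast h1)
      rw [Nat.floor_add_natCast (logLevel_nonneg (by omega))] at h2
      omega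
    · exact Nat.floor_le_floor (logLevel_mono (by omega) hnI'.2)
  have h1 : (Finset.card {n ∈ Finset.Ioc (N / 2) N | n ∈ nearPowerSet δ} : ℝ) ≤
      ∑ κ ∈ Finset.Icc (K - 2) K,
        (Finset.card {n ∈ Finset.Ioc (N / 2) N | n ∈ nearPowerSet δ ∧ ⌊logLevel n⌋₊ = κ} : ℝ) := by
    exact_mod_cast (Finset.card_le_card hsub).trans Finset.card_biUnion_le
  refine h1.trans ((Finset.sum_le_card_nsmul _ _ _ fun κ _ =>
    card_filter_nearPowerSet_floor_eq_le hδ (by omega) κ).trans ?_)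
  rw [nsmul_eq_mul, Nat.card_Icc]
  have : ((K + 1 - (K - 2) : ℕ) : ℝ) ≤ 3 := by
    have : K + 1 - (K - 2) ≤ 3 := by omega
    exact_mod_cast this
  gcongr

-- Summing over dyadic blocks gives 3δ(N + N/2 + ...) ≤ 6δN, plus 3 for each block.
open Classical in
theorem card_filter_nearPowerSet_le {δ : ℝ} (hδ : 0 ≤ δ) (N : ℕ) :
    (Finset.card {n ∈ Finset.Icc 1 N | n ∈ nearPowerSet δ} : ℝ) ≤
      6 * δ * N + 3 * Nat.log 2 N + 3 := by
  induction N using Nat.strong_induction_on with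
  | _ N ih =>
    rcases Nat.lt_or_ge N 4 with h | h
    · have h1 : Finset.card {n ∈ Finset.Icc 1 N | n ∈ nearPowerSet δ} ≤ 3 := by
        refine (Finset.card_filter_le _ _).trans ?_
        rw [Nat.card_Icc]
        omega
      have h2 : (Finset.card {n ∈ Finset.Icc 1 N | n ∈ nearPowerSet δ} : ℝ) ≤ 3 := by
        exact_mod_cast h1
      have : 0 ≤ 6 * δ * N + 3 * Nat.log 2 N := by positivity
      linarith
    · have h1 := ih (N / 2) (by omega)
      have h2 := card_filter_nearPowerSet_Ioc_le hδ h
      have hsub : {n ∈ Finset.Icc 1 N | n ∈ nearPowerSet δ} ⊆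
          {n ∈ Finset.Icc 1 (N / 2) | n ∈ nearPowerSet δ} ∪
            {n ∈ Finset.Ioc (N / 2) N | n ∈ nearPowerSet δ} := by
        intro n
        simp only [Finset.mem_filter, Finset.mem_Icc, Finset.mem_union, Finset.mem_Ioc]
        rintro ⟨h3, h4⟩
        rcases Nat.lt_or_ge (N / 2) n with h5 | h5
        · exact Or.inr ⟨⟨h5, h3.2⟩, h4⟩
        · exact Or.inl ⟨⟨h3.1, h5⟩, h4⟩
      have h3 : (Finset.card {n ∈ Finset.Icc 1 N | n ∈ nearPowerSet δ} : ℝ) ≤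
          Finset.card {n ∈ Finset.Icc 1 (N / 2) | n ∈ nearPowerSet δ} +
            Finset.card {n ∈ Finset.Ioc (N / 2) N | n ∈ nearPowerSet δ} := by
        exact_mod_cast (Finset.card_le_card hsub).trans (Finset.card_union_le _ _)
      have h4 : (Nat.log 2 N : ℝ) = Nat.log 2 (N / 2) + 1 := by
        rw [Nat.log_of_one_lt_of_le (by norm_num) (by omega)]
        push_cast
        rfl
      have h5 : ((N / 2 : ℕ) : ℝ) ≤ N / 2 := by exact_mod_cast Nat.cast_div_le (α := ℝ)
      have h6 : 6 * δ * ((N / 2 : ℕ) : ℝ) ≤ 6 * δ * (N / 2) := by gcongr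
      linarith

theorem eventually_natLog_le {ε : ℝ} (hε : 0 < ε) (C : ℝ) :
    ∀ᶠ N : ℕ in atTop, 3 * (Nat.log 2 N : ℝ) + C ≤ ε * N := by
  filter_upwards [eventually_ge_atTop 2, eventually_sq_logb_le (show 0 < ε / 6 by linarith),
    (tendsto_natCast_atTop_atTop (R := ℝ)).eventually_ge_atTop (2 * C / ε)] with N h2 hsq hC
  have h1 := Real.natLog_le_logb N 2
  have h3 := one_le_logb_two h2
  rw [div_le_iff₀ hε] at hC
  push_cast at h1
  nlinarith

/-- The set `B` of positive integers has natural density zero. -/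
def HasZeroDensity (B : Set ℕ) : Prop :=
  ∀ ε > (0 : ℝ), ∀ᶠ N : ℕ in atTop, ((B ∩ Set.Icc 1 N).ncard : ℝ) ≤ ε * N

theorem hasZeroDensity_probCliqueNumEq_lt {η : ℝ} (hη : 0 < η) :
    HasZeroDensity {n | probCliqueNumEq n (2 ^ ⌊logLevel n⌋₊) < 1 - η} := by
  classical
  intro ε hε
  -- This makes 6δN ≤ (ε/2)N; the other half of ε absorbs the logarithm and the N₀ initial values.
  set δ := min 1 (ε / 12) with hδdef
  have hδ : 0 < δ := lt_min one_pos (by linarith)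
  have hδε : δ ≤ ε / 12 := min_le_right _ _
  obtain ⟨N₀, hN₀⟩ := eventually_atTop.1
    (eventually_one_sub_le_probCliqueNumEq hδ (min_le_left _ _) hη)
  filter_upwards [eventually_natLog_le (show 0 < ε / 2 by linarith) (3 + N₀)] with N hN
  have hsub : {n | probCliqueNumEq n (2 ^ ⌊logLevel n⌋₊) < 1 - η} ∩ Set.Icc 1 N ⊆
      ↑(({n ∈ Finset.Icc 1 N | n ∈ nearPowerSet δ} ∪ Finset.range N₀ : Finset ℕ)) := by
    rintro n ⟨hn, hnI⟩
    rw [Finset.coe_union]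
    rcases Nat.lt_or_ge n N₀ with h | h
    · exact Or.inr (by simpa using h)
    · refine Or.inl (Finset.mem_filter.2 ⟨by simpa using hnI, ?_⟩)
      by_contra hcon
      exact absurd (hN₀ n h (not_lt.1 hcon)) (not_le.2 hn)
  have h1 := Set.ncard_le_ncard hsub (Finset.finite_toSet _)
  rw [Set.ncard_coe_finset] at h1
  have h2 := h1.trans (Finset.card_union_le _ _)
  rw [Finset.card_range] at h2
  have h3 : (({n | probCliqueNumEq n (2 ^ ⌊logLevel n⌋₊) < 1 - η} ∩ Set.Icc 1 N).ncard : ℝ) ≤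
      Finset.card {n ∈ Finset.Icc 1 N | n ∈ nearPowerSet δ} + N₀ := by exact_mod_cast h2
  have h4 := card_filter_nearPowerSet_le hδ.le N
  have h5 : δ * N ≤ ε / 12 * N := by gcongr
  linarith

theorem hasNaturalDensity_one_of_compl {S : Set ℕ} (h : HasZeroDensity Sᶜ) :
    HasNaturalDensity S 1 := by
  have hcount : ∀ N : ℕ, ((S ∩ Set.Icc 1 N).ncard : ℝ) + (Sᶜ ∩ Set.Icc 1 N).ncard = N := by
    intro N
    have h1 := Set.ncard_inter_add_ncard_sdiff_eq_ncard (Set.Icc 1 N) S (Set.finite_Icc _ _)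
    have h2 : (Set.Icc 1 N).ncard = N := by
      rw [← Finset.coe_Icc, Set.ncard_coe_finset, Nat.card_Icc, Nat.add_sub_cancel]
    rw [h2, Set.inter_comm, Set.sdiff_eq, Set.inter_comm _ Sᶜ] at h1
    exact_mod_cast h1
  rw [HasNaturalDensity, Metric.tendsto_atTop']
  intro ε hε
  obtain ⟨N₀, hN₀⟩ := eventually_atTop.1 (h (ε / 2) (by linarith))
  refine ⟨N₀, fun N hN => ?_⟩
  have hNpos : (0 : ℝ) < N := by
    have : 0 < N := by omega
    exact_mod_cast this
  have h1 := hN₀ N hN.le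
  have h2 : ((S ∩ Set.Icc 1 N).ncard : ℝ) / N - 1 = -((Sᶜ ∩ Set.Icc 1 N).ncard / N) := by
    rw [div_sub_one hNpos.ne', ← neg_div]
    congr 1
    linarith [hcount N]
  rw [Real.dist_eq, h2, abs_neg, abs_of_nonneg (by positivity), div_lt_iff₀ hNpos]
  nlinarith

theorem infinite_of_hasNaturalDensity_one {S : Set ℕ} (h : HasNaturalDensity S 1) :
    S.Infinite := by
  intro hfin
  have h0 : Tendsto (fun N : ℕ => ((S ∩ Set.Icc 1 N).ncard : ℝ) / N) atTop (𝓝 0) := by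
    refine squeeze_zero (fun N => by positivity) (fun N => ?_)
      (tendsto_const_div_atTop_nhds_zero_nat (S.ncard : ℝ))
    gcongr
    exact Set.inter_subset_left
  exact one_ne_zero (tendsto_nhds_unique h h0)

/-- A diagonal choice: closeness 1/(j + 1) is demanded only from a threshold φ j on, past which the
j-th exceptional set has proportion at most 1/(j + 1) in every initial segment. -/
theorem exists_hasZeroDensity_compl_eventually {f : ℕ → ℝ}
    (h : ∀ η > 0, HasZeroDensity {n | f n < 1 - η}) :
    ∃ S : Set ℕ, (∀ n ∈ S, 2 ≤ n) ∧ HasZeroDensity Sᶜ ∧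
      ∀ η > 0, ∀ᶠ n in atTop, n ∈ S → 1 - η ≤ f n := by
  have hev : ∀ j : ℕ, ∀ᶠ M : ℕ in atTop, ∀ N ≥ M,
      (({n | f n < 1 - 1 / ((j : ℝ) + 1)} ∩ Set.Icc 1 N).ncard : ℝ) ≤ 1 / ((j : ℝ) + 1) * N :=
    fun j => eventually_forall_ge_atTop.2 (h _ Nat.one_div_pos_of_nat _ Nat.one_div_pos_of_nat)
  obtain ⟨φ, hφ, hφc⟩ := extraction_forall_of_eventually hev
  refine ⟨{n | 2 ≤ n ∧ ∀ j, φ j ≤ n → 1 - 1 / ((j : ℝ) + 1) ≤ f n}, fun n hn => hn.1, ?_, ?_⟩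
  · intro ε hε
    obtain ⟨j, hj⟩ := exists_nat_one_div_lt (show 0 < ε / 2 by linarith)
    filter_upwards [eventually_ge_atTop (φ j),
      (tendsto_natCast_atTop_atTop (R := ℝ)).eventually_ge_atTop (2 / ε * 2)] with N hN hN2
    -- The exceptional sets increase with j, so up to N only the last active one matters, together
    -- with the point 1 excluded by n ≥ 2.
    set J := Nat.findGreatest (fun i => φ i ≤ N) N with hJ
    have hJle : φ J ≤ N :=
      Nat.findGreatest_spec (P := fun i => φ i ≤ N) ((hφ.id_le j).trans hN) hN
    have hmax : ∀ i, φ i ≤ N → i ≤ J := fun i hi =>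
      Nat.le_findGreatest ((hφ.id_le i).trans hi) hi
    have hsub : {n | 2 ≤ n ∧ ∀ j, φ j ≤ n → 1 - 1 / ((j : ℝ) + 1) ≤ f n}ᶜ ∩ Set.Icc 1 N ⊆
        ({n | f n < 1 - 1 / ((J : ℝ) + 1)} ∩ Set.Icc 1 N) ∪ {1} := by
      rintro n ⟨hn, hnI⟩
      rw [Set.mem_compl_iff, Set.mem_ofPred_eq, not_and_or] at hn
      rcases hn with hn | hn
      · right
        rw [Set.mem_singleton_iff]
        have := hnI.1
        omega
      · left
        push Not at hn
        obtain ⟨i, hi, hfi⟩ := hn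
        refine ⟨hfi.trans_le ?_, hnI⟩
        have := hmax i (hi.trans hnI.2)
        gcongr
    have hfin : (({n | f n < 1 - 1 / ((J : ℝ) + 1)} ∩ Set.Icc 1 N) ∪ {1}).Finite :=
      ((Set.finite_Icc 1 N).inter_of_right _).union (Set.finite_singleton 1)
    have h1 := (Set.ncard_le_ncard hsub hfin).trans (Set.ncard_union_le _ _)
    rw [Set.ncard_singleton] at h1
    have h2 := hφc J N hJle
    have h3 : 1 / ((J : ℝ) + 1) ≤ 1 / ((j : ℝ) + 1) := by
      have := hmax j hN
      gcongr
    have h4 : (({n | 2 ≤ n ∧ ∀ j, φ j ≤ n → 1 - 1 / ((j : ℝ) + 1) ≤ f n}ᶜ ∩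
        Set.Icc 1 N).ncard : ℝ) ≤ (({n | f n < 1 - 1 / ((J : ℝ) + 1)} ∩ Set.Icc 1 N).ncard : ℝ) + 1 := by
      exact_mod_cast h1
    have h5 : 1 / ((J : ℝ) + 1) * N ≤ ε / 2 * N :=
      mul_le_mul_of_nonneg_right (h3.trans hj.le) N.cast_nonneg
    rw [div_mul_eq_mul_div, div_le_iff₀ hε] at hN2
    linarith
  · intro η hη
    obtain ⟨j, hj⟩ := exists_nat_one_div_lt hη
    filter_upwards [eventually_ge_atTop (φ j)] with n hn hnS
    linarith [hnS.2 j hn]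

theorem theorem3 :
    ∃ n : ℕ → ℕ, StrictMono n ∧ (∀ l, 2 ≤ n l) ∧ HasNaturalDensity (Set.range n) 1 ∧
      Tendsto
        (fun l => probCliqueNumEq (n l)
          (2 ^ ⌊Real.logb 2 (n l : ℝ) + Real.logb 2 (Real.logb 2 (n l : ℝ))⌋₊))
        atTop (𝓝 1) := by
  obtain ⟨S, hS2, hS0, hSf⟩ := exists_hasZeroDensity_compl_eventually
    (f := fun n => probCliqueNumEq n (2 ^ ⌊logLevel n⌋₊))
    (fun η hη => hasZeroDensity_probCliqueNumEq_lt hη)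
  have hS1 := hasNaturalDensity_one_of_compl hS0
  have hinf := infinite_of_hasNaturalDensity_one hS1
  have hmono : StrictMono (Nat.nth (· ∈ S)) := Nat.nth_strictMono hinf
  have hmem : ∀ l, Nat.nth (· ∈ S) l ∈ S := Nat.nth_mem_of_infinite hinf
  refine ⟨Nat.nth (· ∈ S), hmono, fun l => hS2 _ (hmem l), ?_, ?_⟩
  · have hr : Set.range (Nat.nth (· ∈ S)) = S := Nat.range_nth_of_infinite hinf
    rwa [hr]
  · rw [Metric.tendsto_nhds]
    intro ε hε
    filter_upwards [hmono.tendsto_atTop.eventually (hSf (ε / 2) (by linarith))] with l hl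
    have h1 := hl (hmem l)
    have h2 : probCliqueNumEq (Nat.nth (· ∈ S) l)
        (2 ^ ⌊logLevel (Nat.nth (· ∈ S) l)⌋₊) ≤ 1 := measureReal_le_one
    rw [Real.dist_eq, abs_lt]
    change 1 - ε / 2 ≤ probCliqueNumEq _ (2 ^ ⌊logLevel (Nat.nth (· ∈ S) l)⌋₊) at h1
    change -ε < probCliqueNumEq _ (2 ^ ⌊logLevel (Nat.nth (· ∈ S) l)⌋₊) - 1 ∧
      probCliqueNumEq _ (2 ^ ⌊logLevel (Nat.nth (· ∈ S) l)⌋₊) - 1 < ε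
    constructor <;> linarith
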